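/- Let $d\ge 1$, $1\le M<N$, and let $P^{n}_{\rm sym}=\frac1{n!}\sum_{\pi\in S_n}P(\pi)$ be the projector onto the symmetric subspace of $(\mathbb C^d)^{\otimes n}$, whose dimension is $D_n=\binom{n+d-1}{n}$. Let $(\alpha_x)_{x\subseteq\{1,\dots,N\}}$ satisfy $\alpha_x\ge 0$ and $\sum_x\alpha_x=1$. For a pure state $\psi$ write $\psi_x\otimes 1_{\bar x}$ for the operator on $N$ spins that is $|\psi\rangle\langle\psi|$ on the sites in $x$ and the identity elsewhere, and put $M(\psi)=\sum_x\alpha_x\,\psi_x\otimes 1_{\bar x}$. The ($M\to N$, universal, asymmetric) cloning fidelity of a quantum channel (completely positive trace-preserving map) $\mathcal E$ from $M$ spins to $N$ spins is $$F(\mathcal E)=\int \mathrm{Tr}\big(M(\psi)\,\mathcal E(|\psi\rangle\langle\psi|^{\otimes M})\big)\,d\psi ,$$ where $\psi=U|0\rangle$ with $U$ Haar distributed on $SU(d)$. Let $\lambda$ be the maximum eigenvalue of $$R=\sum_x\alpha_xR_x,\qquad R_x=D_M\int (|\psi\rangle\langle\psi|^{\otimes M})^{T}_{\rm IN}\otimes\psi_x\otimes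 1_{\bar x}\,d\psi$$ on the $M$ input and $N$ output spins. For $|x|=M$ let $|B_x\rangle=D_M^{-1/2}\sum_i|\phi_i\rangle_{\rm IN}|\phi_i\rangle_x$, with $(\phi_i)$ a real orthonormal basis of the symmetric subspace of $M$ spins, and for real $\beta=(\beta_x)_{|x|=M}$ let $A_\beta\Phi=\sum_{|x|=M}\beta_x|B_x\rangle|\Phi\rangle_{\bar x}$ for a state $\Phi$ of $N-M$ spins. Then: (1) $F(\mathcal E)\le\lambda$ for every channel $\mathcal E$, and this upper bound is always achieved, using the maximally mixed symmetric state on the remaining $N-M$ spins: there is $\beta\ge 0$ such that the state $\rho_\beta=A_\beta\,\frac{P^{N-M}_{\rm sym}}{D_{N-M}}\,A_\beta^\dagger$ is a mixture of maximum eigenvectors of $R$ (that is, $R\rho_\beta=\lambda\rho_\beta$), satisfies $\mathrm{Tr}_{\rm OUT}\,\rho_\beta=P^M_{\rm sym}/D_M$, and is the Choi state $(\mathrm{id}\otimes\mathcal E)(|B\rangle\langle B|)$, with $|B\rangle=D_M^{-1/2}\sum_i|\phi_i\rangle|\phi_i\rangle$ on two groups of $M$ spins, of a channel $\mathcal E$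 with $F(\mathcal E)=\lambda$. (2) Suppose that $d\ge 2$ and that every output site is assessed, i.e. every $n\in\{1,\dots,N\}$ lies in some $x$ with $\alpha_x>0$. If $F(\mathcal E)=\lambda$ for some economical (ancilla-free) channel $\mathcal E$, that is, one for which there is an isometry $V$ from $M$ spins to $N$ spins with $\mathcal E(X)=VXV^\dagger$ for all $X$ supported on the symmetric subspace, then $N\ge 3M$. -/

import Mathlib

open MeasureTheory
open scoped Matrix ComplexOrder

noncomputable section

namespace QClone

/-! ### The special unitary group and its Haar probability measure -/

/-- The compact group `SU(d)`. -/
abbrev SU (d : ℕ) : Type := Matrix.specialUnitaryGroup (Fin d) ℂ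

instance instInvSU (d : ℕ) : ContinuousInv (SU d) where
  continuous_inv := by
    have h : Continuous fun U : SU d => star (U : Matrix (Fin d) (Fin d) ℂ) :=
      continuous_subtype_val.star
    exact Continuous.subtype_mk h _

instance instTopGroupSU (d : ℕ) : IsTopologicalGroup (SU d) where

instance instCompactSU (d : ℕ) : CompactSpace (SU d) := by
  refine isCompact_iff_compactSpace.mp ?_
  have hK : IsCompact (Set.pi Set.univ fun _ : Fin d => Set.pi Set.univ
      fun _ : Fin d => Metric.closedBall (0 : ℂ) 1) :=
    isCompact_univ_pi fun _ => isCompact_univ_pi fun _ => isCompact_closedBall 0 1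
  refine hK.of_isClosed_subset ?_ ?_
  · have h1 : IsClosed {A : Matrix (Fin d) (Fin d) ℂ | A.det = 1} :=
      isClosed_eq (Continuous.matrix_det continuous_id) continuous_const
    exact (isClosed_unitary (R := Matrix (Fin d) (Fin d) ℂ)).inter h1
  · intro A hA
    refine Set.mem_univ_pi.mpr fun i => Set.mem_univ_pi.mpr fun j => ?_
    rw [mem_closedBall_zero_iff]
    exact entry_norm_bound_of_unitary hA.1 i j

instance instMeasurableSpaceSU (d : ℕ) : MeasurableSpace (SU d) := borel (SU d)

instance instBorelSpaceSU (d : ℕ) : BorelSpace (SU d) := ⟨rfl⟩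

/-- The Haar probability measure on `SU(d)`. -/
def haarSU (d : ℕ) : Measure (SU d) := Measure.haarMeasure ⊤

/-! ### Spins, the symmetric subspace, pure states -/

/-- The computational basis of `n` spins of dimension `d`: the space `(ℂ^d)^{⊗ n}` is the
space of functions `Conf d n → ℂ`, and its operators are matrices indexed by `Conf d n`. -/
abbrev Conf (d n : ℕ) : Type := Fin n → Fin d

/-- Operators on `n` spins. -/
abbrev Op (d n : ℕ) : Type := Matrix (Conf d n) (Conf d n) ℂ

/-- The operator `P(π)` that permutes the tensor factors. -/
def permOp (d n : ℕ) (π : Equiv.Perm (Fin n)) : Op d n :=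
  Matrix.of fun a b => if a = b ∘ π then 1 else 0

/-- The projector `P_sym^n = (1/n!) ∑_π P(π)` onto the symmetric subspace of `n` spins. -/
def symProj (d n : ℕ) : Op d n :=
  ((n.factorial : ℂ)⁻¹) • ∑ π : Equiv.Perm (Fin n), permOp d n π

/-- `binom (n+d-1) n`, the dimension of the symmetric subspace of `n` spins (for `d ≥ 1`). -/
def symDim (d n : ℕ) : ℕ := (n + d - 1).choose n

/-- The one-spin pure state `U|0⟩`. -/
def pureState {d : ℕ} [NeZero d] (U : SU d) : Fin d → ℂ :=
  fun i => (U : Matrix (Fin d) (Fin d) ℂ) i 0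

/-- The projector `(|ψ⟩⟨ψ|)^{⊗ n}`. -/
def copies {d : ℕ} (n : ℕ) (ψ : Fin d → ℂ) : Op d n :=
  Matrix.of fun a b => ∏ k, ψ (a k) * star (ψ (b k))

/-- The operator `|ψ⟩⟨ψ|_x ⊗ 1_{x̄}` on `n` spins, `x` being a set of sites. -/
def copiesOn {d n : ℕ} (x : Finset (Fin n)) (ψ : Fin d → ℂ) : Op d n :=
  Matrix.of fun a b => ∏ k, if k ∈ x then ψ (a k) * star (ψ (b k))
    else if a k = b k then 1 else 0

/-! ### Quantum channels and the cloning fidelity -/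

/-- `id_k ⊗ E` applied to an operator on `ℂ^k ⊗ (ℂ^d)^{⊗ M}`. -/
def ampliate {d M N : ℕ} (E : Op d M →ₗ[ℂ] Op d N) (k : ℕ)
    (X : Matrix (Fin k × Conf d M) (Fin k × Conf d M) ℂ) :
    Matrix (Fin k × Conf d N) (Fin k × Conf d N) ℂ :=
  Matrix.of fun p q => E (Matrix.of fun a a' => X (p.1, a) (q.1, a')) p.2 q.2

/-- Quantum channels from `M` spins to `N` spins: completely positive trace-preserving maps. -/
structure IsChannel {d M N : ℕ} (E : Op d M →ₗ[ℂ] Op d N) : Prop where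
  completelyPositive : ∀ (k : ℕ) (X : Matrix (Fin k × Conf d M) (Fin k × Conf d M) ℂ),
    X.PosSemidef → (ampliate E k X).PosSemidef
  tracePreserving : ∀ X : Op d M, (E X).trace = X.trace

/-- A channel is economical (ancilla-free) when, on operators supported on the symmetric
subspace of the inputs, it is conjugation by an isometry; equivalently, by a unitary on the `N`
output spins, after padding the input with `N - M` spins in a fixed pure state. -/
def IsEconomical {d M N : ℕ} (E : Op d M →ₗ[ℂ] Op d N) : Prop :=
  ∃ V : Matrix (Conf d N) (Conf d M) ℂ, Vᴴ * V = 1 ∧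
    ∀ X : Op d M, symProj d M * X * symProj d M = X → E X = V * X * Vᴴ

/-- The measurement operator `M(ψ) = ∑_x α_x |ψ⟩⟨ψ|_x ⊗ 1_{x̄}`. -/
def measOp {d N : ℕ} (α : Finset (Fin N) → ℝ) (ψ : Fin d → ℂ) : Op d N :=
  ∑ x, (α x : ℂ) • copiesOn x ψ

/-- The cloning fidelity `∫ Tr(M(ψ) E(ψ^{⊗ M})) dψ`, `ψ = U|0⟩` with `U` Haar distributed. -/
def cloningFidelity {d M N : ℕ} [NeZero d] (α : Finset (Fin N) → ℝ)
    (E : Op d M →ₗ[ℂ] Op d N) : ℝ :=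
  ∫ U : SU d, (measOp α (pureState U) * E (copies M (pureState U))).trace.re ∂(haarSU d)

/-! ### The operator `R` and the Choi state -/

/-- Operators on IN ⊗ OUT, that is on `M` input and `N` output spins. -/
abbrev JointOp (d M N : ℕ) : Type := Matrix (Conf d M × Conf d N) (Conf d M × Conf d N) ℂ

/-- `R_x = d' ∫ (ψ^{⊗ M})ᵀ_IN ⊗ |ψ⟩⟨ψ|_x ⊗ 1_{x̄} dψ`, with `d' = binom (M+d-1) M`. -/
def cloningOpOn (d M : ℕ) {N : ℕ} [NeZero d] (x : Finset (Fin N)) : JointOp d M N :=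
  Matrix.of fun p q => (symDim d M : ℂ) * ∫ U : SU d,
    (copies M (pureState U))ᵀ p.1 q.1 * copiesOn x (pureState U) p.2 q.2 ∂(haarSU d)

/-- `R = ∑_x α_x R_x`. -/
def cloningOp (d M : ℕ) {N : ℕ} [NeZero d] (α : Finset (Fin N) → ℝ) : JointOp d M N :=
  ∑ x, (α x : ℂ) • cloningOpOn d M x

/-- `lam` is the maximum eigenvalue of `R`. -/
def IsMaxEigenvalue {ι : Type} [Fintype ι] [DecidableEq ι] (R : Matrix ι ι ℂ) (lam : ℝ) : Prop :=
  IsGreatest {μ : ℝ | Module.End.HasEigenvalue (Matrix.toLin' R) (μ : ℂ)} lam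

/-- The Bell state `|B^{(M)}⟩ = d'^{-1/2} ∑_i |φ_i⟩|φ_i⟩` of two groups of `M` spins, `φ_i`
ranging over an orthonormal basis of the symmetric subspace with real entries: its amplitudes
are those of `P_sym^M`, divided by `√d'`. -/
def bell (d M : ℕ) (a c : Conf d M) : ℂ :=
  ((Real.sqrt (symDim d M) : ℝ) : ℂ)⁻¹ * symProj d M a c

/-- The Choi state `(id ⊗ E)(|B^{(M)}⟩⟨B^{(M)}|)` on IN ⊗ OUT. -/
def choiState {d M N : ℕ} (E : Op d M →ₗ[ℂ] Op d N) : JointOp d M N :=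
  Matrix.of fun p q =>
    E (Matrix.of fun c c' => bell d M p.1 c * star (bell d M q.1 c')) p.2 q.2

/-- The partial trace over OUT. -/
def traceOut {d M N : ℕ} (ρ : JointOp d M N) : Op d M :=
  Matrix.of fun a a' => ∑ b, ρ (a, b) (a', b)

/-! ### The family of states `∑_x β_x |B_x⟩|Φ⟩_{x̄}` -/

/-- Subsets of `M` of the `N` output sites (bit strings of Hamming weight `M`). -/
abbrev Sites (M N : ℕ) : Type := {x : Finset (Fin N) // x.card = M}

/-- The restriction of a configuration of `N` spins to the sites of `x`, in increasing order. -/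
def onSites {d M N : ℕ} (x : Sites M N) (b : Conf d N) : Conf d M :=
  fun k => b (x.1.orderEmbOfFin x.2 k)

/-- The restriction of a configuration of `N` spins to the sites outside `x`. -/
def offSites {d M N : ℕ} (x : Sites M N) (b : Conf d N) : Conf d (N - M) :=
  fun k => b (x.1ᶜ.orderEmbOfFin (by rw [Finset.card_compl, Fintype.card_fin, x.2]) k)

/-- The linear map `Φ ↦ ∑_x β_x |B_x⟩_{IN,x} |Φ⟩_{x̄}` from `N - M` spins to IN ⊗ OUT. -/
def cloneVec (d M N : ℕ) (β : Sites M N → ℝ) :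
    Matrix (Conf d M × Conf d N) (Conf d (N - M)) ℂ :=
  Matrix.of fun p c => ∑ x : Sites M N,
    (β x : ℂ) * (bell d M p.1 (onSites x p.2) * if offSites x p.2 = c then 1 else 0)

/-- The mixture of the states `∑_x β_x |B_x⟩|Φ⟩_{x̄}` in which `|Φ⟩⟨Φ|` is replaced by the maximally
mixed symmetric state `P_sym^{N-M} / binom (N-M+d-1) (N-M)` of the remaining `N - M` spins. -/
def mixedCloneState (d M N : ℕ) (β : Sites M N → ℝ) : JointOp d M N :=
  cloneVec d M N β * ((symDim d (N - M) : ℂ)⁻¹ • symProj d (N - M)) * (cloneVec d M N β)ᴴ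

end QClone

end

open QClone

set_option linter.unusedSectionVars false
set_option linter.unusedSimpArgs false

noncomputable section

namespace QClone

/-! ### Types of configurations -/

/-! Everything is reduced to types, that is, to multisets of letters. Symmetric vectors are
functions of the type, and a Haar moment of the components of `ψ` vanishes unless the two types
agree, in which case it is fixed by the unitary symmetry (`moment_eq_zero`, `mu_eq`). Hence `R` is a
real symmetric matrix with nonnegative entries (`cloningOp_eq`), and the fidelity is its expectation
value in the Choi state, a positive operator of trace one (`cloningFidelity_eq`). The bound by the
maximum eigenvalue follows.

Attainment is a Perron-Frobenius argument. `R` maps the vectors `∑_y β_y |B_y⟩|Φ_τ⟩`, with `Φ_τ` the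
symmetric vector of type `τ`, into themselves, and acts on `β` by a nonnegative matrix that does not
depend on `τ` (`cloneMat_mulVec_uvec`). `R` also commutes with the action of the matrix units, in
which IN carries the conjugate representation. Raising operators therefore turn any maximum
eigenvector into one of nonnegative weight (`exists_raise`), which lives in the sector where OUT has
the letters of IN together with some `τ`. There it is dominated by the vector with all `β_y = 1`.
Iterating `R` shows that the matrix acting on `β` grows at least as fast as powers of `lam`, which
yields `β ≥ 0` with image at least `lam • β` (`exists_le_mulVec`). Since `lam` is maximal, the
inequality for the vectors of `R` is an equality, for every `τ` at once (`exists_optimal`).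
Averaging over symmetric `Φ` makes the reduced state on IN a multiple of the symmetric projector, so
after normalisation the mixture is a Choi state (`exists_channel_of_choi`).

For an economical cloner the Choi state is pure, hence a single maximum eigenvector. When all sites
are assessed, `R` is irreducible on each sector (`linked_of_type_eq`), so the `β_y` are positive and
this eigenvector is `∑_y β_y |B_y⟩|Φ⟩` for one symmetric `Φ` (`exists_phi`). Its reduced state on IN
must be maximally mixed. Written with the deviations `omega` of the reduced states of `Φ` from the
maximally mixed ones, this condition, paired with the deviation on `K = min M (N - M)` spins,
becomes a positive combination of squared norms equal to zero (`omega_eq_zero`). So `K` of the `N -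
M` spins of `Φ` are maximally mixed, and comparing Schmidt ranks gives `K ≤ N - M - K`. This rules
out `K = N - M`, and with `K = M` it says `3 * M ≤ N`. -/

/-- The type of a configuration on a set of sites: the multiset of the letters found there. -/
def tyOn {ι : Type*} {d : ℕ} (s : Finset ι) (c : ι → Fin d) : Multiset (Fin d) := s.val.map c

/-- The type of a configuration: the multiset of its letters. -/
abbrev ty {ι : Type*} [Fintype ι] {d : ℕ} (c : ι → Fin d) : Multiset (Fin d) :=
  tyOn Finset.univ c

section Types

variable {ι : Type*} {d : ℕ}

lemma card_tyOn (s : Finset ι) (c : ι → Fin d) : (tyOn s c).card = s.card := by simp [tyOn]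

lemma card_ty {n : ℕ} (c : Conf d n) : (ty c).card = n := by simp [card_tyOn]

lemma tyOn_congr {s : Finset ι} {c c' : ι → Fin d} (h : ∀ k ∈ s, c k = c' k) :
    tyOn s c = tyOn s c' := Multiset.map_congr rfl h

lemma count_tyOn (s : Finset ι) (c : ι → Fin d) (i : Fin d) :
    (tyOn s c).count i = (s.filter fun k => c k = i).card := by
  simp only [tyOn, Multiset.count_map, eq_comm (a := i)]
  rfl

lemma mem_tyOn {s : Finset ι} {c : ι → Fin d} {i : Fin d} :
    i ∈ tyOn s c ↔ ∃ k ∈ s, c k = i := by simp [tyOn]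

/-- The number of subsets carrying a type depends on `b` only through its type on `X`. This is what
allows the count to be treated as a function of the type in `sum_free`. -/
lemma card_subsets_eq_count (X : Finset ι) (M : ℕ) (b : ι → Fin d) (m : Multiset (Fin d)) :
    ((X.powersetCard M).filter fun z => tyOn z b = m).card =
      ((tyOn X b).powersetCard M).count m := by
  rw [tyOn, Multiset.powersetCard_map, ← Finset.map_val_val_powersetCard, Multiset.map_map,
    Multiset.count_map]
  simp only [eq_comm (a := m)]
  rfl

variable [DecidableEq ι]

lemma tyOn_insert {k : ι} {s : Finset ι} (hk : k ∉ s) (c : ι → Fin d) :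
    tyOn (insert k s) c = c k ::ₘ tyOn s c := by
  simp [tyOn, Finset.insert_val_of_notMem hk]

lemma tyOn_union {s t : Finset ι} (h : Disjoint s t) (c : ι → Fin d) :
    tyOn (s ∪ t) c = tyOn s c + tyOn t c := by
  rw [← Finset.disjUnion_eq_union s t h, tyOn, Finset.disjUnion_val, Multiset.map_add]
  rfl

lemma tyOn_add_sdiff {s t : Finset ι} (h : s ⊆ t) (c : ι → Fin d) :
    tyOn s c + tyOn (t \ s) c = tyOn t c := by
  rw [← tyOn_union Finset.disjoint_sdiff, Finset.union_sdiff_of_subset h]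

lemma tyOn_add_compl [Fintype ι] (s : Finset ι) (c : ι → Fin d) :
    tyOn s c + tyOn sᶜ c = ty c := by
  rw [← tyOn_union disjoint_compl_right, Finset.union_compl]

lemma tyOn_update {s : Finset ι} {k : ι} (hk : k ∈ s) (c : ι → Fin d) (j : Fin d) :
    tyOn s (Function.update c k j) + {c k} = tyOn s c + {j} := by
  rw [← Finset.insert_erase hk, tyOn_insert (Finset.notMem_erase k s),
    tyOn_insert (Finset.notMem_erase k s), Function.update_self,
    tyOn_congr (c := Function.update c k j) (c' := c)]
  · simp only [← Multiset.singleton_add]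
    abel
  · intro l hl
    exact Function.update_of_ne (Finset.ne_of_mem_erase hl) _ _

end Types

lemma ty_cons {d n : ℕ} (j : Fin d) (c : Conf d n) :
    ty (Fin.cons j c : Conf d (n + 1)) = j ::ₘ ty c := by
  simp [ty, tyOn, Fin.univ_succ]

lemma exists_ty_eq {d : ℕ} (n : ℕ) (m : Multiset (Fin d)) (hm : m.card = n) :
    ∃ c : Conf d n, ty c = m := by
  induction n generalizing m with
  | zero =>
    refine ⟨Fin.elim0, ?_⟩
    rw [Multiset.card_eq_zero.mp hm]
    simp [ty, tyOn]
  | succ n ih =>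
    obtain ⟨j, hj⟩ := Multiset.card_pos_iff_exists_mem.mp (by omega : 0 < m.card)
    obtain ⟨m', rfl⟩ := Multiset.exists_cons_of_mem hj
    obtain ⟨c, hc⟩ := ih m' (by simpa using hm)
    exact ⟨Fin.cons j c, by rw [ty_cons, hc]⟩

/-- Each letter occupies equally many sites in both configurations, so bijections between the fibres
glue to a permutation. -/
lemma exists_perm_of_ty_eq {ι : Type*} [Fintype ι] [DecidableEq ι] {d : ℕ} {s t : ι → Fin d}
    (h : ty s = ty t) : ∃ π : Equiv.Perm ι, s = t ∘ π := by
  have hc : ∀ i, Fintype.card {k // s k = i} = Fintype.card {k // t k = i} := by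
    intro i
    rw [Fintype.card_subtype, Fintype.card_subtype, ← count_tyOn, ← count_tyOn]
    exact congrArg _ h
  refine ⟨Equiv.ofFiberEquiv (f := s) (g := t) fun i => Fintype.equivOfCardEq (hc i), ?_⟩
  funext k
  exact (Equiv.ofFiberEquiv_map _ k).symm

lemma ty_comp_perm {ι : Type*} [Fintype ι] {d : ℕ} (t : ι → Fin d) (π : Equiv.Perm ι) :
    ty (t ∘ π) = ty t := by
  have := Multiset.map_univ_val_equiv π
  rw [ty, tyOn, ← Multiset.map_map, this]
  rfl

/-! ### Sums over configurations of functions of the type -/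

/-- The sum over all configurations of a function of the type. -/
def csum {A : Type*} [AddCommMonoid A] (d n : ℕ) (F : Multiset (Fin d) → A) : A :=
  ∑ c : Conf d n, F (ty c)

section csum

variable {A : Type*} [AddCommMonoid A] {d : ℕ}

lemma csum_congr {n : ℕ} {F G : Multiset (Fin d) → A} (h : ∀ m, m.card = n → F m = G m) :
    csum d n F = csum d n G := Finset.sum_congr rfl fun c _ => h _ (card_ty c)

lemma csum_zero (F : Multiset (Fin d) → A) : csum d 0 F = F 0 := by
  simp [csum, ty, tyOn]

lemma csum_succ (n : ℕ) (F : Multiset (Fin d) → A) :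
    csum d (n + 1) F = ∑ j, csum d n fun m => F (j ::ₘ m) := by
  simp only [csum]
  rw [← Fintype.sum_prod_type', ← (Fin.consEquiv fun _ : Fin (n + 1) => Fin d).sum_comp]
  refine Finset.sum_congr rfl fun p _ => ?_
  rw [← ty_cons]
  rfl

lemma csum_add (m n : ℕ) (F : Multiset (Fin d) → A) :
    csum d (m + n) F = csum d m fun a => csum d n fun b => F (a + b) := by
  induction m generalizing F with
  | zero => simp [csum_zero]
  | succ m ih =>
    rw [show m + 1 + n = m + n + 1 by omega, csum_succ, csum_succ]
    refine Finset.sum_congr rfl fun j _ => ?_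
    rw [ih]
    simp only [Multiset.cons_add]

lemma csum_comm (m n : ℕ) (F : Multiset (Fin d) → Multiset (Fin d) → A) :
    (csum d m fun a => csum d n fun b => F a b) = csum d n fun b => csum d m fun a => F a b :=
  Finset.sum_comm

lemma csum_sum {κ : Type*} (s : Finset κ) (n : ℕ) (F : κ → Multiset (Fin d) → A) :
    (csum d n fun a => ∑ x ∈ s, F x a) = ∑ x ∈ s, csum d n (F x) :=
  Finset.sum_comm

lemma mul_csum {B : Type*} [NonUnitalNonAssocSemiring B] (n : ℕ) (z : B)
    (F : Multiset (Fin d) → B) : z * csum d n F = csum d n fun m => z * F m := by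
  simp [csum, Finset.mul_sum]

lemma csum_mul {B : Type*} [NonUnitalNonAssocSemiring B] (n : ℕ) (z : B)
    (F : Multiset (Fin d) → B) : csum d n F * z = csum d n fun m => F m * z := by
  simp [csum, Finset.sum_mul]

end csum

/-- The number of configurations of `n` spins of a given type. -/
def cnt (d n : ℕ) (m : Multiset (Fin d)) : ℕ := csum d n fun m' => if m' = m then 1 else 0

lemma cnt_eq_card {d n : ℕ} (m : Multiset (Fin d)) :
    cnt d n m = (Finset.univ.filter fun c : Conf d n => ty c = m).card := by
  simp [cnt, csum]

lemma cnt_pos {d n : ℕ} {m : Multiset (Fin d)} (hm : m.card = n) : 0 < cnt d n m := by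
  obtain ⟨c, hc⟩ := exists_ty_eq n m hm
  rw [cnt_eq_card]
  exact Finset.card_pos.mpr ⟨c, by simpa using hc⟩

lemma cnt_ne_zero {d n : ℕ} {m : Multiset (Fin d)} (hm : m.card = n) {K : Type*} [Semiring K]
    [CharZero K] : (cnt d n m : K) ≠ 0 := Nat.cast_ne_zero.mpr (cnt_pos hm).ne'

lemma csum_ite_eq {d n : ℕ} {K : Type*} [Semiring K] (m : Multiset (Fin d)) (F : Multiset (Fin d) → K) :
    (csum d n fun m' => if m' = m then F m' else 0) = cnt d n m * F m := by
  rw [cnt, csum, csum, Nat.cast_sum, Finset.sum_mul]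
  refine Finset.sum_congr rfl fun c _ => ?_
  by_cases h : ty c = m <;> simp [h]

/-! ### Sums over the letters on a set of sites -/

section free

variable {ι : Type*} [Fintype ι] [DecidableEq ι] {d : ℕ}

/-- The configurations that agree with `b` outside `X`. -/
def free (X : Finset ι) (b : ι → Fin d) : Finset (ι → Fin d) :=
  Finset.univ.filter fun b' => ∀ k, k ∉ X → b' k = b k

lemma mem_free {X : Finset ι} {b b' : ι → Fin d} : b' ∈ free X b ↔ ∀ k, k ∉ X → b' k = b k := by
  simp [free]

lemma free_univ (b : ι → Fin d) : free Finset.univ b = Finset.univ := by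
  ext; simp [free]

variable {A : Type*} [AddCommMonoid A]

lemma sum_free_insert {X : Finset ι} {k : ι} (hk : k ∉ X) (b : ι → Fin d)
    (F : (ι → Fin d) → A) :
    ∑ b' ∈ free (insert k X) b, F b' = ∑ j, ∑ b' ∈ free X (Function.update b k j), F b' := by
  rw [← Finset.sum_fiberwise (free (insert k X) b) (fun b' => b' k)]
  refine Finset.sum_congr rfl fun j _ => Finset.sum_congr ?_ fun _ _ => rfl
  ext b'
  simp only [Finset.mem_filter, mem_free, Finset.mem_insert, not_or]
  constructor
  · rintro ⟨h, rfl⟩ l hl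
    by_cases hlk : l = k
    · subst hlk; simp
    · rw [Function.update_of_ne hlk]; exact h l ⟨hlk, hl⟩
  · intro h
    refine ⟨fun l hl => ?_, ?_⟩
    · rw [h l hl.2, Function.update_of_ne hl.1]
    · rw [h k hk, Function.update_self]

/-- Summing the letters on `X` freely turns a sum over configurations into a sum over types, with no
reference to how `X` sits among the sites. Removing a site changes both the frozen configuration and
the function of the type, so both are generalised in the induction. -/
lemma sum_free {X : Finset ι} {b : ι → Fin d} {F : (ι → Fin d) → A}
    {H : Multiset (Fin d) → A} (h : ∀ b' ∈ free X b, F b' = H (tyOn X b')) :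
    ∑ b' ∈ free X b, F b' = csum d X.card H := by
  induction X using Finset.induction_on generalizing b H with
  | empty =>
    have : free ∅ b = {b} := by
      ext b'; simp [mem_free, funext_iff]
    rw [this, Finset.sum_singleton, h b (by simp [this])]
    simp [csum_zero, tyOn]
  | insert k X hk ih =>
    rw [sum_free_insert hk, Finset.card_insert_of_notMem hk, csum_succ]
    refine Finset.sum_congr rfl fun j _ => ih fun b' hb' => ?_
    rw [mem_free] at hb'
    rw [h b', tyOn_insert hk, hb' k hk, Function.update_self]
    rw [mem_free]
    intro l hl
    rw [Finset.mem_insert, not_or] at hl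
    rw [hb' l hl.2, Function.update_of_ne hl.1]

lemma sum_free_union {s t : Finset ι} (hst : Disjoint s t) (b : ι → Fin d)
    (F : (ι → Fin d) → A) :
    ∑ b' ∈ free (s ∪ t) b, F b' = ∑ b' ∈ free t b, ∑ b'' ∈ free s b', F b'' := by
  induction t using Finset.induction_on generalizing b with
  | empty =>
    have : free ∅ b = {b} := by
      ext b'; simp [mem_free, funext_iff]
    simp [this]
  | insert k t hk ih =>
    rw [Finset.disjoint_insert_right] at hst
    rw [Finset.union_insert, sum_free_insert (by simp [hk, hst.1]), sum_free_insert hk]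
    exact Finset.sum_congr rfl fun j _ => ih hst.2 _

/-- Counting the subsets of sites that carry a given type. -/
lemma cnt_mul_card_subsets (X : Finset ι) (M : ℕ) (b : ι → Fin d) (m : Multiset (Fin d)) :
    cnt d X.card (tyOn X b) * ((X.powersetCard M).filter fun z => tyOn z b = m).card =
      X.card.choose M * (cnt d M m *
        csum d (X.card - M) fun r => if m + r = tyOn X b then 1 else 0) := by
  -- Double counting of pairs (arrangement of the letters on `X` with the given type, subset `z` of
  -- type `m`). Summed over `z` first, each arrangement contributes the same number; summed over
  -- arrangements first, each `z` contributes the same number.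
  have h1 : ∑ b' ∈ free X b, (if tyOn X b' = tyOn X b then
      ((X.powersetCard M).filter fun z => tyOn z b' = m).card else 0) =
      cnt d X.card (tyOn X b) * ((X.powersetCard M).filter fun z => tyOn z b = m).card := by
    rw [sum_free (H := fun m' => if m' = tyOn X b then (m'.powersetCard M).count m else 0)]
    · rw [csum_ite_eq, card_subsets_eq_count]
      simp
    · intro b' _
      simp only [card_subsets_eq_count]
  rw [← h1]
  simp only [Finset.card_filter, Finset.ite_sum_zero]
  rw [Finset.sum_comm, Finset.sum_congr rfl (g := fun _ => cnt d M m *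
        csum d (X.card - M) fun r => if m + r = tyOn X b then 1 else 0)]
  · simp
  · intro z hz
    rw [Finset.mem_powersetCard] at hz
    obtain ⟨hzX, rfl⟩ := hz
    rw [← Finset.card_sdiff_of_subset hzX]
    conv_lhs => rw [show free X b = free (z ∪ X \ z) b by rw [Finset.union_sdiff_of_subset hzX]]
    rw [sum_free_union Finset.disjoint_sdiff]
    have h2 : ∀ b' : ι → Fin d, ∑ b'' ∈ free z b', (if tyOn X b'' = tyOn X b then
        if tyOn z b'' = m then 1 else 0 else 0) =
        cnt d z.card m * if m + tyOn (X \ z) b' = tyOn X b then 1 else 0 := by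
      intro b'
      rw [sum_free (H := fun m' => if m' = m then
        (if m' + tyOn (X \ z) b' = tyOn X b then 1 else 0) else 0), csum_ite_eq]
      · simp
      · intro b'' hb''
        rw [mem_free] at hb''
        rw [← tyOn_add_sdiff hzX b'', tyOn_congr (s := X \ z) (c' := b')]
        · split_ifs <;> rfl
        · intro k hk
          exact hb'' k (Finset.mem_sdiff.mp hk).2
    simp only [h2]
    rw [← Finset.mul_sum]
    congr 1
    exact sum_free fun _ _ => rfl

end free

/-- Removing one letter from a type. -/
lemma cnt_cons_mul_count {d n : ℕ} (m : Multiset (Fin d)) (i : Fin d) (hm : m.card = n) :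
    cnt d (n + 1) (i ::ₘ m) * (i ::ₘ m).count i = (n + 1) * cnt d n m := by
  obtain ⟨b, hb⟩ := exists_ty_eq (n + 1) (i ::ₘ m) (by simp [hm])
  -- The double count for one-element subsets: choosing a site with letter `i` leaves an arbitrary
  -- arrangement of type `m`.
  have h := cnt_mul_card_subsets Finset.univ 1 b {i}
  rw [card_subsets_eq_count, ← ty, hb] at h
  simp only [Finset.card_univ, Fintype.card_fin, Nat.choose_one_right, Nat.add_sub_cancel] at h
  rw [Multiset.powersetCard_one, Multiset.count_map_eq_count' _ _
    (fun a b hab => Multiset.singleton_inj.mp hab)] at h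
  rw [h]
  have h1 : cnt d 1 {i} = 1 := by
    rw [cnt, csum_succ]
    simp [csum_zero]
  rw [h1, one_mul, cnt]
  simp

/-! ### The projector onto the symmetric subspace -/

/-- The permutations carrying `t` to `s` exist only for equal types, and their number is the same
for every `s` of that type (a coset of the stabiliser). The `n!` permutations are thus shared
equally by the `cnt` arrangements. -/
lemma symProj_apply {d n : ℕ} (s t : Conf d n) :
    symProj d n s t = if ty s = ty t then (cnt d n (ty s) : ℂ)⁻¹ else 0 := by
  have h0 : symProj d n s t = (n.factorial : ℂ)⁻¹ *
      ((Finset.univ.filter fun π : Equiv.Perm (Fin n) => s = t ∘ π).card : ℂ) := by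
    simp [symProj, permOp, Matrix.sum_apply]
  have hz : ∀ s : Conf d n, ty s ≠ ty t →
      (Finset.univ.filter fun π : Equiv.Perm (Fin n) => s = t ∘ π).card = 0 := by
    intro s hs
    rw [Finset.card_eq_zero, Finset.filter_eq_empty_iff]
    rintro π - rfl
    exact hs (ty_comp_perm t π)
  split_ifs with h
  -- Composing with a permutation that relates `s'` and `s` is a bijection between the two sets of
  -- permutations.
  · have hconst : ∀ s' : Conf d n, ty s' = ty t →
        (Finset.univ.filter fun π : Equiv.Perm (Fin n) => s' = t ∘ π).card =
        (Finset.univ.filter fun π : Equiv.Perm (Fin n) => s = t ∘ π).card := by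
      intro s' hs'
      obtain ⟨σ, rfl⟩ := exists_perm_of_ty_eq (hs'.trans h.symm)
      refine Finset.card_bij' (fun π _ => π * σ⁻¹) (fun π _ => π * σ) ?_ ?_ ?_ ?_
      · intro π hπ
        simp only [Finset.mem_filter, Finset.mem_univ, true_and] at hπ ⊢
        funext k
        simpa using congrFun hπ (σ⁻¹ k)
      · intro π hπ
        simp only [Finset.mem_filter, Finset.mem_univ, true_and] at hπ ⊢
        funext k
        simpa using congrFun hπ (σ k)
      · intro π _; simp
      · intro π _; simp
    have htot : ∑ s' : Conf d n,
        (Finset.univ.filter fun π : Equiv.Perm (Fin n) => s' = t ∘ π).card = n.factorial := by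
      have := Finset.card_eq_sum_card_fiberwise (s := (Finset.univ : Finset (Equiv.Perm (Fin n))))
        (t := (Finset.univ : Finset (Conf d n))) (f := fun π : Equiv.Perm (Fin n) => t ∘ π)
        (by intro; simp)
      rw [Finset.card_univ, Fintype.card_perm, Fintype.card_fin] at this
      rw [this]
      simp only [eq_comm]
    have hmul : cnt d n (ty s) *
        (Finset.univ.filter fun π : Equiv.Perm (Fin n) => s = t ∘ π).card = n.factorial := by
      rw [← htot, cnt_eq_card, ← smul_eq_mul, ← Finset.sum_const, Finset.sum_filter]
      refine Finset.sum_congr rfl fun s' _ => ?_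
      split_ifs with h'
      · exact (hconst s' (h'.trans h)).symm
      · exact (hz s' (h ▸ h')).symm
    rw [h0, ← hmul]
    have h1 := cnt_ne_zero (K := ℂ) (card_ty s)
    have h2 : ((Finset.univ.filter fun π : Equiv.Perm (Fin n) => s = t ∘ π).card : ℂ) ≠ 0 := by
      intro h2
      rw [Nat.cast_eq_zero] at h2
      rw [h2, mul_zero] at hmul
      exact n.factorial_ne_zero hmul.symm
    push_cast
    field_simp
  · rw [h0, hz s h]
    simp

/-- The type of a configuration, with the number of spins recorded. -/
def tySym {d n : ℕ} (c : Conf d n) : Sym (Fin d) n := ⟨ty c, card_ty c⟩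

/-- Each type contributes `cnt` copies of `cnt⁻¹`, so the sum counts the types; these are the
elements of `Sym (Fin d) n`. -/
lemma sum_inv_cnt (d n : ℕ) :
    (csum d n fun m => (cnt d n m : ℂ)⁻¹) = symDim d n := by
  have h1 : (csum d n fun m => (cnt d n m : ℂ)⁻¹) =
      ∑ m : Sym (Fin d) n, (1 : ℂ) := by
    rw [csum, ← Finset.sum_fiberwise Finset.univ
      tySym]
    refine Finset.sum_congr rfl fun m _ => ?_
    rw [Finset.sum_congr rfl (g := fun _ => (cnt d n m.1 : ℂ)⁻¹), Finset.sum_const, nsmul_eq_mul]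
    · have : (Finset.univ.filter fun c : Conf d n => tySym c = m).card
          = cnt d n m.1 := by
        rw [cnt_eq_card]
        exact congrArg _ (Finset.filter_congr fun c _ => Subtype.ext_iff)
      rw [this, mul_inv_cancel₀ (cnt_ne_zero m.2)]
    · intro c hc
      rw [← (Finset.mem_filter.mp hc).2, tySym]
  rw [h1, Finset.sum_const, nsmul_eq_mul, mul_one, Finset.card_univ, Sym.card_sym_eq_choose,
    Fintype.card_fin, symDim, Nat.add_comm]

lemma symDim_pos (d n : ℕ) (hd : 0 < d) : 0 < symDim d n :=
  Nat.choose_pos (Nat.le_pred_of_lt (Nat.lt_add_of_pos_right hd))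

lemma trace_symProj (d n : ℕ) : (symProj d n).trace = symDim d n := by
  rw [← sum_inv_cnt d n]
  simp [Matrix.trace, symProj_apply, csum]

/-! ### Tensor products of one-site matrices -/

section Tensor

variable {ι : Type*} [Fintype ι] {d : ℕ}

/-- The tensor product of one-site matrices. -/
def tensorMat (A : ι → Matrix (Fin d) (Fin d) ℂ) : Matrix (ι → Fin d) (ι → Fin d) ℂ :=
  Matrix.of fun s t => ∏ k, A k (s k) (t k)

lemma tensorMat_conjTranspose (A : ι → Matrix (Fin d) (Fin d) ℂ) :
    (tensorMat A)ᴴ = tensorMat fun k => (A k)ᴴ := by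
  ext s t
  simp [tensorMat, Matrix.conjTranspose_apply]

variable [DecidableEq ι]

lemma tensorMat_mul (A B : ι → Matrix (Fin d) (Fin d) ℂ) :
    tensorMat A * tensorMat B = tensorMat (A * B) := by
  ext s t
  simp only [tensorMat, Matrix.mul_apply, Matrix.of_apply, Pi.mul_apply, Finset.prod_univ_sum,
    Fintype.piFinset_univ, Finset.prod_mul_distrib]

/-- A one-site matrix acting on the site `k`. -/
def siteMat (k : ι) (A : Matrix (Fin d) (Fin d) ℂ) : Matrix (ι → Fin d) (ι → Fin d) ℂ :=
  tensorMat (Function.update (fun _ => 1) k A)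

lemma siteMat_apply (k : ι) (A : Matrix (Fin d) (Fin d) ℂ) (s t : ι → Fin d) :
    siteMat k A s t = (∏ l ∈ Finset.univ.erase k, (1 : Matrix (Fin d) (Fin d) ℂ) (s l) (t l)) *
      A (s k) (t k) := by
  rw [siteMat, tensorMat, Matrix.of_apply, ← Finset.prod_erase_mul _ _ (Finset.mem_univ k),
    Function.update_self]
  congr 1
  refine Finset.prod_congr rfl fun l hl => ?_
  rw [Function.update_of_ne (Finset.ne_of_mem_erase hl)]

lemma siteMat_mul_siteMat_same (k : ι) (A B : Matrix (Fin d) (Fin d) ℂ) :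
    siteMat k A * siteMat k B = siteMat k (A * B) := by
  rw [siteMat, siteMat, siteMat, tensorMat_mul]
  congr 1
  funext l
  by_cases h : l = k
  · subst h; simp
  · simp [h]

lemma siteMat_commute {k l : ι} (hkl : k ≠ l) (A B : Matrix (Fin d) (Fin d) ℂ) :
    siteMat k A * siteMat l B = siteMat l B * siteMat k A := by
  rw [siteMat, siteMat, tensorMat_mul, tensorMat_mul]
  congr 1
  funext j
  by_cases h : j = k
  · subst h; simp [hkl]
  · by_cases h' : j = l
    · subst h'; simp [h]
    · simp [h, h']

lemma siteMat_conjTranspose (k : ι) (A : Matrix (Fin d) (Fin d) ℂ) :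
    (siteMat k A)ᴴ = siteMat k Aᴴ := by
  rw [siteMat, siteMat, tensorMat_conjTranspose]
  congr 1
  funext l
  by_cases h : l = k
  · subst h; simp
  · simp [h]

lemma siteMat_add (k : ι) (A B : Matrix (Fin d) (Fin d) ℂ) :
    siteMat k (A + B) = siteMat k A + siteMat k B := by
  ext s t
  simp [siteMat_apply, mul_add]

lemma siteMat_smul (k : ι) (z : ℂ) (A : Matrix (Fin d) (Fin d) ℂ) :
    siteMat k (z • A) = z • siteMat k A := by
  ext s t
  simp only [siteMat_apply, Matrix.smul_apply, smul_eq_mul]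
  ring

lemma siteMat_sub (k : ι) (A B : Matrix (Fin d) (Fin d) ℂ) :
    siteMat k (A - B) = siteMat k A - siteMat k B := by
  ext s t
  simp [siteMat_apply, mul_sub]

lemma siteMat_apply_update (k : ι) (A : Matrix (Fin d) (Fin d) ℂ) (s : ι → Fin d) (i : Fin d) :
    siteMat k A s (Function.update s k i) = A (s k) i := by
  rw [siteMat_apply, Finset.prod_eq_one, one_mul, Function.update_self]
  intro l hl
  rw [Function.update_of_ne (Finset.ne_of_mem_erase hl), Matrix.one_apply_eq]

lemma siteMat_apply_eq_zero {k : ι} (A : Matrix (Fin d) (Fin d) ℂ) {s r : ι → Fin d}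
    (h : r ≠ Function.update s k (r k)) : siteMat k A s r = 0 := by
  obtain ⟨l, hl⟩ := Function.ne_iff.mp h
  have hlk : l ≠ k := by
    rintro rfl; simp at hl
  rw [Function.update_of_ne hlk] at hl
  rw [siteMat_apply, Finset.prod_eq_zero (Finset.mem_erase.mpr ⟨hlk, Finset.mem_univ l⟩), zero_mul]
  exact Matrix.one_apply_ne hl.symm

lemma sum_siteMat_mul (k : ι) (A : Matrix (Fin d) (Fin d) ℂ) (s : ι → Fin d)
    (F : (ι → Fin d) → ℂ) :
    ∑ r, siteMat k A s r * F r = ∑ i, A (s k) i * F (Function.update s k i) := by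
  have hinj : Set.InjOn (fun i => Function.update s k i) (Finset.univ : Finset (Fin d)) :=
    fun i _ j _ h => by simpa using congrFun h k
  have h := Finset.sum_image (f := fun r => siteMat k A s r * F r) hinj
  simp only [siteMat_apply_update] at h
  rw [← h]
  symm
  refine Finset.sum_subset (Finset.subset_univ _) fun r _ hr => ?_
  rw [siteMat_apply_eq_zero, zero_mul]
  intro hr'
  exact hr (Finset.mem_image.mpr ⟨r k, Finset.mem_univ _, hr'.symm⟩)

lemma siteMat_mul_apply {κ : Type*} (k : ι) (A : Matrix (Fin d) (Fin d) ℂ)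
    (K : Matrix (ι → Fin d) κ ℂ) (s : ι → Fin d) (t : κ) :
    (siteMat k A * K) s t = ∑ i, A (s k) i * K (Function.update s k i) t := by
  rw [Matrix.mul_apply, sum_siteMat_mul k A s fun r => K r t]

lemma mul_siteMat_apply {κ : Type*} (k : ι) (A : Matrix (Fin d) (Fin d) ℂ)
    (K : Matrix κ (ι → Fin d) ℂ) (s : κ) (t : ι → Fin d) :
    (K * siteMat k A) s t = ∑ i, K s (Function.update t k i) * A i (t k) := by
  have h := sum_siteMat_mul k Aᵀ t fun r => K s r
  simp only [Matrix.transpose_apply] at h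
  rw [Matrix.mul_apply]
  simp only [mul_comm (K s _)]
  rw [← h]
  refine Finset.sum_congr rfl fun r _ => ?_
  congr 1
  simp only [siteMat_apply, Matrix.transpose_apply, Matrix.one_apply, eq_comm]

/-- The action of a one-site unitary on a site: the complex conjugate if `f` is true. -/
def siteRep (f : Bool) (V : Matrix (Fin d) (Fin d) ℂ) : Matrix (Fin d) (Fin d) ℂ :=
  if f then V.map star else V

/-- The infinitesimal version of `siteRep`. -/
def siteLie (f : Bool) (X : Matrix (Fin d) (Fin d) ℂ) : Matrix (Fin d) (Fin d) ℂ :=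
  if f then -Xᵀ else X

/-- The infinitesimal action of a matrix on all sites. -/
def tot (f : ι → Bool) (X : Matrix (Fin d) (Fin d) ℂ) : Matrix (ι → Fin d) (ι → Fin d) ℂ :=
  ∑ k, siteMat k (siteLie (f k) X)

lemma tot_add (f : ι → Bool) (X Y : Matrix (Fin d) (Fin d) ℂ) :
    tot f (X + Y) = tot f X + tot f Y := by
  rw [tot, tot, tot, ← Finset.sum_add_distrib]
  refine Finset.sum_congr rfl fun k _ => ?_
  rw [← siteMat_add]
  congr 1
  cases f k <;> simp [siteLie, add_comm]

lemma tot_sub (f : ι → Bool) (X Y : Matrix (Fin d) (Fin d) ℂ) :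
    tot f (X - Y) = tot f X - tot f Y := by
  rw [tot, tot, tot, ← Finset.sum_sub_distrib]
  refine Finset.sum_congr rfl fun k _ => ?_
  rw [← siteMat_sub]
  congr 1
  cases f k <;> simp [siteLie, neg_add_eq_sub]

lemma tot_smul (f : ι → Bool) (z : ℂ) (X : Matrix (Fin d) (Fin d) ℂ) :
    tot f (z • X) = z • tot f X := by
  rw [tot, tot, Finset.smul_sum]
  refine Finset.sum_congr rfl fun k _ => ?_
  rw [← siteMat_smul]
  congr 1
  cases f k <;> simp [siteLie]

lemma tot_conjTranspose (f : ι → Bool) (X : Matrix (Fin d) (Fin d) ℂ) :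
    (tot f X)ᴴ = tot f Xᴴ := by
  rw [tot, tot, Matrix.conjTranspose_sum]
  refine Finset.sum_congr rfl fun k _ => ?_
  rw [siteMat_conjTranspose]
  congr 1
  cases f k
  · simp [siteLie]
  · ext i j; simp [siteLie]

lemma siteLie_comm (f : Bool) (X Y : Matrix (Fin d) (Fin d) ℂ) :
    siteLie f X * siteLie f Y - siteLie f Y * siteLie f X = siteLie f (X * Y - Y * X) := by
  cases f
  · simp [siteLie]
  · simp [siteLie, Matrix.transpose_mul]

/-- One-site operators on different sites commute, so only the diagonal terms of the double sum
survive. -/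
lemma tot_comm (f : ι → Bool) (X Y : Matrix (Fin d) (Fin d) ℂ) :
    tot f X * tot f Y - tot f Y * tot f X = tot f (X * Y - Y * X) := by
  rw [tot, tot, tot, Finset.sum_mul_sum, Finset.sum_mul_sum, Finset.sum_comm (γ := ι),
    ← Finset.sum_sub_distrib]
  refine Finset.sum_congr rfl fun l _ => ?_
  rw [← Finset.sum_sub_distrib, Finset.sum_eq_single l]
  · rw [siteMat_mul_siteMat_same, siteMat_mul_siteMat_same, ← siteMat_sub, siteLie_comm]
  · intro k _ hk
    rw [siteMat_commute hk, sub_self]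
  · simp

end Tensor

/-! ### Differentiating a unitary symmetry -/

section Lie

variable {ι : Type*} [Fintype ι] [DecidableEq ι] {d : ℕ}

attribute [local instance] Matrix.linftyOpNormedRing Matrix.linftyOpNormedAlgebra

lemma hasDerivAt_exp_entry (X : Matrix (Fin d) (Fin d) ℂ) (i j : Fin d) :
    HasDerivAt (fun θ : ℝ => NormedSpace.exp (θ • X) i j) (X i j) 0 := by
  have h := hasDerivAt_exp_smul_const (𝕂 := ℝ) X 0
  rw [zero_smul, NormedSpace.exp_zero, one_mul] at h
  exact ((Matrix.entryLinearMap ℝ ℂ i j).toContinuousLinearMap.hasFDerivAt).comp_hasDerivAt (0 : ℝ) h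

lemma exp_mem_unitary {X : Matrix (Fin d) (Fin d) ℂ} (hX : Xᴴ = -X) (θ : ℝ) :
    NormedSpace.exp (θ • X) ∈ Matrix.unitaryGroup (Fin d) ℂ := by
  rw [Matrix.mem_unitaryGroup_iff', Matrix.star_eq_conjTranspose, ← Matrix.exp_conjTranspose,
    Matrix.conjTranspose_smul, hX, smul_neg, star_trivial, Matrix.exp_neg]
  exact Matrix.nonsing_inv_mul _ ((Matrix.isUnit_iff_isUnit_det _).mp (Matrix.isUnit_exp _))

lemma hasDerivAt_siteRep {X : Matrix (Fin d) (Fin d) ℂ} (hX : Xᴴ = -X) (f : Bool) (i j : Fin d) :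
    HasDerivAt (fun θ : ℝ => siteRep f (NormedSpace.exp (θ • X)) i j) (siteLie f X i j) 0 := by
  cases f
  · simpa [siteRep, siteLie] using hasDerivAt_exp_entry X i j
  · have h := (hasDerivAt_exp_entry X i j).star
    have hij : star (X i j) = -X j i := by
      have := congrFun (congrFun hX j) i
      simpa [Matrix.conjTranspose_apply] using this
    rw [hij] at h
    simpa [siteRep, siteLie] using h

/-- The Leibniz rule. Skew-Hermitian `X` is needed because on conjugated sites the derivative is the
entrywise conjugate of `X`, which is then `-Xᵀ`. -/
lemma hasDerivAt_tensorMat {X : Matrix (Fin d) (Fin d) ℂ} (hX : Xᴴ = -X) (f : ι → Bool)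
    (s t : ι → Fin d) :
    HasDerivAt (fun θ : ℝ => tensorMat (fun k => siteRep (f k) (NormedSpace.exp (θ • X))) s t)
      (tot f X s t) 0 := by
  have h := HasDerivAt.fun_finsetProd (u := Finset.univ) fun k (_ : k ∈ Finset.univ) =>
    hasDerivAt_siteRep hX (f k) (s k) (t k)
  refine h.congr_deriv ?_
  symm
  unfold tot
  rw [Matrix.sum_apply]
  refine Finset.sum_congr rfl fun k _ => ?_
  rw [siteMat_apply, smul_eq_mul]
  congr 1
  refine Finset.prod_congr rfl fun l _ => ?_
  rw [zero_smul, NormedSpace.exp_zero, siteRep]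
  split_ifs <;> simp [Matrix.one_apply, apply_ite]

/-- A matrix that commutes with the action of the unitary group commutes with the infinitesimal
action. -/
lemma commute_tot {f : ι → Bool} {K : Matrix (ι → Fin d) (ι → Fin d) ℂ}
    (hK : ∀ V ∈ Matrix.unitaryGroup (Fin d) ℂ, K * tensorMat (fun k => siteRep (f k) V) =
      tensorMat (fun k => siteRep (f k) V) * K) (X : Matrix (Fin d) (Fin d) ℂ) :
    K * tot f X = tot f X * K := by
  have hskew : ∀ X : Matrix (Fin d) (Fin d) ℂ, Xᴴ = -X → K * tot f X = tot f X * K := by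
    intro X hX
    ext s t
    have h1 : HasDerivAt (fun θ : ℝ => (K * tensorMat
        (fun k => siteRep (f k) (NormedSpace.exp (θ • X)))) s t) ((K * tot f X) s t) 0 := by
      simp only [Matrix.mul_apply]
      exact HasDerivAt.fun_sum fun r _ => (hasDerivAt_tensorMat hX f r t).const_mul _
    have h2 : HasDerivAt (fun θ : ℝ => (tensorMat
        (fun k => siteRep (f k) (NormedSpace.exp (θ • X))) * K) s t) ((tot f X * K) s t) 0 := by
      simp only [Matrix.mul_apply]
      exact HasDerivAt.fun_sum fun r _ => (hasDerivAt_tensorMat hX f s r).mul_const _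
    refine h1.unique ?_
    have h3 : (fun θ : ℝ => (K * tensorMat
        (fun k => siteRep (f k) (NormedSpace.exp (θ • X)))) s t) = fun θ : ℝ => (tensorMat
        (fun k => siteRep (f k) (NormedSpace.exp (θ • X))) * K) s t := by
      funext θ
      rw [hK _ (exp_mem_unitary hX θ)]
    rwa [h3]
  -- Every matrix is a complex combination of two skew-Hermitian ones, and `tot` is complex linear.
  have hX : X = (2⁻¹ : ℂ) • (X - Xᴴ) + (Complex.I * 2⁻¹) • ((-Complex.I) • (X + Xᴴ)) := by
    rw [smul_smul, show Complex.I * 2⁻¹ * -Complex.I = (2⁻¹ : ℂ) by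
      linear_combination (-2⁻¹ : ℂ) * Complex.I_mul_I, ← smul_add]
    ext i j
    simp
    ring
  rw [hX, tot_add, tot_smul, tot_smul, mul_add, add_mul, mul_smul_comm, mul_smul_comm,
    smul_mul_assoc, smul_mul_assoc, hskew, hskew]
  · ext i j
    simp
  · simp

end Lie

/-! ### Haar integrals over pure states -/

section Haar

variable {d : ℕ} [NeZero d]

instance : (haarSU d).IsMulLeftInvariant := by
  unfold haarSU; infer_instance

instance : IsProbabilityMeasure (haarSU d) :=
  ⟨by unfold haarSU; exact Measure.haarMeasure_self⟩

lemma continuous_pureState (i : Fin d) : Continuous fun U : SU d => pureState U i :=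
  (continuous_apply_apply i 0).comp continuous_subtype_val

lemma integrable_of_continuous {E : Type*} [NormedAddCommGroup E] {F : SU d → E}
    (hF : Continuous F) : Integrable F (haarSU d) := by
  have : IsFiniteMeasureOnCompacts (haarSU d) := inferInstance
  exact hF.integrable_of_hasCompactSupport (HasCompactSupport.of_compactSpace F)

lemma sum_norm_sq_pureState (U : SU d) : ∑ i, ‖pureState U i‖ ^ 2 = 1 := by
  have h := congrFun (congrFun (Matrix.mem_unitaryGroup_iff'.mp U.2.1) 0) 0
  rw [Matrix.mul_apply, Matrix.one_apply_eq] at h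
  have h2 : ((∑ i, ‖pureState U i‖ ^ 2 : ℝ) : ℂ) = 1 := by
    rw [← h]
    push_cast
    refine Finset.sum_congr rfl fun i _ => ?_
    rw [Matrix.star_apply, ← starRingEnd_apply, Complex.conj_mul']
    rfl
  exact_mod_cast h2

/-- The distribution of the pure state is invariant under the full unitary group, as far as
functions insensitive to the phase are concerned. -/
lemma integral_unitary {F : (Fin d → ℂ) → ℂ}
    (hF : ∀ c : ℂ, ‖c‖ = 1 → ∀ ψ, F (c • ψ) = F ψ) {V : Matrix (Fin d) (Fin d) ℂ}
    (hV : V ∈ Matrix.unitaryGroup (Fin d) ℂ) :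
    ∫ U : SU d, F (V *ᵥ pureState U) ∂(haarSU d) = ∫ U : SU d, F (pureState U) ∂(haarSU d) := by
  have hd : 0 < d := Nat.pos_of_ne_zero (NeZero.ne d)
  -- Dividing `V` by a `d`-th root of its determinant lands in `SU(d)`, where Haar invariance
  -- applies; the phase `c` is invisible to `F`.
  obtain ⟨c, hc⟩ := IsAlgClosed.exists_pow_nat_eq V.det hd
  have hdet : ‖V.det‖ = 1 := by
    have h := congrArg Matrix.det (Matrix.mem_unitaryGroup_iff.mp hV)
    rw [Matrix.det_mul, Matrix.star_eq_conjTranspose, Matrix.det_conjTranspose, Matrix.det_one,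
      ← starRingEnd_apply, Complex.mul_conj'] at h
    have h2 : ‖V.det‖ ^ 2 = 1 := by exact_mod_cast h
    exact (pow_eq_one_iff_of_nonneg (norm_nonneg _) two_ne_zero).mp h2
  have hc1 : ‖c‖ = 1 := by
    rw [← hc, norm_pow] at hdet
    exact (pow_eq_one_iff_of_nonneg (norm_nonneg _) hd.ne').mp hdet
  have hc0 : c ≠ 0 := by
    rintro rfl; simp at hc1
  have hcc : star c * c = 1 := by
    rw [← starRingEnd_apply, Complex.conj_mul', hc1]; simp
  have hW : star c • V ∈ Matrix.specialUnitaryGroup (Fin d) ℂ := by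
    rw [Matrix.mem_specialUnitaryGroup_iff]
    constructor
    · rw [Matrix.mem_unitaryGroup_iff, star_smul, star_star, smul_mul_smul_comm, hcc,
        Matrix.mem_unitaryGroup_iff.mp hV, one_smul]
    · rw [Matrix.det_smul, Fintype.card_fin, ← hc, ← mul_pow, hcc, one_pow]
  rw [← integral_mul_left_eq_self (fun U => F (pureState U)) (⟨star c • V, hW⟩ : SU d)]
  refine integral_congr_ae (Filter.Eventually.of_forall fun U => ?_)
  have h1 : pureState ((⟨star c • V, hW⟩ : SU d) * U) = star c • (V *ᵥ pureState U) := by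
    funext i
    simp [pureState, Matrix.mul_apply, Matrix.mulVec, dotProduct, Finset.mul_sum, mul_assoc]
  simp only [h1]
  rw [hF]
  rw [norm_star, hc1]

end Haar

/-! ### Twirled site operators -/

section Twirl

variable {ι : Type*} [Fintype ι] [DecidableEq ι] {d : ℕ}

/-- The operator on one site in a twirl: the identity if `o` is false, the projector onto `ψ` (or
its complex conjugate if `f` is true) otherwise. -/
def siteKer (f o : Bool) (ψ : Fin d → ℂ) : Matrix (Fin d) (Fin d) ℂ :=
  if o then siteRep f (Matrix.vecMulVec ψ (star ψ)) else 1

lemma siteRep_mul (f : Bool) (A B : Matrix (Fin d) (Fin d) ℂ) :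
    siteRep f (A * B) = siteRep f A * siteRep f B := by
  cases f
  · rfl
  · simp [siteRep]

lemma siteKer_mul_siteRep (f o : Bool) (ψ : Fin d → ℂ) {V : Matrix (Fin d) (Fin d) ℂ}
    (hV : V ∈ Matrix.unitaryGroup (Fin d) ℂ) :
    siteKer f o (V *ᵥ ψ) * siteRep f V = siteRep f V * siteKer f o ψ := by
  cases o
  · simp [siteKer]
  · simp only [siteKer, if_true]
    rw [← siteRep_mul, ← siteRep_mul]
    congr 1
    rw [Matrix.star_mulVec, Matrix.vecMulVec_mul, Matrix.vecMul_vecMul,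
      ← Matrix.star_eq_conjTranspose, Matrix.mem_unitaryGroup_iff'.mp hV, Matrix.vecMul_one,
      Matrix.mul_vecMulVec]

lemma siteKer_smul (f o : Bool) (ψ : Fin d → ℂ) {c : ℂ} (hc : ‖c‖ = 1) :
    siteKer f o (c • ψ) = siteKer f o ψ := by
  have h : c * star c = 1 := by
    rw [← starRingEnd_apply, Complex.mul_conj', hc]; simp
  have h2 : Matrix.vecMulVec (c • ψ) (star (c • ψ)) = Matrix.vecMulVec ψ (star ψ) := by
    rw [star_smul, Matrix.smul_vecMulVec, Matrix.vecMulVec_smul, smul_smul, h, one_smul]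
  rw [siteKer, siteKer, h2]

variable [NeZero d]

/-- The Haar average of a tensor product of site operators. -/
def twirl (f o : ι → Bool) : Matrix (ι → Fin d) (ι → Fin d) ℂ :=
  Matrix.of fun s t => ∫ U : SU d,
    tensorMat (fun k => siteKer (f k) (o k) (pureState U)) s t ∂(haarSU d)

lemma continuous_siteKer (f o : Bool) (i j : Fin d) :
    Continuous fun U : SU d => siteKer f o (pureState U) i j := by
  have h := fun i : Fin d => continuous_pureState i
  cases o
  · simpa [siteKer] using continuous_const
  · cases f
    · simp only [siteKer, siteRep, Matrix.vecMulVec_apply, if_true, Pi.star_apply]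
      exact (h i).mul (h j).star
    · simp only [siteKer, siteRep, if_true, Matrix.map_apply, Matrix.vecMulVec_apply, Pi.star_apply]
      exact ((h i).mul (h j).star).star

lemma continuous_tensorMat_siteKer (f o : ι → Bool) (s t : ι → Fin d) :
    Continuous fun U : SU d => tensorMat (fun k => siteKer (f k) (o k) (pureState U)) s t :=
  continuous_finsetProd _ fun k _ => continuous_siteKer (f k) (o k) (s k) (t k)

lemma twirl_commute_tensorMat (f o : ι → Bool) {V : Matrix (Fin d) (Fin d) ℂ}
    (hV : V ∈ Matrix.unitaryGroup (Fin d) ℂ) :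
    twirl f o * tensorMat (fun k => siteRep (f k) V) =
      tensorMat (fun k => siteRep (f k) V) * twirl f o := by
  have hint := fun s t => integrable_of_continuous (continuous_tensorMat_siteKer (d := d) f o s t)
  ext s t
  have h1 : ((twirl f o : Matrix (ι → Fin d) (ι → Fin d) ℂ) * tensorMat (fun k => siteRep (f k) V)) s t = ∫ U : SU d,
      (tensorMat (fun k => siteKer (f k) (o k) (pureState U)) *
        tensorMat (fun k => siteRep (f k) V)) s t ∂(haarSU d) := by
    simp only [Matrix.mul_apply]
    rw [integral_finsetSum _ fun r _ => (hint s r).mul_const _]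
    exact Finset.sum_congr rfl fun r _ => (integral_mul_const _ _).symm
  have h2 : (tensorMat (fun k => siteRep (f k) V) * (twirl f o : Matrix (ι → Fin d) (ι → Fin d) ℂ)) s t = ∫ U : SU d,
      (tensorMat (fun k => siteRep (f k) V) *
        tensorMat (fun k => siteKer (f k) (o k) (pureState U))) s t ∂(haarSU d) := by
    simp only [Matrix.mul_apply]
    rw [integral_finsetSum _ fun r _ => (hint r t).const_mul _]
    exact Finset.sum_congr rfl fun r _ => (integral_const_mul _ _).symm
  rw [h1, h2, ← integral_unitary (F := fun ψ => (tensorMat (fun k => siteKer (f k) (o k) ψ) *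
        tensorMat (fun k => siteRep (f k) V)) s t) _ hV]
  · refine integral_congr_ae (Filter.Eventually.of_forall fun U => ?_)
    simp only [tensorMat_mul]
    exact congrFun (congrFun (congrArg tensorMat
      (funext fun k => siteKer_mul_siteRep (f k) (o k) _ hV)) s) t
  · intro c hc ψ
    simp only [siteKer_smul _ _ ψ hc]

lemma twirl_commute_tot (f o : ι → Bool) (X : Matrix (Fin d) (Fin d) ℂ) :
    twirl f o * tot f X = tot f X * twirl f o :=
  commute_tot (fun _ hV => twirl_commute_tensorMat f o hV) X

end Twirl

/-! ### Moments of the Haar distribution -/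

section Moments

variable {d : ℕ} [NeZero d]

/-- The mixed moments of the components of the random pure state. -/
def moment (m m' : Multiset (Fin d)) : ℂ :=
  ∫ U : SU d, (m.map (pureState U)).prod * star (m'.map (pureState U)).prod ∂(haarSU d)

/-- The moments of the squared moduli of the components of the random pure state. -/
def mu (m : Multiset (Fin d)) : ℝ :=
  ∫ U : SU d, (m.map fun i => ‖pureState U i‖ ^ 2).prod ∂(haarSU d)

lemma prod_eq_map_tyOn {ι : Type*} (s : Finset ι) (c : ι → Fin d) {A : Type*} [CommMonoid A]
    (F : Fin d → A) : ∏ k ∈ s, F (c k) = ((tyOn s c).map F).prod := by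
  rw [tyOn, Multiset.map_map]
  rfl

lemma continuous_prod_map_norm (m : Multiset (Fin d)) :
    Continuous fun U : SU d => (m.map fun i => ‖pureState U i‖ ^ 2).prod := by
  induction m using Multiset.induction with
  | empty => simpa using continuous_const
  | cons a m ih =>
    simp only [Multiset.map_cons, Multiset.prod_cons]
    exact ((continuous_pureState a).norm.pow 2).mul ih

lemma twirl_eq_moment {n : ℕ} (s t : Conf d n) :
    twirl (fun _ => false) (fun _ => true) s t = moment (ty s) (ty t) := by
  simp only [twirl, moment, Matrix.of_apply, tensorMat, siteKer, siteRep, if_true,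
    Bool.false_eq_true, if_false, Matrix.vecMulVec_apply, Finset.prod_mul_distrib, Pi.star_apply, ← prod_eq_map_tyOn, star_prod]

lemma moment_self (m : Multiset (Fin d)) : moment m m = mu m := by
  refine Eq.trans (integral_congr_ae (Filter.Eventually.of_forall fun U => ?_)) integral_ofReal
  induction m using Multiset.induction with
  | empty => simp
  | cons a m ih =>
    simp only [Multiset.map_cons, Multiset.prod_cons, star_mul'] at ih ⊢
    rw [mul_mul_mul_comm, ih, ← starRingEnd_apply, Complex.mul_conj']
    push_cast
    rfl

/-- The entry at `(s, t)` of the commutation of the averaged projector with the infinitesimal action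
of a matrix unit. All the moment identities below come from this one relation. -/
lemma sum_moment_replace {n : ℕ} (s t : Conf d n) (i j : Fin d) :
    (∑ k, if t k = j then moment (ty s) (ty (Function.update t k i)) else 0) =
      ∑ k, if s k = i then moment (ty (Function.update s k j)) (ty t) else 0 := by
  have h := congrFun (congrFun (twirl_commute_tot (ι := Fin n) (fun _ => false) (fun _ => true)
    (Matrix.single i j (1 : ℂ))) s) t
  rw [tot, Finset.mul_sum, Finset.sum_mul, Matrix.sum_apply, Matrix.sum_apply] at h
  simp only [mul_siteMat_apply, siteMat_mul_apply, siteLie, twirl_eq_moment] at h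
  convert h using 2 with k _ k _
  · rw [Finset.sum_eq_single i]
    · simp [Matrix.single_apply, eq_comm]
    · intro l _ hl
      simp [Matrix.single_apply, hl.symm]
    · simp
  · rw [Finset.sum_eq_single j]
    · simp [Matrix.single_apply, eq_comm]
    · intro l _ hl
      simp [Matrix.single_apply, hl.symm]
    · simp

lemma moment_eq_zero {m m' : Multiset (Fin d)} (hc : m.card = m'.card) (hm : m ≠ m') :
    moment m m' = 0 := by
  obtain ⟨s, hs⟩ := exists_ty_eq m.card m rfl
  obtain ⟨t, ht⟩ := exists_ty_eq m.card m' hc.symm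
  obtain ⟨i, hi⟩ : ∃ i, m.count i ≠ m'.count i := by
    by_contra! h
    exact hm (Multiset.ext' h)
  -- For a diagonal matrix unit nothing is replaced, and the relation says that the moment is
  -- annihilated by the difference of the numbers of letters `i`.
  have h := sum_moment_replace s t i i
  have h1 : ∀ (t : Conf d m.card) k, t k = i → Function.update t k i = t := by
    rintro t k rfl
    exact Function.update_eq_self k t
  have h2 : (∑ k, if t k = i then moment (ty s) (ty (Function.update t k i)) else 0) =
      (ty t).count i * moment (ty s) (ty t) := by
    rw [count_tyOn, Finset.card_filter, Nat.cast_sum, Finset.sum_mul]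
    refine Finset.sum_congr rfl fun k _ => ?_
    split_ifs with hk
    · rw [h1 t k hk]; simp
    · simp
  have h3 : (∑ k, if s k = i then moment (ty (Function.update s k i)) (ty t) else 0) =
      (ty s).count i * moment (ty s) (ty t) := by
    rw [count_tyOn, Finset.card_filter, Nat.cast_sum, Finset.sum_mul]
    refine Finset.sum_congr rfl fun k _ => ?_
    split_ifs with hk
    · rw [h1 s k hk]; simp
    · simp
  rw [h2, h3, hs, ht, ← sub_eq_zero, ← sub_mul, mul_eq_zero] at h
  refine h.resolve_left ?_
  rw [sub_eq_zero, Nat.cast_inj]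
  exact hi.symm

/-- Replacing a letter changes the moment by a ratio of multiplicities, and the multiplicities `cnt`
change by the inverse ratio (`cnt_cons_mul_count`). -/
lemma mu_exchange (m : Multiset (Fin d)) (i j : Fin d) :
    mu (i ::ₘ m) * cnt d (m.card + 1) (i ::ₘ m) = mu (j ::ₘ m) * cnt d (m.card + 1) (j ::ₘ m) := by
  obtain ⟨s, hs⟩ := exists_ty_eq (m.card + 1) (i ::ₘ m) (by simp)
  obtain ⟨t, ht⟩ := exists_ty_eq (m.card + 1) (j ::ₘ m) (by simp)
  have h := sum_moment_replace s t i j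
  have hup : ∀ (t : Conf d (m.card + 1)) k (i j : Fin d), ty t = j ::ₘ m → t k = j →
      ty (Function.update t k i) = i ::ₘ m := by
    intro t k i j ht hk
    have := tyOn_update (Finset.mem_univ k) t i
    rw [← ty, ← ty, ht, hk, ← Multiset.singleton_add, add_comm, add_assoc, add_right_inj] at this
    rw [this, add_comm, Multiset.singleton_add]
  have h2 : (∑ k, if t k = j then moment (ty s) (ty (Function.update t k i)) else 0) =
      (j ::ₘ m).count j * (mu (i ::ₘ m) : ℂ) := by
    rw [← moment_self, ← ht, count_tyOn, Finset.card_filter, Nat.cast_sum, Finset.sum_mul]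
    refine Finset.sum_congr rfl fun k _ => ?_
    split_ifs with hk
    · rw [hup t k i j ht hk, hs]; simp
    · simp
  have h3 : (∑ k, if s k = i then moment (ty (Function.update s k j)) (ty t) else 0) =
      (i ::ₘ m).count i * (mu (j ::ₘ m) : ℂ) := by
    rw [← moment_self, ← hs, count_tyOn, Finset.card_filter, Nat.cast_sum, Finset.sum_mul]
    refine Finset.sum_congr rfl fun k _ => ?_
    split_ifs with hk
    · rw [hup s k j i hs hk, ht]; simp
    · simp
  rw [h2, h3] at h
  have h4 : ((j ::ₘ m).count j : ℝ) * mu (i ::ₘ m) = (i ::ₘ m).count i * mu (j ::ₘ m) := by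
    exact_mod_cast h
  have hi : (cnt d (m.card + 1) (i ::ₘ m) : ℝ) * (i ::ₘ m).count i = (m.card + 1) * cnt d m.card m := by
    exact_mod_cast cnt_cons_mul_count m i rfl
  have hj : (cnt d (m.card + 1) (j ::ₘ m) : ℝ) * (j ::ₘ m).count j = (m.card + 1) * cnt d m.card m := by
    exact_mod_cast cnt_cons_mul_count m j rfl
  have hi0 : ((i ::ₘ m).count i : ℝ) ≠ 0 := by
    rw [Nat.cast_ne_zero, Multiset.count_cons_self]; omega
  have hj0 : ((j ::ₘ m).count j : ℝ) ≠ 0 := by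
    rw [Nat.cast_ne_zero, Multiset.count_cons_self]; omega
  refine mul_right_cancel₀ hj0 (mul_right_cancel₀ hi0 ?_)
  linear_combination (cnt d (m.card + 1) (i ::ₘ m) : ℝ) * ((i ::ₘ m).count i : ℝ) * h4 +
    mu (j ::ₘ m) * ((i ::ₘ m).count i : ℝ) * (hi - hj)

/-- A function of types that is invariant under replacing a letter is constant. -/
lemma const_of_exchange {A : Type*} {F : Multiset (Fin d) → A}
    (hF : ∀ m i j, F (i ::ₘ m) = F (j ::ₘ m)) {m m' : Multiset (Fin d)}
    (h : m.card = m'.card) : F m = F m' := by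
  induction m using Multiset.induction generalizing F m' with
  | empty =>
    rw [Multiset.card_zero] at h
    rw [Multiset.card_eq_zero.mp h.symm]
  | cons i m ih =>
    obtain ⟨j, hj⟩ := Multiset.card_pos_iff_exists_mem.mp
      (show 0 < m'.card by rw [← h, Multiset.card_cons]; omega)
    obtain ⟨m', rfl⟩ := Multiset.exists_cons_of_mem hj
    rw [hF m i j]
    refine ih (F := fun m => F (j ::ₘ m)) (fun m i' j' => ?_) (by simpa using h)
    simp only [Multiset.cons_swap j]
    exact hF _ _ _

/-- Each added spin inserts the factor `∑ |ψ_i|² = 1` under the integral. -/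
lemma csum_mu_add (m : Multiset (Fin d)) (n : ℕ) : (csum d n fun r => mu (m + r)) = mu m := by
  induction n generalizing m with
  | zero => simp [csum_zero]
  | succ n ih =>
    have h1 : mu m = ∑ j, mu (j ::ₘ m) := by
      simp only [mu, Multiset.map_cons, Multiset.prod_cons]
      rw [← integral_finsetSum]
      · refine integral_congr_ae (Filter.Eventually.of_forall fun U => ?_)
        simp only []
        rw [← Finset.sum_mul, sum_norm_sq_pureState, one_mul]
      · intro j _
        exact integrable_of_continuous
          (((continuous_pureState j).norm.pow 2).mul (continuous_prod_map_norm m))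
    rw [csum_succ, h1]
    refine Finset.sum_congr rfl fun j _ => ?_
    rw [← ih (j ::ₘ m)]
    simp only [Multiset.add_cons, Multiset.cons_add]

lemma mu_zero : mu (0 : Multiset (Fin d)) = 1 := by
  simp [mu]

/-- The product is invariant under exchange of letters, hence the same for all types of size `n`.
The total probability one, spread over the types, fixes the constant. -/
lemma mu_mul_cnt {m : Multiset (Fin d)} {n : ℕ} (hm : m.card = n) :
    mu m * cnt d n m = (symDim d n : ℝ)⁻¹ := by
  have hc : ∀ m' : Multiset (Fin d), m'.card = n → mu m' = (mu m * cnt d n m) * (cnt d n m' : ℝ)⁻¹ := by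
    intro m' hm'
    have h := const_of_exchange (F := fun m => mu m * cnt d m.card m) (fun m i j => by
      simpa using mu_exchange m i j) (hm.trans hm'.symm)
    simp only [hm, hm'] at h
    rw [h, mul_assoc, mul_inv_cancel₀ (cnt_ne_zero hm'), mul_one]
  have h1 : (csum d n fun m' => mu m') = 1 := by
    simpa [mu_zero] using csum_mu_add (0 : Multiset (Fin d)) n
  rw [csum_congr hc, ← mul_csum] at h1
  have h2 : (csum d n fun m' => (cnt d n m' : ℝ)⁻¹) = symDim d n := by
    have := sum_inv_cnt d n
    rw [csum] at this ⊢
    have h3 := congrArg Complex.re this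
    simpa using h3
  rw [h2] at h1
  exact eq_inv_of_mul_eq_one_left h1

lemma mu_eq {m : Multiset (Fin d)} {n : ℕ} (hm : m.card = n) :
    mu m = (symDim d n : ℝ)⁻¹ * (cnt d n m : ℝ)⁻¹ := by
  rw [← mu_mul_cnt hm, mul_assoc, mul_inv_cancel₀ (cnt_ne_zero hm), mul_one]

lemma mu_pos (m : Multiset (Fin d)) : 0 < mu m := by
  have h1 := symDim_pos d m.card (Nat.pos_of_ne_zero (NeZero.ne d))
  have h2 := cnt_pos (m := m) rfl
  rw [mu_eq rfl]
  positivity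

end Moments

/-! ### The largest eigenvalue of a Hermitian matrix -/

section MaxEigenvalue

variable {κ : Type} [Fintype κ] [DecidableEq κ] {R : Matrix κ κ ℂ} {lam : ℝ}

lemma hasEigenvalue_iff {z : ℂ} :
    Module.End.HasEigenvalue (Matrix.toLin' R) z ↔ ∃ v : κ → ℂ, v ≠ 0 ∧ R *ᵥ v = z • v := by
  constructor
  · intro h
    obtain ⟨v, hv⟩ := h.exists_hasEigenvector
    exact ⟨v, hv.2, by simpa using hv.apply_eq_smul⟩
  · rintro ⟨v, hv, h⟩
    exact Module.End.hasEigenvalue_of_hasEigenvector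
      (Module.End.hasEigenvector_iff.mpr ⟨by simpa [Module.End.mem_eigenspace_iff] using h, hv⟩)

lemma exists_isMaxEigenvalue [Nonempty κ] (hR : R.IsHermitian) :
    ∃ lam : ℝ, IsMaxEigenvalue R lam := by
  have hfin : {x : ℝ | Module.End.HasEigenvalue (Matrix.toLin' R) (x : ℂ)}.Finite :=
    (Module.End.finite_hasEigenvalue (Matrix.toLin' R)).preimage Complex.ofReal_injective.injOn
  have hne : {x : ℝ | Module.End.HasEigenvalue (Matrix.toLin' R) (x : ℂ)}.Nonempty := by
    obtain ⟨i⟩ := ‹Nonempty κ›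
    refine ⟨hR.eigenvalues i, hasEigenvalue_iff.mpr ⟨⇑(hR.eigenvectorBasis i), ?_, ?_⟩⟩
    · exact (WithLp.ofLp_eq_zero 2).ne.2 (hR.eigenvectorBasis.orthonormal.ne_zero i)
    · rw [hR.mulVec_eigenvectorBasis]
      rfl
  refine ⟨hfin.toFinset.max' (by simpa using hne), ?_⟩
  have := hfin.toFinset.isGreatest_max' (by simpa using hne)
  rwa [hfin.coe_toFinset] at this

lemma IsMaxEigenvalue.posSemidef (h : IsMaxEigenvalue R lam) (hR : R.IsHermitian) :
    ((lam : ℂ) • (1 : Matrix κ κ ℂ) - R).PosSemidef := by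
  have hH : ((lam : ℂ) • (1 : Matrix κ κ ℂ) - R).IsHermitian := by
    refine Matrix.IsHermitian.sub ?_ hR
    rw [Matrix.IsHermitian, Matrix.conjTranspose_smul, Matrix.conjTranspose_one]
    simp
  rw [hH.posSemidef_iff_eigenvalues_nonneg]
  intro i
  have h1 := hH.mulVec_eigenvectorBasis i
  -- An eigenvalue `e` of `lam • 1 - R` makes `lam - e` an eigenvalue of `R`, which maximality
  -- bounds by `lam`.
  have h2 : lam - hH.eigenvalues i ≤ lam := by
    refine h.2 (hasEigenvalue_iff.mpr ⟨⇑(hH.eigenvectorBasis i), ?_, ?_⟩)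
    · exact (WithLp.ofLp_eq_zero 2).ne.2 (hH.eigenvectorBasis.orthonormal.ne_zero i)
    · rw [Matrix.sub_mulVec, Matrix.smul_mulVec, Matrix.one_mulVec, sub_eq_iff_eq_add] at h1
      push_cast
      rw [sub_smul, h1, add_comm]
      exact (add_sub_cancel_right _ _).symm
  simpa using h2

lemma trace_vecMulVec_mul (v : κ → ℂ) (A : Matrix κ κ ℂ) :
    (Matrix.vecMulVec v (star v) * A).trace = star v ⬝ᵥ A *ᵥ v := by
  rw [Matrix.trace_mul_comm, Matrix.mul_vecMulVec, Matrix.trace_vecMulVec, dotProduct_comm]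

lemma trace_mul_nonneg_of_posSemidef {A C : Matrix κ κ ℂ} (hC : C.PosSemidef)
    (hA : A.PosSemidef) : 0 ≤ (C * A).trace := by
  obtain ⟨m, v, rfl⟩ := Matrix.posSemidef_iff_eq_sum_vecMulVec.mp hC
  rw [Finset.sum_mul, Matrix.trace_sum]
  refine Finset.sum_nonneg fun i _ => ?_
  rw [trace_vecMulVec_mul]
  exact hA.dotProduct_mulVec_nonneg _

lemma trace_smul_one_sub (C : Matrix κ κ ℂ) :
    (C * ((lam : ℂ) • (1 : Matrix κ κ ℂ) - R)).trace = lam * C.trace - (C * R).trace := by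
  rw [mul_sub, Matrix.trace_sub, mul_smul_comm, mul_one, Matrix.trace_smul, smul_eq_mul]

lemma IsMaxEigenvalue.trace_le (h : IsMaxEigenvalue R lam) (hR : R.IsHermitian)
    {C : Matrix κ κ ℂ} (hC : C.PosSemidef) (hC1 : C.trace = 1) : (C * R).trace.re ≤ lam := by
  have h1 := trace_mul_nonneg_of_posSemidef hC (h.posSemidef hR)
  rw [trace_smul_one_sub, hC1, mul_one] at h1
  simpa using (Complex.le_def.mp h1).1

/-- Saturating the bound makes the quadratic form of the positive semidefinite `lam • 1 - R` vanish
at `v`, which puts `v` in its kernel. -/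
lemma IsMaxEigenvalue.eigenvector_of_trace_eq (h : IsMaxEigenvalue R lam) (hR : R.IsHermitian)
    {v : κ → ℂ} (hv : (Matrix.vecMulVec v (star v)).trace = 1)
    (h1 : (Matrix.vecMulVec v (star v) * R).trace.re = lam) : R *ᵥ v = (lam : ℂ) • v := by
  have hP := h.posSemidef hR
  have h2 := trace_smul_one_sub (R := R) (lam := lam) (Matrix.vecMulVec v (star v))
  have h3 := hP.dotProduct_mulVec_nonneg v
  rw [← trace_vecMulVec_mul, Complex.le_def] at h3
  have h4 : star v ⬝ᵥ ((lam : ℂ) • (1 : Matrix κ κ ℂ) - R) *ᵥ v = 0 := by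
    rw [← trace_vecMulVec_mul]
    refine Complex.ext ?_ h3.2.symm
    rw [h2, hv]
    simp [h1]
  rw [hP.dotProduct_mulVec_zero_iff, Matrix.sub_mulVec, Matrix.smul_mulVec, Matrix.one_mulVec,
    sub_eq_zero] at h4
  exact h4.symm

lemma map_ofReal_mulVec (A : Matrix κ κ ℝ) (g : κ → ℝ) :
    A.map Complex.ofReal *ᵥ (fun p => (g p : ℂ)) = fun p => ((A *ᵥ g) p : ℂ) := by
  funext p
  simp [Matrix.mulVec, dotProduct]

/-- Pairing the entrywise inequality with `g ≥ 0` makes the quadratic form of `lam • 1 - A`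
nonpositive at `g`. It is also nonnegative, so `g` lies in the kernel. This is the maximality half
of Perron-Frobenius, and it avoids any irreducibility assumption. -/
lemma IsMaxEigenvalue.mulVec_eq_of_le {A : Matrix κ κ ℝ}
    (h : IsMaxEigenvalue (A.map Complex.ofReal) lam) (hA : Aᵀ = A) {g : κ → ℝ} (hg : ∀ p, 0 ≤ g p)
    (hle : ∀ p, lam * g p ≤ (A *ᵥ g) p) : A *ᵥ g = lam • g := by
  have hR : (A.map Complex.ofReal).IsHermitian := by
    ext i j
    simpa [Matrix.conjTranspose_apply] using congrFun (congrFun hA i) j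
  have hP := h.posSemidef hR
  have h4 : star (fun p => (g p : ℂ)) ⬝ᵥ ((lam : ℂ) • (1 : Matrix κ κ ℂ) - A.map Complex.ofReal) *ᵥ
      (fun p => (g p : ℂ)) = ((∑ p, g p * (lam * g p - (A *ᵥ g) p) : ℝ) : ℂ) := by
    rw [Matrix.sub_mulVec, Matrix.smul_mulVec, Matrix.one_mulVec, map_ofReal_mulVec]
    simp [dotProduct]
  have h5 := hP.dotProduct_mulVec_nonneg (fun p => (g p : ℂ))
  rw [h4] at h5
  have h6 : ∑ p, g p * (lam * g p - (A *ᵥ g) p) = 0 := by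
    refine le_antisymm (Finset.sum_nonpos fun p _ => ?_) (by exact_mod_cast h5)
    exact mul_nonpos_of_nonneg_of_nonpos (hg p) (by linarith [hle p])
  rw [h6, Complex.ofReal_zero, hP.dotProduct_mulVec_zero_iff, Matrix.sub_mulVec,
    Matrix.smul_mulVec, Matrix.one_mulVec, map_ofReal_mulVec, sub_eq_zero] at h4
  funext p
  have := congrFun h4 p
  simp only [Pi.smul_apply, smul_eq_mul] at this ⊢
  exact_mod_cast this.symm

lemma IsMaxEigenvalue.diag_le {A : Matrix κ κ ℝ}
    (h : IsMaxEigenvalue (A.map Complex.ofReal) lam) (hA : Aᵀ = A) (p : κ) : A p p ≤ lam := by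
  have hR : (A.map Complex.ofReal).IsHermitian := by
    ext i j
    simpa [Matrix.conjTranspose_apply] using congrFun (congrFun hA i) j
  have h1 := (h.posSemidef hR).diag_nonneg (i := p)
  rw [Matrix.sub_apply, Matrix.smul_apply, Matrix.one_apply_eq, Matrix.map_apply, smul_eq_mul,
    mul_one, sub_nonneg] at h1
  exact_mod_cast h1

end MaxEigenvalue

/-! ### The matrix elements of `R` -/

section CloningOp

variable {d M N : ℕ} [NeZero d]

/-- The matrix elements of `R_x`. -/
def cloneKer (d M : ℕ) {N : ℕ} [NeZero d] (x : Finset (Fin N)) :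
    Matrix (Conf d M × Conf d N) (Conf d M × Conf d N) ℝ :=
  Matrix.of fun p q => if (∀ k, k ∉ x → p.2 k = q.2 k) ∧
      ty q.1 + tyOn x p.2 = ty p.1 + tyOn x q.2 then
    symDim d M * mu (ty q.1 + tyOn x p.2) else 0

/-- The matrix elements of `R`. -/
def cloneMat (d M : ℕ) {N : ℕ} [NeZero d] (α : Finset (Fin N) → ℝ) :
    Matrix (Conf d M × Conf d N) (Conf d M × Conf d N) ℝ := ∑ x, α x • cloneKer d M x

/-- The transposition on IN exchanges the roles of `ψ` and its conjugate, so the unconjugated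
factors come from the column on IN and the row on OUT. The moment is then zero, or a moment of
squared moduli. -/
lemma cloningOpOn_eq (x : Finset (Fin N)) :
    cloningOpOn d M x = (cloneKer d M x).map Complex.ofReal := by
  ext p q
  have h1 : ∀ ψ : Fin d → ℂ, (copies M ψ)ᵀ p.1 q.1 * copiesOn x ψ p.2 q.2 =
      if ∀ k, k ∉ x → p.2 k = q.2 k then
        ((ty q.1 + tyOn x p.2).map ψ).prod * star ((ty p.1 + tyOn x q.2).map ψ).prod else 0 := by
    intro ψ
    simp only [copies, copiesOn, Matrix.transpose_apply, Matrix.of_apply]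
    have h2 : (∏ k, if k ∈ x then ψ (p.2 k) * star (ψ (q.2 k)) else if p.2 k = q.2 k then 1 else 0) =
        if ∀ k, k ∉ x → p.2 k = q.2 k then ∏ k ∈ x, ψ (p.2 k) * star (ψ (q.2 k)) else 0 := by
      split_ifs with h
      · rw [← Finset.prod_subset (Finset.subset_univ x)]
        · exact Finset.prod_congr rfl fun k hk => if_pos hk
        · intro k _ hk
          rw [if_neg hk, if_pos (h k hk)]
      · push Not at h
        obtain ⟨k, hk, hne⟩ := h
        exact Finset.prod_eq_zero (Finset.mem_univ k) (by rw [if_neg hk, if_neg hne])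
    rw [h2, Finset.prod_mul_distrib, Finset.prod_mul_distrib, ← star_prod, ← star_prod,
      prod_eq_map_tyOn, prod_eq_map_tyOn, prod_eq_map_tyOn, prod_eq_map_tyOn]
    split_ifs
    · simp only [Multiset.map_add, Multiset.prod_add, star_mul']
      ring
    · simp
  simp only [cloningOpOn, cloneKer, Matrix.of_apply, Matrix.map_apply, h1]
  by_cases h : ∀ k, k ∉ x → p.2 k = q.2 k
  · simp only [if_pos h]
    rw [if_congr (and_iff_right h) rfl rfl]
    have h2 : ∫ U : SU d, ((ty q.1 + tyOn x p.2).map (pureState U)).prod *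
        star ((ty p.1 + tyOn x q.2).map (pureState U)).prod ∂(haarSU d) =
        moment (ty q.1 + tyOn x p.2) (ty p.1 + tyOn x q.2) := rfl
    rw [h2]
    split_ifs with h3
    · rw [← h3, moment_self]; push_cast; rfl
    · rw [moment_eq_zero _ h3]
      · simp
      · simp [card_tyOn]
  · simp only [if_neg h, if_neg fun h' : _ ∧ _ => h h'.1]
    simp

lemma cloningOp_eq (α : Finset (Fin N) → ℝ) :
    cloningOp d M α = (cloneMat d M α).map Complex.ofReal := by
  ext p q
  simp [cloningOp, cloneMat, cloningOpOn_eq, Matrix.sum_apply]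

lemma cloneKer_transpose (x : Finset (Fin N)) : (cloneKer d M x)ᵀ = cloneKer d M x := by
  ext p q
  simp only [cloneKer, Matrix.transpose_apply, Matrix.of_apply]
  have h : ((∀ k, k ∉ x → q.2 k = p.2 k) ∧ ty p.1 + tyOn x q.2 = ty q.1 + tyOn x p.2) ↔
      ((∀ k, k ∉ x → p.2 k = q.2 k) ∧ ty q.1 + tyOn x p.2 = ty p.1 + tyOn x q.2) := by
    simp only [eq_comm]
  by_cases h' : (∀ k, k ∉ x → p.2 k = q.2 k) ∧ ty q.1 + tyOn x p.2 = ty p.1 + tyOn x q.2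
  · rw [if_pos h', if_pos (h.mpr h'), h'.2]
  · rw [if_neg h', if_neg fun h'' => h' (h.mp h'')]

lemma cloneMat_transpose (α : Finset (Fin N) → ℝ) : (cloneMat d M α)ᵀ = cloneMat d M α := by
  simp [cloneMat, Matrix.transpose_sum, cloneKer_transpose]

lemma cloneKer_nonneg (x : Finset (Fin N)) (p q : Conf d M × Conf d N) :
    0 ≤ cloneKer d M x p q := by
  simp only [cloneKer, Matrix.of_apply]
  split_ifs
  · exact mul_nonneg (Nat.cast_nonneg _) (mu_pos _).le
  · exact le_rfl

lemma cloneMat_nonneg {α : Finset (Fin N) → ℝ} (hα : ∀ x, 0 ≤ α x) (p q : Conf d M × Conf d N) :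
    0 ≤ cloneMat d M α p q := by
  simp only [cloneMat, Matrix.sum_apply, Matrix.smul_apply, smul_eq_mul]
  exact Finset.sum_nonneg fun x _ => mul_nonneg (hα x) (cloneKer_nonneg x p q)

lemma cloneMat_pos {α : Finset (Fin N) → ℝ} (hα : ∀ x, 0 ≤ α x) {x : Finset (Fin N)} (hx : 0 < α x)
    {p q : Conf d M × Conf d N} (h1 : ∀ k, k ∉ x → p.2 k = q.2 k)
    (h2 : ty q.1 + tyOn x p.2 = ty p.1 + tyOn x q.2) : 0 < cloneMat d M α p q := by
  simp only [cloneMat, Matrix.sum_apply, Matrix.smul_apply, smul_eq_mul]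
  refine Finset.sum_pos' (fun x _ => mul_nonneg (hα x) (cloneKer_nonneg x p q))
    ⟨x, Finset.mem_univ x, mul_pos hx ?_⟩
  simp only [cloneKer, Matrix.of_apply]
  rw [if_pos ⟨h1, h2⟩]
  exact mul_pos (Nat.cast_pos.mpr (symDim_pos d M (Nat.pos_of_ne_zero (NeZero.ne d)))) (mu_pos _)

lemma cloneMat_isHermitian (α : Finset (Fin N) → ℝ) : (cloningOp d M α).IsHermitian := by
  rw [cloningOp_eq]
  ext i j
  simpa [Matrix.conjTranspose_apply] using congrFun (congrFun (cloneMat_transpose α) i) j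

/-- The sites of IN are complex conjugated, those of OUT are not. -/
def inOut (M N : ℕ) : Fin M ⊕ Fin N → Bool := Sum.elim (fun _ => true) (fun _ => false)

/-- The infinitesimal action of a matrix on IN ⊗ OUT. -/
def jointTot (M N : ℕ) (X : Matrix (Fin d) (Fin d) ℂ) : JointOp d M N :=
  (tot (inOut M N) X).submatrix (Equiv.sumArrowEquivProdArrow (Fin M) (Fin N) (Fin d)).symm
    (Equiv.sumArrowEquivProdArrow (Fin M) (Fin N) (Fin d)).symm

/-- The transpose of a projector is its complex conjugate, so `R_x` is a twirl over all the sites,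
with IN conjugated and the sites outside `x` carrying the identity. -/
lemma cloningOpOn_commute (x : Finset (Fin N)) (X : Matrix (Fin d) (Fin d) ℂ) :
    cloningOpOn d M x * jointTot M N X = jointTot M N X * cloningOpOn d M x := by
  have h : cloningOpOn d M x = (symDim d M : ℂ) • (twirl (inOut M N)
      (Sum.elim (fun _ => true) fun k => decide (k ∈ x))).submatrix
      (Equiv.sumArrowEquivProdArrow (Fin M) (Fin N) (Fin d)).symm
      (Equiv.sumArrowEquivProdArrow (Fin M) (Fin N) (Fin d)).symm := by
    ext p q
    simp only [cloningOpOn, twirl, Matrix.of_apply, Matrix.smul_apply, Matrix.submatrix_apply,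
      smul_eq_mul]
    congr 2
    funext U
    have he : ∀ p : Conf d M × Conf d N,
        (Equiv.sumArrowEquivProdArrow (Fin M) (Fin N) (Fin d)).symm p = Sum.elim p.1 p.2 :=
      fun _ => rfl
    rw [tensorMat, Matrix.of_apply, Fintype.prod_sum_type, he, he]
    congr 1
    · simp only [copies, Matrix.transpose_apply, Matrix.of_apply]
      refine Finset.prod_congr rfl fun k _ => ?_
      simp [siteKer, inOut, siteRep, Matrix.vecMulVec_apply, mul_comm]
    · simp only [copiesOn, Matrix.of_apply]
      refine Finset.prod_congr rfl fun k _ => ?_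
      by_cases hk : k ∈ x
      · simp [siteKer, inOut, siteRep, Matrix.vecMulVec_apply, hk]
      · simp only [siteKer, hk, Sum.elim_inr, decide_false, Bool.false_eq_true, if_false,
          Matrix.one_apply]
  rw [h, jointTot, smul_mul_assoc, mul_smul_comm, Matrix.submatrix_mul_equiv,
    Matrix.submatrix_mul_equiv, twirl_commute_tot]

lemma cloningOp_commute (α : Finset (Fin N) → ℝ) (X : Matrix (Fin d) (Fin d) ℂ) :
    cloningOp d M α * jointTot M N X = jointTot M N X * cloningOp d M α := by
  rw [cloningOp, Finset.sum_mul, Finset.mul_sum]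
  refine Finset.sum_congr rfl fun x _ => ?_
  rw [smul_mul_assoc, mul_smul_comm, cloningOpOn_commute]

end CloningOp

/-! ### Weights of the infinitesimal action on IN ⊗ OUT -/

section Weights

variable {d M N : ℕ}

lemma tot_mulVec {ι : Type*} [Fintype ι] [DecidableEq ι] (f : ι → Bool)
    (X : Matrix (Fin d) (Fin d) ℂ) (v : (ι → Fin d) → ℂ) (s : ι → Fin d) :
    (tot f X *ᵥ v) s = ∑ k, ∑ l, siteLie (f k) X (s k) l * v (Function.update s k l) := by
  rw [tot, Matrix.sum_mulVec, Finset.sum_apply]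
  refine Finset.sum_congr rfl fun k _ => ?_
  rw [Matrix.mulVec, dotProduct, sum_siteMat_mul]

lemma jointTot_mulVec (X : Matrix (Fin d) (Fin d) ℂ) (v : Conf d M × Conf d N → ℂ)
    (p : Conf d M × Conf d N) :
    (jointTot M N X *ᵥ v) p = ∑ k, ∑ l, X (p.2 k) l * v (p.1, Function.update p.2 k l) -
      ∑ k, ∑ l, X l (p.1 k) * v (Function.update p.1 k l, p.2) := by
  have he : ∀ p : Conf d M × Conf d N,
      (Equiv.sumArrowEquivProdArrow (Fin M) (Fin N) (Fin d)).symm p = Sum.elim p.1 p.2 :=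
    fun _ => rfl
  rw [jointTot, Matrix.submatrix_mulVec_equiv, Function.comp_apply, tot_mulVec,
    Fintype.sum_sum_type, add_comm, sub_eq_add_neg, ← Finset.sum_neg_distrib, he]
  congr 1
  · refine Finset.sum_congr rfl fun k _ => Finset.sum_congr rfl fun l _ => ?_
    rw [← Sum.elim_update_right]
    rfl
  · refine Finset.sum_congr rfl fun k _ => ?_
    rw [← Finset.sum_neg_distrib]
    refine Finset.sum_congr rfl fun l _ => ?_
    rw [← Sum.elim_update_left]
    exact neg_mul (X l (p.1 k)) (v (Function.update p.1 k l, p.2))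

lemma jointTot_single_mulVec (i j : Fin d) (v : Conf d M × Conf d N → ℂ)
    (p : Conf d M × Conf d N) :
    (jointTot M N (Matrix.single i j 1) *ᵥ v) p =
      (∑ k, if p.2 k = i then v (p.1, Function.update p.2 k j) else 0) -
      ∑ k, if p.1 k = j then v (Function.update p.1 k i, p.2) else 0 := by
  rw [jointTot_mulVec]
  congr 1
  · refine Finset.sum_congr rfl fun k _ => ?_
    rw [Finset.sum_eq_single j]
    · simp [Matrix.single_apply, eq_comm]
    · intro l _ hl
      simp [hl.symm]
    · simp
  · refine Finset.sum_congr rfl fun k _ => ?_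
    rw [Finset.sum_eq_single i]
    · simp [Matrix.single_apply, eq_comm]
    · intro l _ hl
      simp [hl.symm]
    · simp

/-- The weight of a configuration of IN ⊗ OUT: the number of letters `i` on OUT, minus the number
of letters `i` on IN. -/
def wt (p : Conf d M × Conf d N) (i : Fin d) : ℤ := (ty p.2).count i - (ty p.1).count i

lemma jointTot_single_self_mulVec (i : Fin d) (v : Conf d M × Conf d N → ℂ)
    (p : Conf d M × Conf d N) :
    (jointTot M N (Matrix.single i i 1) *ᵥ v) p = wt p i * v p := by
  rw [jointTot_single_mulVec, wt, count_tyOn, count_tyOn, Finset.card_filter, Finset.card_filter]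
  push_cast
  rw [sub_mul, Finset.sum_mul, Finset.sum_mul]
  congr 1
  · refine Finset.sum_congr rfl fun k _ => ?_
    split_ifs with h
    · rw [← h, Function.update_eq_self, one_mul]
    · rw [zero_mul]
  · refine Finset.sum_congr rfl fun k _ => ?_
    split_ifs with h
    · rw [← h, Function.update_eq_self, one_mul]
    · rw [zero_mul]

lemma jointTot_conjTranspose (X : Matrix (Fin d) (Fin d) ℂ) :
    (jointTot M N X)ᴴ = jointTot M N Xᴴ := by
  rw [jointTot, Matrix.conjTranspose_submatrix, tot_conjTranspose, jointTot]

lemma jointTot_comm (X Y : Matrix (Fin d) (Fin d) ℂ) :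
    jointTot M N X * jointTot M N Y - jointTot M N Y * jointTot M N X =
      jointTot M N (X * Y - Y * X) := by
  rw [jointTot, jointTot, jointTot, Matrix.submatrix_mul_equiv, Matrix.submatrix_mul_equiv,
    ← tot_comm]
  rfl

lemma jointTot_sub (X Y : Matrix (Fin d) (Fin d) ℂ) :
    jointTot M N (X - Y) = jointTot M N X - jointTot M N Y := by
  rw [jointTot, tot_sub]
  rfl

/-- A vector all of whose components have the same weight. -/
def HasWeight (v : Conf d M × Conf d N → ℂ) (w : Fin d → ℤ) : Prop :=
  ∀ p, v p ≠ 0 → wt p = w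

lemma HasWeight.mulVec {v : Conf d M × Conf d N → ℂ} {w : Fin d → ℤ} (h : HasWeight v w)
    (i j : Fin d) :
    HasWeight (jointTot M N (Matrix.single i j 1) *ᵥ v) (w + Pi.single i 1 - Pi.single j 1) := by
  intro p hp
  rw [jointTot_single_mulVec] at hp
  have h1 : (∃ k, p.2 k = i ∧ v (p.1, Function.update p.2 k j) ≠ 0) ∨
      ∃ k, p.1 k = j ∧ v (Function.update p.1 k i, p.2) ≠ 0 := by
    by_contra! hcon
    apply hp
    rw [Finset.sum_eq_zero, Finset.sum_eq_zero, sub_zero]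
    · intro k _
      split_ifs with hk
      · exact hcon.2 k hk
      · rfl
    · intro k _
      split_ifs with hk
      · exact hcon.1 k hk
      · rfl
  funext l
  rcases h1 with ⟨k, hk, hv⟩ | ⟨k, hk, hv⟩
  · rw [← h _ hv]
    have h2 := congrArg (Multiset.count l) (tyOn_update (Finset.mem_univ k) p.2 j)
    rw [hk] at h2
    simp only [Multiset.count_add, Multiset.count_singleton] at h2
    simp only [wt, Pi.sub_apply, Pi.add_apply, Pi.single_apply]
    split_ifs at h2 ⊢ <;> (zify at h2; linarith)
  · rw [← h _ hv]
    have h2 := congrArg (Multiset.count l) (tyOn_update (Finset.mem_univ k) p.1 i)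
    rw [hk] at h2
    simp only [Multiset.count_add, Multiset.count_singleton] at h2
    simp only [wt, Pi.sub_apply, Pi.add_apply, Pi.single_apply]
    split_ifs at h2 ⊢ <;> (zify at h2; linarith)

lemma star_mulVec_dotProduct {κ : Type*} [Fintype κ] (A : Matrix κ κ ℂ) (v : κ → ℂ) :
    star (A *ᵥ v) ⬝ᵥ (A *ᵥ v) = star v ⬝ᵥ (Aᴴ *ᵥ (A *ᵥ v)) := by
  rw [Matrix.star_mulVec, Matrix.dotProduct_mulVec, Matrix.dotProduct_mulVec,
    Matrix.dotProduct_mulVec]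

/-- The raising operator between a smaller and a larger component of the weight is injective. -/
lemma HasWeight.raise {v : Conf d M × Conf d N → ℂ} {w : Fin d → ℤ} (h : HasWeight v w)
    (hv : v ≠ 0) {i j : Fin d} (hij : w i < w j) :
    jointTot M N (Matrix.single j i 1) *ᵥ (jointTot M N (Matrix.single i j 1) *ᵥ v) ≠ 0 := by
  intro h0
  set A := jointTot M N (Matrix.single i j (1 : ℂ)) with hA
  have hAH : Aᴴ = jointTot M N (Matrix.single j i (1 : ℂ)) := by
    rw [hA, jointTot_conjTranspose, Matrix.conjTranspose_single, star_one]
  rw [← hAH] at h0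
  -- If `Aᴴ A v = 0`, the `sl₂` relation gives `-A Aᴴ v = (w j - w i) v`. Pairing with `v` equates
  -- minus a squared norm with a positive number.
  have hcomm : Aᴴ * A - A * Aᴴ = jointTot M N (Matrix.single j j 1) -
      jointTot M N (Matrix.single i i 1) := by
    rw [hAH, hA, jointTot_comm, Matrix.single_mul_single_same, Matrix.single_mul_single_same,
      jointTot_sub, one_mul]
  have h1 : (Aᴴ * A - A * Aᴴ) *ᵥ v = ((w j - w i : ℤ) : ℂ) • v := by
    rw [hcomm, Matrix.sub_mulVec]
    funext p
    rw [Pi.sub_apply, jointTot_single_self_mulVec, jointTot_single_self_mulVec, Pi.smul_apply,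
      smul_eq_mul]
    by_cases hp : v p = 0
    · simp [hp]
    · rw [h p hp]
      push_cast
      ring
  rw [Matrix.sub_mulVec, ← Matrix.mulVec_mulVec, ← Matrix.mulVec_mulVec, h0, zero_sub] at h1
  have h2 := congrArg (fun u => star v ⬝ᵥ u) h1
  simp only [dotProduct_neg, dotProduct_smul, smul_eq_mul] at h2
  have h3 := star_mulVec_dotProduct Aᴴ v
  rw [Matrix.conjTranspose_conjTranspose] at h3
  rw [← h3] at h2
  have h4 : 0 ≤ star (Aᴴ *ᵥ v) ⬝ᵥ (Aᴴ *ᵥ v) := dotProduct_star_self_nonneg _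
  have h5 : 0 < star v ⬝ᵥ v := Matrix.dotProduct_star_self_pos_iff.mpr hv
  have h6 : (0 : ℂ) < ((w j - w i : ℤ) : ℂ) := by
    exact_mod_cast sub_pos.mpr hij
  have h7 := mul_pos h6 h5
  rw [← h2] at h7
  exact lt_irrefl _ (h7.trans_le (neg_nonpos.mpr h4))

lemma sum_count {m : Multiset (Fin d)} : ∑ i, m.count i = m.card :=
  Multiset.sum_count_eq_card fun _ _ => Finset.mem_univ _

lemma sum_wt (p : Conf d M × Conf d N) : ∑ i, wt p i = N - M := by
  simp only [wt]
  rw [Finset.sum_sub_distrib]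
  have h1 := sum_count (m := ty p.1)
  have h2 := sum_count (m := ty p.2)
  rw [card_ty] at h1 h2
  zify at h1 h2
  rw [h1, h2]

/-- Starting from a weight with a negative component in an invariant space of vectors, raising
operators lead to a nonnegative weight. -/
lemma exists_raise {T : Set (Conf d M × Conf d N → ℂ)} (hMN : M ≤ N)
    (hT : ∀ v ∈ T, ∀ i j, jointTot M N (Matrix.single i j 1) *ᵥ v ∈ T)
    {v : Conf d M × Conf d N → ℂ} (hv : v ∈ T) (hv0 : v ≠ 0) {w : Fin d → ℤ} (h : HasWeight v w)
    (hneg : ∃ i, w i < 0) :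
    ∃ i j, ∃ v' ∈ T, ∃ w' : Fin d → ℤ, HasWeight v' w' ∧ (∀ l, 0 ≤ w' l) ∧ w' i = 0 ∧ i ≠ j ∧
      jointTot M N (Matrix.single j i 1) *ᵥ v' ≠ 0 := by
  induction hn : ∑ i, (-w i).toNat using Nat.strong_induction_on generalizing v w with
  -- The induction is on the total of the negative parts of the weight. A negative component forces
  -- a positive one, since the sum is `N - M ≥ 0`; moving one unit from `j` to `i` lowers the total.
  | _ n ih =>
    obtain ⟨i, hi⟩ := hneg
    obtain ⟨p, hp⟩ := Function.ne_iff.mp hv0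
    have hsum := sum_wt p
    rw [h p hp] at hsum
    obtain ⟨j, hj⟩ : ∃ j, 0 < w j := by
      by_contra! hcon
      have := Finset.sum_lt_sum (s := Finset.univ) (f := w) (g := 0) (fun l _ => hcon l)
        ⟨i, Finset.mem_univ i, hi⟩
      simp only [Pi.zero_apply, Finset.sum_const_zero] at this
      omega
    have hij : i ≠ j := by
      rintro rfl; omega
    have h1 := h.raise hv0 (hi.trans hj)
    have h2 := h.mulVec i j
    have h3 := hT v hv i j
    by_cases hpos : ∀ l, 0 ≤ (w + Pi.single i 1 - Pi.single j 1 : Fin d → ℤ) l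
    -- At the first nonnegative weight the component `i` has just risen from a negative integer by
    -- one, so it is exactly zero.
    · refine ⟨i, j, _, h3, _, h2, hpos, ?_, hij, h1⟩
      have := hpos i
      simp [hij] at this ⊢
      omega
    · push Not at hpos
      refine ih _ ?_ h3 ?_ h2 hpos rfl
      · rw [← hn]
        refine Finset.sum_lt_sum (fun l _ => ?_) ⟨i, Finset.mem_univ i, ?_⟩
        · by_cases hlj : l = j
          · subst hlj
            simp [hij.symm]
            omega
          · by_cases hli : l = i
            · subst hli
              simp [hij]
            · simp [hlj, hli]
        · simp [hij]
          omega
      · intro h0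
        rw [h0, Matrix.mulVec_zero] at h1
        exact h1 rfl

/-- A nonnegative weight is a multiset of letters, namely those that OUT has beyond the ones of IN.
-/
lemma HasWeight.exists_type {v : Conf d M × Conf d N → ℂ} {w : Fin d → ℤ} (h : HasWeight v w)
    (hv : v ≠ 0) (hw : ∀ l, 0 ≤ w l) :
    ∃ τ : Multiset (Fin d), (∀ p, v p ≠ 0 → ty p.2 = ty p.1 + τ) ∧ ∀ i, (τ.count i : ℤ) = w i := by
  have hle : ∀ q, v q ≠ 0 → ty q.1 ≤ ty q.2 := by
    intro q hq
    rw [Multiset.le_iff_count]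
    intro i
    have := hw i
    rw [← h q hq, wt] at this
    omega
  obtain ⟨p, hp⟩ := Function.ne_iff.mp hv
  have hc : ∀ i, ((ty p.2 - ty p.1).count i : ℤ) = w i := by
    intro i
    have := Multiset.le_iff_count.mp (hle p hp) i
    rw [← h p hp, wt, Multiset.count_sub]
    omega
  refine ⟨ty p.2 - ty p.1, fun q hq => ?_, hc⟩
  ext i
  have h1 := hc i
  rw [← h q hq, wt] at h1
  rw [Multiset.count_add]
  omega

end Weights

/-! ### The action of `R` on the family of optimal vectors -/

section Action

variable {d M N : ℕ}

/-- The sum of the weights `β_y` of the sets of sites `y` that carry a given type. -/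
def hvec (β : Sites M N → ℝ) (m : Multiset (Fin d)) (b : Conf d N) : ℝ :=
  ∑ y, β y * if tyOn y.1 b = m then 1 else 0

/-- The vector `∑_y β_y |B_y⟩|Φ⟩_ȳ`, up to a factor, `Φ` being the symmetric state of type `τ`. -/
def uvec (β : Sites M N → ℝ) (τ : Multiset (Fin d)) (p : Conf d M × Conf d N) : ℝ :=
  if ty p.2 = ty p.1 + τ then (cnt d M (ty p.1) : ℝ)⁻¹ * hvec β (ty p.1) p.2 else 0

lemma uvec_eq_sum (β : Sites M N → ℝ) (τ : Multiset (Fin d)) (p : Conf d M × Conf d N) :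
    uvec β τ p = ∑ y, β y * uvec (Pi.single y 1) τ p := by
  have h : ∀ y : Sites M N, hvec (Pi.single y 1) (ty p.1) p.2 =
      if tyOn y.1 p.2 = ty p.1 then 1 else 0 := by
    intro y
    rw [hvec, Finset.sum_eq_single y]
    · simp
    · intro z _ hz
      simp [hz]
    · simp
  simp only [uvec, h]
  split_ifs
  · rw [hvec, Finset.mul_sum]
    refine Finset.sum_congr rfl fun y _ => ?_
    ring
  · simp

lemma uvec_single (y : Sites M N) (τ : Multiset (Fin d)) (p : Conf d M × Conf d N) :
    uvec (Pi.single y 1) τ p = if tyOn y.1 p.2 = ty p.1 ∧ tyOn y.1ᶜ p.2 = τ then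
      (cnt d M (ty p.1) : ℝ)⁻¹ else 0 := by
  have h : hvec (Pi.single y 1) (ty p.1) p.2 = if tyOn y.1 p.2 = ty p.1 then 1 else 0 := by
    rw [hvec, Finset.sum_eq_single y]
    · simp
    · intro z _ hz
      simp [hz]
    · simp
  rw [uvec, h, ← tyOn_add_compl y.1 p.2]
  by_cases h1 : tyOn y.1 p.2 = ty p.1
  · simp [h1]
  · simp [h1]

variable [NeZero d]

/-- The matrix elements of `R_x` in the family of vectors `uvec`. -/
def gKer (d M : ℕ) {N : ℕ} (x : Finset (Fin N)) : Matrix (Sites M N) (Sites M N) ℝ :=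
  Matrix.of fun z y => if z.1 ⊆ x ∪ y.1 then
    symDim d M * (symDim d (x ∪ y.1).card : ℝ)⁻¹ * ((x ∪ y.1).card.choose M : ℝ)⁻¹ else 0

/-- The matrix elements of `R` in the family of vectors `uvec`. -/
def gMat (d M : ℕ) {N : ℕ} (α : Finset (Fin N) → ℝ) : Matrix (Sites M N) (Sites M N) ℝ :=
  ∑ x, α x • gKer d M x

lemma gKer_nonneg (x : Finset (Fin N)) (z y : Sites M N) : 0 ≤ gKer d M x z y := by
  simp only [gKer, Matrix.of_apply]
  split_ifs <;> positivity

lemma gMat_nonneg {α : Finset (Fin N) → ℝ} (hα : ∀ x, 0 ≤ α x) (z y : Sites M N) :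
    0 ≤ gMat d M α z y := by
  simp only [gMat, Matrix.sum_apply, Matrix.smul_apply, smul_eq_mul]
  exact Finset.sum_nonneg fun x _ => mul_nonneg (hα x) (gKer_nonneg x z y)

/-- The Bell vector identifies the letters of IN with those on `y`, which eliminates the sum over
IN. The letters on `x ∩ y` are summed freely and drop out by `csum_mu_add`; those on `x \ y` remain
as `r`. The result sees `x` and `y` only through their union. -/
lemma cloneKer_mulVec_aux (x : Finset (Fin N)) (y : Sites M N) (τ : Multiset (Fin d))
    (p : Conf d M × Conf d N) :
    (cloneKer d M x *ᵥ uvec (Pi.single y 1) τ) p = if ty p.2 = ty p.1 + τ then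
      symDim d M * mu (tyOn (x ∪ y.1) p.2) * (csum d ((x ∪ y.1).card - M) fun r =>
        if ty p.1 + r = tyOn (x ∪ y.1) p.2 then (1 : ℝ) else 0) else 0 := by
  obtain ⟨a, b⟩ := p
  dsimp only
  set X := x ∪ y.1 with hX
  have h1 : (cloneKer d M x *ᵥ uvec (Pi.single y 1) τ) (a, b) = ∑ b' ∈ free x b,
      if tyOn y.1 b' + tyOn x b = ty a + tyOn x b' ∧ tyOn y.1ᶜ b' = τ then
        symDim d M * mu (tyOn y.1 b' + tyOn x b) else 0 := by
    rw [Matrix.mulVec, dotProduct, Fintype.sum_prod_type, Finset.sum_comm, free, Finset.sum_filter]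
    refine Finset.sum_congr rfl fun b' _ => ?_
    by_cases hb : ∀ k, k ∉ x → b' k = b k
    · rw [if_pos hb]
      -- As a function of `a'` the summand is supported on a single type, and the `cnt⁻¹` of the
      -- Bell vector cancels the number of configurations of that type.
      have h2 : ∀ a' : Conf d M, cloneKer d M x (a, b) (a', b') * uvec (Pi.single y 1) τ (a', b') =
          (fun m => if m = tyOn y.1 b' then ((cnt d M m : ℝ)⁻¹ *
            if m + tyOn x b = ty a + tyOn x b' ∧ tyOn y.1ᶜ b' = τ then
              symDim d M * mu (m + tyOn x b) else 0) else 0) (ty a') := by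
        intro a'
        rw [uvec_single]
        simp only [cloneKer, Matrix.of_apply]
        rw [if_congr (and_iff_right fun k hk => (hb k hk).symm) rfl rfl]
        by_cases h3 : ty a' = tyOn y.1 b'
        · rw [if_pos h3, h3]
          by_cases h4 : tyOn y.1ᶜ b' = τ
          · simp only [h4, and_self, and_true, if_true]
            ring
          · simp [h4]
        · rw [if_neg h3, if_neg (c := tyOn y.1 b' = ty a' ∧ tyOn y.1ᶜ b' = τ)
            (fun h4 => h3 h4.1.symm), mul_zero]
      rw [Finset.sum_congr rfl fun a' _ => h2 a']
      refine (csum_ite_eq (n := M) (tyOn y.1 b') fun m => (cnt d M m : ℝ)⁻¹ *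
            if m + tyOn x b = ty a + tyOn x b' ∧ tyOn y.1ᶜ b' = τ then
              symDim d M * mu (m + tyOn x b) else 0).trans ?_
      rw [← mul_assoc, mul_inv_cancel₀ (cnt_ne_zero (by rw [card_tyOn, y.2])), one_mul]
    · rw [if_neg hb]
      refine Finset.sum_eq_zero fun a' _ => ?_
      simp only [cloneKer, Matrix.of_apply]
      rw [if_neg, zero_mul]
      exact fun h => hb fun k hk => (h.1 k hk).symm
  have hdisj : Disjoint (x ∩ y.1) (x \ y.1) := by
    rw [Finset.disjoint_left]; intro k; simp; tauto
  have hun : (x ∩ y.1) ∪ (x \ y.1) = x := by ext k; simp; tauto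
  have hcard : (x \ y.1).card = X.card - M := by
    have h1 := Finset.card_sdiff_add_card x y.1
    have h2 := y.2
    rw [hX]
    omega
  have h5 : ∀ b' ∈ free (x \ y.1) b, ∑ b'' ∈ free (x ∩ y.1) b',
      (if tyOn y.1 b'' + tyOn x b = ty a + tyOn x b'' ∧ tyOn y.1ᶜ b'' = τ then
        symDim d M * mu (tyOn y.1 b'' + tyOn x b) else 0) =
      if ty b = ty a + τ ∧ ty a + tyOn (x \ y.1) b' = tyOn X b then
        symDim d M * mu (tyOn X b) else 0 := by
    intro b' hb'
    rw [mem_free] at hb'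
    have hH : ∀ b'' ∈ free (x ∩ y.1) b',
        (if tyOn y.1 b'' + tyOn x b = ty a + tyOn x b'' ∧ tyOn y.1ᶜ b'' = τ then
          symDim d M * mu (tyOn y.1 b'' + tyOn x b) else 0) =
        (fun c => if ty b = ty a + τ ∧ ty a + tyOn (x \ y.1) b' = tyOn X b then
          symDim d M * mu (tyOn X b + c) else 0) (tyOn (x ∩ y.1) b'') := by
      intro b'' hb''
      rw [mem_free] at hb''
      have e1 : tyOn (x \ y.1) b'' = tyOn (x \ y.1) b' :=
        tyOn_congr fun k hk => hb'' k (by simp at hk ⊢; tauto)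
      have e2 : tyOn (y.1 \ x) b'' = tyOn (y.1 \ x) b := tyOn_congr fun k hk => by
        rw [hb'' k (by simp at hk ⊢; tauto), hb' k (by simp at hk ⊢; tauto)]
      have e3 : tyOn Xᶜ b'' = tyOn Xᶜ b := tyOn_congr fun k hk => by
        rw [hb'' k (by simp [hX] at hk ⊢; tauto), hb' k (by simp [hX] at hk ⊢; tauto)]
      have e4 : tyOn y.1 b'' = tyOn (x ∩ y.1) b'' + tyOn (y.1 \ x) b := by
        rw [← e2, ← tyOn_union]
        · congr 1; ext k; simp; tauto
        · rw [Finset.disjoint_left]; intro k; simp; tauto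
      have e5 : tyOn x b'' = tyOn (x ∩ y.1) b'' + tyOn (x \ y.1) b' := by
        rw [← e1, ← tyOn_union hdisj, hun]
      have e6 : tyOn y.1ᶜ b'' = tyOn (x \ y.1) b' + tyOn Xᶜ b := by
        rw [← e1, ← e3, ← tyOn_union]
        · congr 1; ext k; simp [hX]; tauto
        · rw [Finset.disjoint_left]; intro k; simp [hX]; tauto
      have e7 : tyOn (y.1 \ x) b + tyOn x b = tyOn X b := by
        rw [← tyOn_union]
        · congr 1; ext k; simp [hX]; tauto
        · rw [Finset.disjoint_left]; intro k; simp
      have e8 : tyOn y.1 b'' + tyOn x b = tyOn X b + tyOn (x ∩ y.1) b'' := by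
        rw [e4, add_assoc, e7, add_comm]
      rw [e8, e5, e6]
      refine if_congr ?_ rfl rfl
      rw [add_comm (tyOn X b), add_left_comm (ty a), add_right_inj, ← tyOn_add_compl X b]
      constructor
      · rintro ⟨h6, h7⟩
        refine ⟨?_, h6.symm⟩
        rw [h6, ← h7, add_assoc]
      · rintro ⟨h6, h7⟩
        refine ⟨h7.symm, ?_⟩
        rw [← h7, add_assoc, add_right_inj] at h6
        exact h6
    rw [sum_free (H := fun c => if ty b = ty a + τ ∧ ty a + tyOn (x \ y.1) b' = tyOn X b then
          symDim d M * mu (tyOn X b + c) else 0) hH]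
    split_ifs
    · rw [← mul_csum, csum_mu_add]
    · simp [csum]
  rw [h1]
  conv_lhs => rw [show free x b = free ((x ∩ y.1) ∪ (x \ y.1)) b by rw [hun]]
  rw [sum_free_union hdisj, Finset.sum_congr rfl h5, ← hcard]
  split_ifs with h6
  · rw [mul_csum]
    refine sum_free fun b' _ => ?_
    simp [h6]
  · simp [h6]

/-- By `mu_eq`, the moment in the previous formula is that of the symmetric projector on `x ∪ y`.
Since `cnt_mul_card_subsets` rewrites its action as an average over the `M`-subsets `z` of `x ∪ y`,
the image is again in the family, with coefficients independent of `τ`. -/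
lemma cloneKer_mulVec (x : Finset (Fin N)) (y : Sites M N) (τ : Multiset (Fin d))
    (p : Conf d M × Conf d N) :
    (cloneKer d M x *ᵥ uvec (Pi.single y 1) τ) p =
      ∑ z, gKer d M x z y * uvec (Pi.single z 1) τ p := by
  rw [cloneKer_mulVec_aux]
  set X := x ∪ y.1 with hX
  have hMX : M ≤ X.card := by
    rw [← y.2]; exact Finset.card_le_card Finset.subset_union_right
  have h1 := cnt_mul_card_subsets X M p.2 (ty p.1)
  have h2 : ∑ z : Sites M N, gKer d M x z y * uvec (Pi.single z 1) τ p =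
      if ty p.2 = ty p.1 + τ then
        symDim d M * (symDim d X.card : ℝ)⁻¹ * (X.card.choose M : ℝ)⁻¹ * (cnt d M (ty p.1) : ℝ)⁻¹ *
          ((X.powersetCard M).filter fun z => tyOn z p.2 = ty p.1).card else 0 := by
    have h3 : ∀ z : Sites M N, gKer d M x z y * uvec (Pi.single z 1) τ p =
        if ty p.2 = ty p.1 + τ then
          symDim d M * (symDim d X.card : ℝ)⁻¹ * (X.card.choose M : ℝ)⁻¹ * (cnt d M (ty p.1) : ℝ)⁻¹ *
          (if z.1 ⊆ X ∧ tyOn z.1 p.2 = ty p.1 then 1 else 0) else 0 := by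
      intro z
      rw [uvec_single, ← tyOn_add_compl z.1 p.2]
      simp only [gKer, Matrix.of_apply, ← hX]
      by_cases h4 : z.1 ⊆ X <;> by_cases h5 : tyOn z.1 p.2 = ty p.1 <;> simp [h4, h5]
    rw [Finset.sum_congr rfl fun z _ => h3 z]
    split_ifs
    · rw [← Finset.mul_sum]
      congr 1
      rw [Finset.card_filter, Nat.cast_sum]
      rw [← Finset.sum_subtype (p := fun z : Finset (Fin N) => z.card = M)
        (Finset.univ.filter fun z : Finset (Fin N) => z.card = M) (by simp)
        (fun z => if z ⊆ X ∧ tyOn z p.2 = ty p.1 then (1 : ℝ) else 0)]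
      rw [Finset.sum_filter, ← Finset.sum_filter_add_sum_filter_not Finset.univ
        (fun z => z ∈ X.powersetCard M), Finset.sum_eq_zero (s := Finset.univ.filter fun z =>
        ¬ z ∈ X.powersetCard M), add_zero, Finset.filter_mem_eq_inter, Finset.univ_inter]
      · refine Finset.sum_congr rfl fun z hz => ?_
        rw [Finset.mem_powersetCard] at hz
        simp [hz.1, hz.2]
      · intro z hz
        simp only [Finset.mem_filter, Finset.mem_powersetCard, Finset.mem_univ, true_and,
          not_and] at hz
        by_cases h5 : z.card = M
        · simp [h5, fun h => hz h h5]
          intro h6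
          exact absurd h5 (hz h6)
        · simp [h5]
    · simp
  rw [h2]
  split_ifs
  · have h6 : (csum d (X.card - M) fun r => if ty p.1 + r = tyOn X p.2 then (1 : ℝ) else 0) =
        ((csum d (X.card - M) fun r => if ty p.1 + r = tyOn X p.2 then 1 else 0 : ℕ) : ℝ) := by
      simp [csum]
    rw [h6, mu_eq (card_tyOn X p.2)]
    have h7 : (cnt d X.card (tyOn X p.2) : ℝ) *
        ((X.powersetCard M).filter fun z => tyOn z p.2 = ty p.1).card =
        X.card.choose M * (cnt d M (ty p.1) *
        (csum d (X.card - M) fun r => if ty p.1 + r = tyOn X p.2 then 1 else 0 : ℕ)) := by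
      exact_mod_cast h1
    have h8 : (cnt d X.card (tyOn X p.2) : ℝ) ≠ 0 := cnt_ne_zero (card_tyOn X p.2)
    have h9 : (cnt d M (ty p.1) : ℝ) ≠ 0 := cnt_ne_zero (card_ty p.1)
    have h10 : (X.card.choose M : ℝ) ≠ 0 := Nat.cast_ne_zero.mpr (Nat.choose_pos hMX).ne'
    have h11 : (symDim d X.card : ℝ) ≠ 0 :=
      Nat.cast_ne_zero.mpr (symDim_pos d _ (Nat.pos_of_ne_zero (NeZero.ne d))).ne'
    field_simp
    linear_combination (-(symDim d M : ℝ)) * h7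
  · rfl

lemma cloneMat_mulVec_uvec (α : Finset (Fin N) → ℝ) (β : Sites M N → ℝ) (τ : Multiset (Fin d)) :
    cloneMat d M α *ᵥ uvec β τ = uvec (gMat d M α *ᵥ β) τ := by
  have hu : uvec β τ = ∑ y, β y • uvec (d := d) (Pi.single y 1) τ := by
    funext p
    rw [uvec_eq_sum, Finset.sum_apply]
    rfl
  funext p
  calc (cloneMat d M α *ᵥ uvec β τ) p
      = ∑ y, ∑ x, ∑ z, β y * (α x * (gKer d M x z y * uvec (Pi.single z 1) τ p)) := by
        rw [hu, Matrix.mulVec_sum, Finset.sum_apply]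
        refine Finset.sum_congr rfl fun y _ => ?_
        rw [Matrix.mulVec_smul, cloneMat, Matrix.sum_mulVec, Pi.smul_apply, Finset.sum_apply,
          smul_eq_mul, Finset.mul_sum]
        refine Finset.sum_congr rfl fun x _ => ?_
        rw [Matrix.smul_mulVec, Pi.smul_apply, smul_eq_mul, cloneKer_mulVec, Finset.mul_sum,
          Finset.mul_sum]
    _ = ∑ y, ∑ z, ∑ x, β y * (α x * (gKer d M x z y * uvec (Pi.single z 1) τ p)) :=
        Finset.sum_congr rfl fun y _ => Finset.sum_comm
    _ = ∑ z, ∑ y, ∑ x, β y * (α x * (gKer d M x z y * uvec (Pi.single z 1) τ p)) :=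
        Finset.sum_comm
    _ = uvec (gMat d M α *ᵥ β) τ p := by
        rw [uvec_eq_sum]
        refine Finset.sum_congr rfl fun z _ => ?_
        rw [Matrix.mulVec, dotProduct, Finset.sum_mul]
        refine Finset.sum_congr rfl fun y _ => ?_
        rw [gMat, Matrix.sum_apply, Finset.sum_mul, Finset.sum_mul]
        refine Finset.sum_congr rfl fun x _ => ?_
        rw [Matrix.smul_apply, smul_eq_mul]
        ring

end Action

/-! ### The optimal weights -/

section Optimal

/-- A substitute for the Perron vector. The partial sums of `∑ λ^{-k} G^k 1` satisfy the desired
inequality up to the error `lam` in each entry, and their total grows at least linearly. After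
normalisation to the simplex the error tends to zero, and any limit point is the vector sought. -/
lemma exists_le_mulVec {ι : Type} [Fintype ι] [DecidableEq ι] {G : Matrix ι ι ℝ}
    (hG : ∀ i j, 0 ≤ G i j) {lam c : ℝ} (hlam : 0 < lam) (hc : 0 < c)
    (h : ∀ k : ℕ, c * lam ^ k ≤ ∑ i, (G ^ k *ᵥ 1) i) :
    ∃ β : ι → ℝ, (∀ i, 0 ≤ β i) ∧ β ≠ 0 ∧ ∀ i, lam * β i ≤ (G *ᵥ β) i := by
  have hGk : ∀ k i, 0 ≤ (G ^ k *ᵥ (1 : ι → ℝ)) i := by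
    intro k
    induction k with
    | zero => intro i; simp
    | succ k ih =>
      intro i
      rw [pow_succ', ← Matrix.mulVec_mulVec]
      exact Finset.sum_nonneg fun j _ => mul_nonneg (hG i j) (ih j)
  set b : ℕ → ι → ℝ := fun n => ∑ k ∈ Finset.range n, (lam ^ k)⁻¹ • (G ^ k *ᵥ (1 : ι → ℝ)) with hb
  have hb0 : ∀ n i, 0 ≤ b n i := by
    intro n i
    simp only [hb, Finset.sum_apply, Pi.smul_apply, smul_eq_mul]
    exact Finset.sum_nonneg fun k _ => mul_nonneg (by positivity) (hGk k i)
  have hbs : ∀ n : ℕ, c * n ≤ ∑ i, b n i := by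
    intro n
    induction n with
    | zero => simp [hb]
    | succ n ih =>
      have h1 : ∑ i, b (n + 1) i = (∑ i, b n i) + (lam ^ n)⁻¹ * ∑ i, (G ^ n *ᵥ (1 : ι → ℝ)) i := by
        simp only [hb, Finset.sum_range_succ, Pi.add_apply, Pi.smul_apply, smul_eq_mul,
          Finset.sum_add_distrib, Finset.mul_sum]
      have h2 : c ≤ (lam ^ n)⁻¹ * ∑ i, (G ^ n *ᵥ (1 : ι → ℝ)) i := by
        rw [inv_mul_eq_div, le_div_iff₀ (by positivity)]
        exact h n
      rw [h1]
      push_cast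
      linarith
  have hGb : ∀ n i, lam * b n i - lam ≤ (G *ᵥ b n) i := by
    intro n i
    -- Applying `G` shifts the series by one index; the initial term, the all-ones vector, is what
    -- goes missing.
    have h1 : G *ᵥ b n = lam • (b (n + 1) - 1) := by
      simp only [hb]
      rw [Finset.sum_range_succ', Matrix.mulVec_sum]
      simp only [pow_zero, inv_one, one_smul, Matrix.one_mulVec, add_sub_cancel_right,
        Finset.smul_sum]
      refine Finset.sum_congr rfl fun k _ => ?_
      rw [Matrix.mulVec_smul, Matrix.mulVec_mulVec, ← pow_succ', smul_smul, pow_succ' lam,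
        mul_inv, mul_inv_cancel_left₀ hlam.ne']
    have h2 : b n i ≤ b (n + 1) i := by
      simp only [hb, Finset.sum_range_succ, Pi.add_apply, Pi.smul_apply, smul_eq_mul]
      exact le_add_of_nonneg_right (mul_nonneg (by positivity) (hGk n i))
    rw [h1]
    simp only [Pi.smul_apply, Pi.sub_apply, Pi.one_apply, smul_eq_mul]
    nlinarith
  set S : ℕ → ℝ := fun n => ∑ i, b (n + 1) i with hS
  have hSpos : ∀ n, 0 < S n := fun n => lt_of_lt_of_le (by positivity) (hbs (n + 1))
  have hSinv : Filter.Tendsto (fun n => (S n)⁻¹) Filter.atTop (nhds 0) := by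
    refine tendsto_inv_atTop_zero.comp (Filter.tendsto_atTop_mono (fun n => hbs (n + 1)) ?_)
    exact (Filter.tendsto_const_mul_atTop_of_pos hc).mpr
      (tendsto_natCast_atTop_atTop.comp (Filter.tendsto_add_atTop_nat 1))
  have hmem : ∀ n, (S n)⁻¹ • b (n + 1) ∈ stdSimplex ℝ ι := by
    intro n
    refine ⟨fun i => mul_nonneg (inv_nonneg.mpr (hSpos n).le) (hb0 _ i), ?_⟩
    simp only [Pi.smul_apply, smul_eq_mul, ← Finset.mul_sum]
    exact inv_mul_cancel₀ (hSpos n).ne'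
  obtain ⟨β, hβ, φ, hφ, hlim⟩ := (isCompact_stdSimplex ℝ ι).tendsto_subseq hmem
  refine ⟨β, hβ.1, ?_, fun i => ?_⟩
  · rintro rfl
    simpa using hβ.2
  · have h1 : Filter.Tendsto (fun n => lam * ((S (φ n))⁻¹ • b (φ n + 1)) i - lam * (S (φ n))⁻¹)
        Filter.atTop (nhds (lam * β i - lam * 0)) :=
      ((tendsto_pi_nhds.mp hlim i).const_mul lam).sub
        ((hSinv.comp hφ.tendsto_atTop).const_mul lam)
    have hcont : Continuous fun v : ι → ℝ => (G *ᵥ v) i :=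
      (continuous_apply i).comp (continuous_const.matrix_mulVec continuous_id)
    have h2 : Filter.Tendsto (fun n => (G *ᵥ ((S (φ n))⁻¹ • b (φ n + 1))) i)
        Filter.atTop (nhds ((G *ᵥ β) i)) := (hcont.tendsto β).comp hlim
    rw [mul_zero, sub_zero] at h1
    refine le_of_tendsto_of_tendsto' h1 h2 fun n => ?_
    rw [Matrix.mulVec_smul]
    simp only [Pi.smul_apply, smul_eq_mul]
    have := mul_le_mul_of_nonneg_left (hGb (φ n + 1) i) (inv_nonneg.mpr (hSpos (φ n)).le)
    linarith

/-! ### Positivity of the invariant family and existence of the optimal weights -/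

variable {d M N : ℕ}

/-- The double count of `cnt_mul_card_subsets` has a positive right-hand side, so some subset
carries the type. -/
lemma exists_sites_tyOn (hMN : M ≤ N) {m τ : Multiset (Fin d)} (hm : m.card = M) {b : Conf d N}
    (h : ty b = m + τ) : ∃ y : Sites M N, tyOn y.1 b = m := by
  have hτ : τ.card = N - M := by
    have := congrArg Multiset.card h
    rw [card_ty, Multiset.card_add, hm] at this
    omega
  have h1 := cnt_mul_card_subsets Finset.univ M b m
  have h2 : 0 < csum d ((Finset.univ : Finset (Fin N)).card - M)
      fun r => if m + r = tyOn Finset.univ b then 1 else 0 := by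
    rw [Finset.card_univ, Fintype.card_fin]
    obtain ⟨c, hc⟩ := exists_ty_eq (N - M) τ hτ
    refine Finset.sum_pos' (fun _ _ => Nat.zero_le _) ⟨c, Finset.mem_univ c, ?_⟩
    simp only [hc]
    rw [if_pos h.symm]
    exact one_pos
  have h3 : 0 < cnt d M m := cnt_pos hm
  have h4 : 0 < (Finset.univ : Finset (Fin N)).card.choose M := by
    rw [Finset.card_univ, Fintype.card_fin]
    exact Nat.choose_pos hMN
  have h5 := mul_pos h4 (mul_pos h3 h2)
  rw [← h1] at h5
  obtain ⟨y, hy⟩ := Finset.card_pos.mp (Nat.pos_of_mul_pos_left h5)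
  rw [Finset.mem_filter, Finset.mem_powersetCard] at hy
  exact ⟨⟨y, hy.1.2⟩, hy.2⟩

lemma hvec_nonneg {β : Sites M N → ℝ} (hβ : ∀ y, 0 ≤ β y) (m : Multiset (Fin d)) (b : Conf d N) :
    0 ≤ hvec β m b :=
  Finset.sum_nonneg fun y _ => mul_nonneg (hβ y) (by split_ifs <;> simp)

lemma uvec_nonneg {β : Sites M N → ℝ} (hβ : ∀ y, 0 ≤ β y) (τ : Multiset (Fin d))
    (p : Conf d M × Conf d N) : 0 ≤ uvec β τ p := by
  rw [uvec]
  split_ifs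
  · exact mul_nonneg (by positivity) (hvec_nonneg hβ _ _)
  · exact le_rfl

lemma uvec_single_nonneg (y : Sites M N) (τ : Multiset (Fin d)) (p : Conf d M × Conf d N) :
    0 ≤ uvec (Pi.single y 1) τ p := by
  rw [uvec_single]
  split_ifs <;> positivity

lemma uvec_mono {β γ : Sites M N → ℝ} (h : ∀ y, β y ≤ γ y) (τ : Multiset (Fin d))
    (p : Conf d M × Conf d N) : uvec β τ p ≤ uvec γ τ p := by
  rw [uvec_eq_sum, uvec_eq_sum γ]
  exact Finset.sum_le_sum fun y _ => mul_le_mul_of_nonneg_right (h y) (uvec_single_nonneg y τ p)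

lemma uvec_smul (c : ℝ) (β : Sites M N → ℝ) (τ : Multiset (Fin d)) :
    uvec (c • β) τ = c • uvec β τ := by
  funext p
  rw [uvec_eq_sum, Pi.smul_apply, uvec_eq_sum β, smul_eq_mul, Finset.mul_sum]
  refine Finset.sum_congr rfl fun y _ => ?_
  rw [Pi.smul_apply, smul_eq_mul, mul_assoc]

lemma uvec_le_sum {β : Sites M N → ℝ} (hβ : ∀ y, 0 ≤ β y) (τ : Multiset (Fin d))
    (p : Conf d M × Conf d N) : uvec β τ p ≤ ∑ y, β y := by
  rw [uvec_eq_sum]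
  refine Finset.sum_le_sum fun y _ => mul_le_of_le_one_right (hβ y) ?_
  rw [uvec_single]
  split_ifs
  · exact inv_le_one_of_one_le₀ (by exact_mod_cast cnt_pos (card_ty p.1))
  · exact zero_le_one

lemma uvec_pos (hMN : M ≤ N) {β : Sites M N → ℝ} (hβ : ∀ y, 0 < β y) {τ : Multiset (Fin d)}
    {p : Conf d M × Conf d N} (h : ty p.2 = ty p.1 + τ) : 0 < uvec β τ p := by
  obtain ⟨y, hy⟩ := exists_sites_tyOn hMN (card_ty p.1) h
  rw [uvec, if_pos h]
  refine mul_pos (inv_pos.mpr (by exact_mod_cast cnt_pos (card_ty p.1))) ?_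
  refine Finset.sum_pos' (fun z _ => mul_nonneg (hβ z).le (by split_ifs <;> simp))
    ⟨y, Finset.mem_univ y, ?_⟩
  rw [if_pos hy, mul_one]
  exact hβ y

variable [NeZero d]

lemma cloneKer_ne_zero {x : Finset (Fin N)} {p q : Conf d M × Conf d N}
    (h : cloneKer d M x p q ≠ 0) : ty q.1 + ty p.2 = ty p.1 + ty q.2 := by
  simp only [cloneKer, Matrix.of_apply] at h
  split_ifs at h with h1
  · rw [← tyOn_add_compl x p.2, ← tyOn_add_compl x q.2, ← add_assoc, ← add_assoc, h1.2]
    congr 1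
    exact tyOn_congr fun k hk => h1.1 k (Finset.mem_compl.mp hk)
  · exact absurd rfl h

lemma cloneMat_ne_zero {α : Finset (Fin N) → ℝ} {p q : Conf d M × Conf d N}
    (h : cloneMat d M α p q ≠ 0) : ty q.1 + ty p.2 = ty p.1 + ty q.2 := by
  simp only [cloneMat, Matrix.sum_apply] at h
  obtain ⟨x, -, hx⟩ := Finset.exists_ne_zero_of_sum_ne_zero h
  exact cloneKer_ne_zero (x := x) fun h0 => hx (by simp [h0])

lemma wt_eq_of_cloneMat_ne_zero {α : Finset (Fin N) → ℝ} {p q : Conf d M × Conf d N}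
    (h : cloneMat d M α p q ≠ 0) : wt p = wt q := by
  funext i
  have h1 := congrArg (Multiset.count i) (cloneMat_ne_zero h)
  simp only [Multiset.count_add] at h1
  simp only [wt]
  omega

/-- The eigenspace of `R` with eigenvalue `lam`. -/
def eigSet (d M : ℕ) {N : ℕ} [NeZero d] (α : Finset (Fin N) → ℝ) (lam : ℝ) :
    Set (Conf d M × Conf d N → ℂ) :=
  {v | cloningOp d M α *ᵥ v = (lam : ℂ) • v}

lemma mem_eigSet {α : Finset (Fin N) → ℝ} {lam : ℝ} {v : Conf d M × Conf d N → ℂ} :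
    v ∈ eigSet d M α lam ↔ ∀ p, ∑ q, (cloneMat d M α p q : ℂ) * v q = lam * v p := by
  rw [eigSet, Set.mem_ofPred_eq, cloningOp_eq, funext_iff]
  rfl

lemma jointTot_mem_eigSet {α : Finset (Fin N) → ℝ} {lam : ℝ} (v : Conf d M × Conf d N → ℂ)
    (hv : v ∈ eigSet d M α lam) (i j : Fin d) :
    jointTot M N (Matrix.single i j 1) *ᵥ v ∈ eigSet d M α lam := by
  rw [eigSet, Set.mem_ofPred_eq] at hv ⊢
  rw [Matrix.mulVec_mulVec, cloningOp_commute, ← Matrix.mulVec_mulVec, hv, Matrix.mulVec_smul]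

/-- The part of a vector on the configurations with the weight of a given one. -/
def wtPart (p : Conf d M × Conf d N) (v : Conf d M × Conf d N → ℂ) : Conf d M × Conf d N → ℂ :=
  fun q => if wt q = wt p then v q else 0

lemma hasWeight_wtPart (p : Conf d M × Conf d N) (v : Conf d M × Conf d N → ℂ) :
    HasWeight (wtPart p v) (wt p) := by
  intro q hq
  by_contra h
  exact hq (if_neg h)

lemma wtPart_mem_eigSet {α : Finset (Fin N) → ℝ} {lam : ℝ} {v : Conf d M × Conf d N → ℂ}
    (hv : v ∈ eigSet d M α lam) (p : Conf d M × Conf d N) : wtPart p v ∈ eigSet d M α lam := by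
  rw [mem_eigSet] at hv ⊢
  intro r
  simp only [wtPart]
  split_ifs with h
  · rw [← hv r]
    refine Finset.sum_congr rfl fun q _ => ?_
    by_cases h1 : cloneMat d M α r q = 0
    · simp [h1]
    · rw [if_pos (by rw [← wt_eq_of_cloneMat_ne_zero h1, h])]
  · rw [mul_zero]
    refine Finset.sum_eq_zero fun q _ => ?_
    by_cases h1 : cloneMat d M α r q = 0
    · simp [h1]
    · rw [if_neg (by rw [← wt_eq_of_cloneMat_ne_zero h1]; exact h), mul_zero]

lemma IsMaxEigenvalue.exists_type {α : Finset (Fin N) → ℝ} {lam : ℝ} (hMN : M ≤ N)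
    (h : IsMaxEigenvalue (cloningOp d M α) lam) :
    ∃ τ : Multiset (Fin d), ∃ v ∈ eigSet d M α lam, v ≠ 0 ∧ ∀ p, v p ≠ 0 → ty p.2 = ty p.1 + τ := by
  obtain ⟨v, hv0, hv⟩ := hasEigenvalue_iff.mp h.1
  obtain ⟨p, hp⟩ := Function.ne_iff.mp hv0
  have hu : wtPart p v ∈ eigSet d M α lam := wtPart_mem_eigSet hv p
  have hu0 : wtPart p v ≠ 0 := fun h0 => hp (by simpa [wtPart] using congrFun h0 p)
  obtain ⟨u, huT, hu0, w, hw, hw0⟩ : ∃ u ∈ eigSet d M α lam, u ≠ 0 ∧ ∃ w, HasWeight u w ∧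
      ∀ l, 0 ≤ w l := by
    by_cases hneg : ∃ i, wt p i < 0
    · obtain ⟨i, j, v', hv', w', hw', hw0, -, -, hne⟩ := exists_raise hMN
        (fun v hv i j => jointTot_mem_eigSet v hv i j) hu hu0 (hasWeight_wtPart p v) hneg
      refine ⟨v', hv', ?_, w', hw', hw0⟩
      rintro rfl
      exact hne (Matrix.mulVec_zero _)
    · push Not at hneg
      exact ⟨_, hu, hu0, wt p, hasWeight_wtPart p v, hneg⟩
  obtain ⟨τ, hτ, -⟩ := hw.exists_type hu0 hw0
  exact ⟨τ, u, huT, hu0, hτ⟩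

lemma IsMaxEigenvalue.cloningOp_pos {α : Finset (Fin N) → ℝ} {lam : ℝ}
    (hα : ∀ x, 0 ≤ α x) (hα1 : ∃ x, 0 < α x) (h : IsMaxEigenvalue (cloningOp d M α) lam) :
    0 < lam := by
  obtain ⟨x, hx⟩ := hα1
  rw [cloningOp_eq] at h
  -- A diagonal entry bounds `lam` from below, and at a constant configuration it is positive.
  exact (cloneMat_pos hα hx (p := (fun _ => 0, fun _ => 0)) (q := (fun _ => 0, fun _ => 0))
    (fun _ _ => rfl) rfl).trans_le (h.diag_le (cloneMat_transpose α) _)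

/-- There are nonnegative weights for which all the vectors `uvec` are maximum eigenvectors. -/
lemma exists_optimal {α : Finset (Fin N) → ℝ} {lam : ℝ} (hMN : M ≤ N) (hα : ∀ x, 0 ≤ α x)
    (hα1 : ∃ x, 0 < α x) (h : IsMaxEigenvalue (cloningOp d M α) lam) :
    ∃ β : Sites M N → ℝ, (∀ y, 0 ≤ β y) ∧ β ≠ 0 ∧
      ∀ τ, cloneMat d M α *ᵥ uvec β τ = lam • uvec β τ := by
  have hlam := h.cloningOp_pos hα hα1
  obtain ⟨τ, v, hv, hv0, hτ⟩ := h.exists_type hMN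
  rw [mem_eigSet] at hv
  -- The entries of `R` are nonnegative, so the moduli of an eigenvector form a subsolution.
  have hA : ∀ p, lam * ‖v p‖ ≤ ∑ q, cloneMat d M α p q * ‖v q‖ := by
    intro p
    have h1 : lam * ‖v p‖ = ‖∑ q, (cloneMat d M α p q : ℂ) * v q‖ := by
      rw [hv p, norm_mul, Complex.norm_real, Real.norm_of_nonneg hlam.le]
    rw [h1]
    refine (norm_sum_le _ _).trans (Finset.sum_le_sum fun q _ => ?_)
    rw [norm_mul, Complex.norm_real, Real.norm_of_nonneg (cloneMat_nonneg hα p q)]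
  have h1pos : ∀ p, v p ≠ 0 → 0 < uvec (1 : Sites M N → ℝ) τ p :=
    fun p hp => uvec_pos hMN (fun _ => one_pos) (hτ p hp)
  have h1nn : ∀ p, 0 ≤ uvec (1 : Sites M N → ℝ) τ p := uvec_nonneg (fun _ => zero_le_one) τ
  -- The comparison vector is positive wherever `v` is nonzero, so a large multiple dominates `|v|`.
  -- Where the comparison vector vanishes so does `v`, and the quotient `0 / 0 = 0` is harmless.
  obtain ⟨C, hC0, hC⟩ : ∃ C : ℝ, 0 < C ∧ ∀ p, ‖v p‖ ≤ C * uvec (1 : Sites M N → ℝ) τ p := by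
    refine ⟨1 + ∑ p, ‖v p‖ / uvec (1 : Sites M N → ℝ) τ p, ?_, fun p => ?_⟩
    · have := Finset.sum_nonneg fun p (_ : p ∈ Finset.univ) =>
        div_nonneg (norm_nonneg (v p)) (h1nn p)
      linarith
    · by_cases hp : v p = 0
      · rw [hp, norm_zero]
        refine mul_nonneg ?_ (h1nn p)
        have := Finset.sum_nonneg fun p (_ : p ∈ Finset.univ) =>
          div_nonneg (norm_nonneg (v p)) (h1nn p)
        linarith
      · rw [← div_le_iff₀ (h1pos p hp)]
        have := Finset.single_le_sum (fun p (_ : p ∈ Finset.univ) =>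
          div_nonneg (norm_nonneg (v p)) (h1nn p)) (Finset.mem_univ p)
        linarith
  -- Iterating `R` on the domination transfers the growth rate `lam` from `v` to the powers of
  -- `gMat`.
  have hpow : ∀ k : ℕ, ∀ p, lam ^ k * ‖v p‖ ≤ C * uvec (gMat d M α ^ k *ᵥ 1) τ p := by
    intro k
    induction k with
    | zero => intro p; simpa using hC p
    | succ k ih =>
      intro p
      calc lam ^ (k + 1) * ‖v p‖ = lam ^ k * (lam * ‖v p‖) := by ring
        _ ≤ lam ^ k * ∑ q, cloneMat d M α p q * ‖v q‖ :=
          mul_le_mul_of_nonneg_left (hA p) (by positivity)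
        _ = ∑ q, cloneMat d M α p q * (lam ^ k * ‖v q‖) := by
          rw [Finset.mul_sum]; exact Finset.sum_congr rfl fun q _ => by ring
        _ ≤ ∑ q, cloneMat d M α p q * (C * uvec (gMat d M α ^ k *ᵥ 1) τ q) :=
          Finset.sum_le_sum fun q _ => mul_le_mul_of_nonneg_left (ih q) (cloneMat_nonneg hα p q)
        _ = C * (cloneMat d M α *ᵥ uvec (gMat d M α ^ k *ᵥ 1) τ) p := by
          rw [Matrix.mulVec, dotProduct, Finset.mul_sum]
          exact Finset.sum_congr rfl fun q _ => by ring
        _ = C * uvec (gMat d M α ^ (k + 1) *ᵥ 1) τ p := by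
          rw [cloneMat_mulVec_uvec, Matrix.mulVec_mulVec, ← pow_succ']
  obtain ⟨p, hp⟩ := Function.ne_iff.mp hv0
  have hGk : ∀ (k : ℕ) y, 0 ≤ (gMat d M α ^ k *ᵥ (1 : Sites M N → ℝ)) y := by
    intro k
    induction k with
    | zero => intro i; simp
    | succ k ih =>
      intro i
      rw [pow_succ', ← Matrix.mulVec_mulVec]
      exact dotProduct_nonneg_of_nonneg (fun j => gMat_nonneg hα i j) ih
  obtain ⟨β, hβ, hβ0, hle⟩ := exists_le_mulVec (G := gMat d M α) (gMat_nonneg hα) hlam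
    (c := ‖v p‖ / C) (div_pos (norm_pos_iff.mpr hp) hC0) fun k => by
      rw [div_mul_eq_mul_div, div_le_iff₀ hC0, mul_comm, mul_comm _ C]
      exact (hpow k p).trans (mul_le_mul_of_nonneg_left (uvec_le_sum (hGk k) τ p) hC0.le)
  refine ⟨β, hβ, hβ0, fun τ => ?_⟩
  rw [cloningOp_eq] at h
  -- The inequality for `β` does not involve `τ`, so the vectors of all types become eigenvectors
  -- simultaneously.
  refine h.mulVec_eq_of_le (cloneMat_transpose α) (uvec_nonneg hβ τ) fun p => ?_
  rw [cloneMat_mulVec_uvec, ← smul_eq_mul, ← Pi.smul_apply, ← uvec_smul]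
  exact uvec_mono (fun y => hle y) τ p

end Optimal

/-! ### The symmetric projector -/

section SymProj

variable {d n : ℕ}

lemma symProj_mulVec_of_ty {g : Conf d n → ℂ} (h : ∀ s t, ty s = ty t → g s = g t) :
    symProj d n *ᵥ g = g := by
  funext s
  have h1 : (symProj d n *ᵥ g) s = csum d n fun m =>
      if m = ty s then (cnt d n m : ℂ)⁻¹ * g s else 0 := by
    rw [Matrix.mulVec, dotProduct, csum]
    refine Finset.sum_congr rfl fun t _ => ?_
    rw [symProj_apply]
    by_cases h2 : ty s = ty t
    · rw [if_pos h2, if_pos h2.symm, h s t h2, h2]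
    · rw [if_neg h2, if_neg (Ne.symm h2), zero_mul]
  rw [h1, csum_ite_eq (ty s) fun m => (cnt d n m : ℂ)⁻¹ * g s, mul_inv_cancel_left₀]
  exact cnt_ne_zero (card_ty s)

lemma symProj_mul_of_ty {κ : Type*} {A : Matrix (Conf d n) κ ℂ}
    (h : ∀ s t j, ty s = ty t → A s j = A t j) : symProj d n * A = A := by
  ext s j
  exact congrFun (symProj_mulVec_of_ty (g := fun s => A s j) fun s t hst => h s t j hst) s

lemma symProj_conjTranspose : (symProj d n)ᴴ = symProj d n := by
  ext s t
  simp only [Matrix.conjTranspose_apply, symProj_apply]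
  by_cases h : ty s = ty t
  · simp [h]
  · simp [h, Ne.symm h]

lemma symProj_transpose : (symProj d n)ᵀ = symProj d n := by
  ext s t
  simp only [Matrix.transpose_apply, symProj_apply]
  by_cases h : ty s = ty t
  · simp [h]
  · simp [h, Ne.symm h]

lemma mul_symProj_of_ty {κ : Type*} {A : Matrix κ (Conf d n) ℂ}
    (h : ∀ s t j, ty s = ty t → A j s = A j t) : A * symProj d n = A := by
  have h1 := symProj_mul_of_ty (A := Aᵀ) fun s t j hst => h s t j hst
  have h2 := congrArg Matrix.transpose h1
  rwa [Matrix.transpose_mul, Matrix.transpose_transpose, symProj_transpose] at h2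

lemma symProj_ty_left {s t : Conf d n} (h : ty s = ty t) (r : Conf d n) :
    symProj d n s r = symProj d n t r := by
  rw [symProj_apply, symProj_apply, h]

lemma symProj_ty_right {s t : Conf d n} (h : ty s = ty t) (r : Conf d n) :
    symProj d n r s = symProj d n r t := by
  rw [symProj_apply, symProj_apply, h]

lemma symProj_mul_self : symProj d n * symProj d n = symProj d n :=
  symProj_mul_of_ty fun _ _ r h => symProj_ty_left h r

end SymProj

/-! ### Sums over configurations split along a pair of sets of sites -/

section Pair

variable {d M N : ℕ}

lemma sum_free_union_of_ty {A : Type*} [AddCommMonoid A] {ι : Type*} [Fintype ι] [DecidableEq ι]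
    {s t : Finset ι} (hst : Disjoint s t) (b : ι → Fin d) {F : (ι → Fin d) → A}
    {H : Multiset (Fin d) → (ι → Fin d) → A} (h : ∀ b, F b = H (tyOn s b) b)
    (hH : ∀ m b b', (∀ k, k ∉ s → b' k = b k) → H m b' = H m b) :
    ∑ b' ∈ free (s ∪ t) b, F b' = csum d s.card fun m => ∑ b' ∈ free t b, H m b' := by
  rw [sum_free_union hst, csum_sum]
  refine Finset.sum_congr rfl fun b' _ => sum_free (H := fun m => H m b') fun b'' hb'' => ?_
  rw [h, hH _ _ _ (mem_free.mp hb'')]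

/-- The output sites split into `y ∩ z`, `y \ z`, `z \ y` and the rest, with types `e`, `f`, `g`,
`r`. The complement of `y` then carries `g + r` and that of `z` carries `f + r`. -/
lemma sum_sites_pair [NeZero d] {A : Type*} [AddCommMonoid A] (y z : Sites M N) (m m' : Multiset (Fin d))
    (κ : Multiset (Fin d) → Multiset (Fin d) → A) :
    (∑ b : Conf d N, if tyOn y.1 b = m ∧ tyOn z.1 b = m' then κ (tyOn y.1ᶜ b) (tyOn z.1ᶜ b) else 0) =
      csum d (M - (y.1 \ z.1).card) fun e => csum d (y.1 \ z.1).card fun f =>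
        csum d (y.1 \ z.1).card fun g => if e + f = m ∧ e + g = m' then
          csum d (N - M - (y.1 \ z.1).card) fun r => κ (g + r) (f + r) else 0 := by
  have hy := y.2
  have hz := z.2
  have c1 := Finset.card_sdiff_add_card_inter y.1 z.1
  have c2 := Finset.card_sdiff_add_card_inter z.1 y.1
  have c3 := Finset.card_union_add_card_inter y.1 z.1
  have c4 := Finset.card_compl_add_card (y.1 ∪ z.1)
  rw [Fintype.card_fin] at c4
  rw [Finset.inter_comm z.1 y.1] at c2
  have d1 : (y.1 ∩ z.1).card = M - (y.1 \ z.1).card := by omega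
  have d2 : (z.1 \ y.1).card = (y.1 \ z.1).card := by omega
  have d3 : (y.1 ∪ z.1)ᶜ.card = N - M - (y.1 \ z.1).card := by omega
  have t1 : ∀ b : Conf d N, tyOn y.1 b = tyOn (y.1 ∩ z.1) b + tyOn (y.1 \ z.1) b := fun b => by
    rw [← tyOn_union]
    · congr 1; ext k; simp; tauto
    · rw [Finset.disjoint_left]; intro k; simp; tauto
  have t2 : ∀ b : Conf d N, tyOn z.1 b = tyOn (y.1 ∩ z.1) b + tyOn (z.1 \ y.1) b := fun b => by
    rw [← tyOn_union]
    · congr 1; ext k; simp; tauto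
    · rw [Finset.disjoint_left]; intro k; simp; tauto
  have t3 : ∀ b : Conf d N, tyOn y.1ᶜ b = tyOn (z.1 \ y.1) b + tyOn (y.1 ∪ z.1)ᶜ b := fun b => by
    rw [← tyOn_union]
    · congr 1; ext k; simp; tauto
    · rw [Finset.disjoint_left]; intro k; simp; tauto
  have t4 : ∀ b : Conf d N, tyOn z.1ᶜ b = tyOn (y.1 \ z.1) b + tyOn (y.1 ∪ z.1)ᶜ b := fun b => by
    rw [← tyOn_union]
    · congr 1; ext k; simp; tauto
    · rw [Finset.disjoint_left]; intro k; simp; tauto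
  simp only [t1, t2, t3, t4]
  have hu : (Finset.univ : Finset (Fin N)) =
      (y.1 ∩ z.1) ∪ ((y.1 \ z.1) ∪ ((z.1 \ y.1) ∪ (y.1 ∪ z.1)ᶜ)) := by
    ext k; simp; tauto
  have k1 : Disjoint (y.1 ∩ z.1) ((y.1 \ z.1) ∪ ((z.1 \ y.1) ∪ (y.1 ∪ z.1)ᶜ)) := by
    rw [Finset.disjoint_left]; intro k; simp; tauto
  have k2 : Disjoint (y.1 \ z.1) ((z.1 \ y.1) ∪ (y.1 ∪ z.1)ᶜ) := by
    rw [Finset.disjoint_left]; intro k; simp; tauto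
  have k3 : Disjoint (z.1 \ y.1) (y.1 ∪ z.1)ᶜ := by
    rw [Finset.disjoint_left]; intro k; simp; tauto
  have eq : ∀ {s t : Finset (Fin N)} {b b' : Conf d N}, Disjoint t s → (∀ k, k ∉ t → b' k = b k) →
      tyOn s b' = tyOn s b := fun hd h =>
    tyOn_congr fun k hk => h k fun hk' => Finset.disjoint_left.mp hd hk' hk
  rw [Finset.disjoint_union_right, Finset.disjoint_union_right] at k1
  rw [Finset.disjoint_union_right] at k2
  let b0 : Conf d N := fun _ => 0
  rw [← free_univ b0, hu, sum_free_union_of_ty (H := fun e b => if e + tyOn (y.1 \ z.1) b = m ∧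
      e + tyOn (z.1 \ y.1) b = m' then κ (tyOn (z.1 \ y.1) b + tyOn (y.1 ∪ z.1)ᶜ b)
        (tyOn (y.1 \ z.1) b + tyOn (y.1 ∪ z.1)ᶜ b) else 0)
      (Finset.disjoint_union_right.mpr ⟨k1.1, Finset.disjoint_union_right.mpr k1.2⟩) b0
      (fun b => rfl), d1]
  swap
  · intro m b b' h
    rw [eq k1.1 h, eq k1.2.1 h, eq k1.2.2 h]
  refine csum_congr fun e _ => ?_
  rw [sum_free_union_of_ty (H := fun f b => if e + f = m ∧
      e + tyOn (z.1 \ y.1) b = m' then κ (tyOn (z.1 \ y.1) b + tyOn (y.1 ∪ z.1)ᶜ b)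
        (f + tyOn (y.1 ∪ z.1)ᶜ b) else 0)
      (Finset.disjoint_union_right.mpr k2) b0 (fun b => rfl)]
  swap
  · intro m b b' h
    rw [eq k2.1 h, eq k2.2 h]
  refine csum_congr fun f _ => ?_
  rw [sum_free_union_of_ty (H := fun g b => if e + f = m ∧
      e + g = m' then κ (g + tyOn (y.1 ∪ z.1)ᶜ b)
        (f + tyOn (y.1 ∪ z.1)ᶜ b) else 0) k3 b0 (fun b => rfl), d2]
  swap
  · intro m b b' h
    rw [eq k3 h]
  refine csum_congr fun g _ => ?_
  rw [sum_free (H := fun r => if e + f = m ∧ e + g = m' then κ (g + r) (f + r) else 0)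
    (fun b _ => rfl), d3]
  split_ifs
  · rfl
  · simp [csum]

variable [NeZero d]

/-- This is `csum_mu_add` with the moments replaced by their values. -/
lemma csum_inv_cnt_add {n k : ℕ} (hk : k ≤ n) {f : Multiset (Fin d)} (hf : f.card = k) :
    (csum d (n - k) fun r => (cnt d n (f + r) : ℝ)⁻¹) =
      symDim d n * ((symDim d k : ℝ)⁻¹ * (cnt d k f : ℝ)⁻¹) := by
  have h1 : (symDim d n : ℝ) ≠ 0 :=
    Nat.cast_ne_zero.mpr (symDim_pos d _ (Nat.pos_of_ne_zero (NeZero.ne d))).ne'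
  rw [← mu_eq hf, ← csum_mu_add f (n - k), mul_csum]
  refine csum_congr fun r hr => ?_
  rw [mu_eq (n := n) (by rw [Multiset.card_add, hf, hr]; omega), mul_inv_cancel_left₀ h1]

lemma csum_csum_add_eq {n k : ℕ} (hk : k ≤ n) (m : Multiset (Fin d)) {A : Type*} [Semiring A]
    (a : A) : (csum d (n - k) fun e => csum d k fun f => if e + f = m then a else 0) =
      cnt d n m * a := by
  rw [← csum_ite_eq m (fun _ => a), ← csum_add (n - k) k (fun s => if s = m then a else 0),
    Nat.sub_add_cancel hk]

/-- The complements of `y` and `z` share their common part, so equal types there force `f = g` and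
hence `m = m'`. Tracing out the common part of the maximally mixed symmetric state leaves the
maximally mixed one on `|y \ z|` spins, whence the ratio of dimensions. -/
lemma sum_sites_pair_diag (y z : Sites M N) (m m' : Multiset (Fin d)) :
    (∑ b : Conf d N, if tyOn y.1 b = m ∧ tyOn z.1 b = m' then
        (if tyOn y.1ᶜ b = tyOn z.1ᶜ b then (cnt d (N - M) (tyOn y.1ᶜ b) : ℝ)⁻¹ else 0) else 0) =
      if m = m' then cnt d M m * (symDim d (N - M) * (symDim d (y.1 \ z.1).card : ℝ)⁻¹) else 0 := by
  have hy := y.2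
  have hz := z.2
  have c1 := Finset.card_sdiff_add_card_inter y.1 z.1
  have c3 := Finset.card_union_add_card_inter y.1 z.1
  have c4 := Finset.card_le_univ (y.1 ∪ z.1)
  rw [Fintype.card_fin] at c4
  rw [sum_sites_pair y z m m' fun p q => if p = q then (cnt d (N - M) p : ℝ)⁻¹ else 0]
  set k := (y.1 \ z.1).card with hk
  have hkM : k ≤ M := by omega
  have hkN : k ≤ N - M := by omega
  set D : ℝ := symDim d (N - M) * (symDim d k : ℝ)⁻¹ with hD
  have h1 : ∀ e f : Multiset (Fin d), f.card = k → (csum d k fun g => if e + f = m ∧ e + g = m' then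
      csum d (N - M - k) fun r =>
        if g + r = f + r then (cnt d (N - M) (g + r) : ℝ)⁻¹ else 0 else 0) =
      if e + f = m then (if m = m' then D else 0) else 0 := by
    intro e f hf
    have h2 : ∀ g : Multiset (Fin d), g.card = k → (if e + f = m ∧ e + g = m' then
        csum d (N - M - k) fun r =>
          if g + r = f + r then (cnt d (N - M) (g + r) : ℝ)⁻¹ else 0 else 0) =
        if g = f then (fun g => if e + f = m then
          (if m = m' then D * (cnt d k g : ℝ)⁻¹ else 0) else 0) g else 0 := by
      intro g hg
      simp only [add_left_inj]
      by_cases hgf : g = f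
      · subst hgf
        simp only [if_true]
        rw [csum_inv_cnt_add hkN hg, ← mul_assoc]
        by_cases h3 : e + g = m
        · simp only [h3, true_and, if_true, hD]
        · simp [h3]
      · simp [hgf, csum]
    rw [csum_congr h2, csum_ite_eq f fun g => if e + f = m then
          (if m = m' then D * (cnt d k g : ℝ)⁻¹ else 0) else 0]
    have h4 : (cnt d k f : ℝ) ≠ 0 := cnt_ne_zero hf
    split_ifs
    · field_simp
    · simp
    · simp
  rw [csum_congr fun e _ => csum_congr fun f hf => h1 e f hf, csum_csum_add_eq hkM]
  split_ifs <;> simp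

end Pair

/-! ### The mixture of optimal states -/

section Mixed

variable {d M N : ℕ}

lemma tyOn_map {κ ι : Type*} {d : ℕ} (s : Finset κ) (e : κ ↪ ι) (b : ι → Fin d) :
    tyOn s (fun k => b (e k)) = tyOn (s.map e) b := by
  rw [tyOn, tyOn, Finset.map_val, Multiset.map_map]
  rfl

lemma ty_onSites (y : Sites M N) (b : Conf d N) : ty (onSites y b) = tyOn y.1 b := by
  refine (tyOn_map Finset.univ (y.1.orderEmbOfFin y.2).toEmbedding b).trans ?_
  congr 1
  exact Finset.map_orderEmbOfFin_univ y.1 y.2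

lemma ty_offSites (y : Sites M N) (b : Conf d N) : ty (offSites y b) = tyOn y.1ᶜ b := by
  refine (tyOn_map Finset.univ (y.1ᶜ.orderEmbOfFin (k := N - M) _).toEmbedding b).trans ?_
  congr 1
  exact Finset.map_orderEmbOfFin_univ y.1ᶜ _

/-- The states `∑_y β_y |B_y⟩|Φ⟩_ȳ` for symmetric `Φ`, in terms of `uvec`. -/
lemma cloneVec_mul_symProj (β : Sites M N → ℝ) (p : Conf d M × Conf d N) (c : Conf d (N - M)) :
    (cloneVec d M N β * symProj d (N - M)) p c =
      (((Real.sqrt (symDim d M))⁻¹ * (cnt d (N - M) (ty c) : ℝ)⁻¹ * uvec β (ty c) p : ℝ) : ℂ) := by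
  have h1 : (cloneVec d M N β * symProj d (N - M)) p c = ∑ y : Sites M N,
      (β y : ℂ) * (bell d M p.1 (onSites y p.2) * symProj d (N - M) (offSites y p.2) c) := by
    simp only [Matrix.mul_apply, cloneVec, Matrix.of_apply, Finset.sum_mul]
    rw [Finset.sum_comm]
    refine Finset.sum_congr rfl fun y _ => ?_
    rw [Finset.sum_eq_single (offSites y p.2)]
    · simp [mul_assoc]
    · intro e _ he
      simp [Ne.symm he]
    · simp
  rw [h1, uvec_eq_sum, Finset.mul_sum, Complex.ofReal_sum]
  refine Finset.sum_congr rfl fun y _ => ?_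
  rw [uvec_single, bell, symProj_apply, symProj_apply, ty_onSites, ty_offSites]
  by_cases h2 : ty p.1 = tyOn y.1 p.2 <;> by_cases h3 : tyOn y.1ᶜ p.2 = ty c
  · rw [if_pos h2, if_pos h3, if_pos ⟨h2.symm, h3⟩, h3]
    push_cast
    ring
  · simp [h3]
  · rw [if_neg h2, if_neg (c := tyOn y.1 p.2 = ty p.1 ∧ tyOn y.1ᶜ p.2 = ty c)
      (fun h => h2 h.1.symm)]
    simp
  · simp [h3]

lemma mixedCloneState_eq (β : Sites M N → ℝ) : mixedCloneState d M N β =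
    (symDim d (N - M) : ℂ)⁻¹ • ((cloneVec d M N β * symProj d (N - M)) *
      (cloneVec d M N β * symProj d (N - M))ᴴ) := by
  rw [mixedCloneState, Matrix.conjTranspose_mul, symProj_conjTranspose, Matrix.mul_smul,
    Matrix.smul_mul, Matrix.mul_assoc, Matrix.mul_assoc, ← Matrix.mul_assoc (symProj d (N - M))
      (symProj d (N - M)), symProj_mul_self]

variable [NeZero d]

lemma cloningOp_mul_mixedCloneState {α : Finset (Fin N) → ℝ} {lam : ℝ} {β : Sites M N → ℝ}
    (h : ∀ τ, cloneMat d M α *ᵥ uvec β τ = lam • uvec β τ) :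
    cloningOp d M α * mixedCloneState d M N β = (lam : ℂ) • mixedCloneState d M N β := by
  have h1 : cloningOp d M α * (cloneVec d M N β * symProj d (N - M)) =
      (lam : ℂ) • (cloneVec d M N β * symProj d (N - M)) := by
    ext p c
    have h2 := congrFun (h (ty c)) p
    rw [Matrix.mulVec, dotProduct, Pi.smul_apply, smul_eq_mul] at h2
    rw [Matrix.smul_apply, cloneVec_mul_symProj, Matrix.mul_apply, cloningOp_eq, smul_eq_mul,
      ← Complex.ofReal_mul, mul_left_comm lam, ← h2, Finset.mul_sum, Complex.ofReal_sum]
    refine Finset.sum_congr rfl fun q _ => ?_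
    rw [cloneVec_mul_symProj, Matrix.map_apply]
    push_cast
    ring
  rw [mixedCloneState_eq, Matrix.mul_smul, ← Matrix.mul_assoc, h1, Matrix.smul_mul, smul_comm]

/-- The norm of the state `∑_y β_y |B_y⟩|Φ⟩_ȳ`, averaged over the symmetric states `Φ`. -/
def normSq (d : ℕ) (β : Sites M N → ℝ) : ℝ :=
  ∑ y, ∑ z, β y * β z * (symDim d (y.1 \ z.1).card : ℝ)⁻¹

lemma normSq_pos {β : Sites M N → ℝ} (hβ : ∀ y, 0 ≤ β y) (hβ0 : β ≠ 0) : 0 < normSq d β := by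
  obtain ⟨y, hy⟩ := Function.ne_iff.mp hβ0
  have hy' : 0 < β y := lt_of_le_of_ne (hβ y) (Ne.symm hy)
  have h0 : ∀ y z : Sites M N, 0 ≤ β y * β z * (symDim d (y.1 \ z.1).card : ℝ)⁻¹ := fun y z =>
    mul_nonneg (mul_nonneg (hβ y) (hβ z)) (by positivity)
  have h1 : 0 < symDim d (y.1 \ y.1).card := symDim_pos d _ (Nat.pos_of_ne_zero (NeZero.ne d))
  exact Finset.sum_pos' (fun y _ => Finset.sum_nonneg fun z _ => h0 y z)
    ⟨y, Finset.mem_univ y, Finset.sum_pos' (fun z _ => h0 y z) ⟨y, Finset.mem_univ y, by positivity⟩⟩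

lemma sum_uvec_mul_uvec (β : Sites M N → ℝ) (a a' : Conf d M) :
    (∑ b : Conf d N, csum d (N - M) fun τ => ((cnt d (N - M) τ : ℝ)⁻¹) ^ 2 *
      (uvec β τ (a, b) * uvec β τ (a', b))) =
    if ty a = ty a' then (cnt d M (ty a) : ℝ)⁻¹ * (symDim d (N - M) * normSq d β) else 0 := by
  have h1 : ∀ b : Conf d N, (csum d (N - M) fun τ => ((cnt d (N - M) τ : ℝ)⁻¹) ^ 2 *
      (uvec β τ (a, b) * uvec β τ (a', b))) = ∑ y, ∑ z, β y * β z * ((cnt d M (ty a) : ℝ)⁻¹ *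
        (cnt d M (ty a') : ℝ)⁻¹ * if tyOn y.1 b = ty a ∧ tyOn z.1 b = ty a' then
          (if tyOn y.1ᶜ b = tyOn z.1ᶜ b then (cnt d (N - M) (tyOn y.1ᶜ b) : ℝ)⁻¹ else 0)
            else 0) := by
    intro b
    have h2 : ∀ τ : Multiset (Fin d), ((cnt d (N - M) τ : ℝ)⁻¹) ^ 2 *
        (uvec β τ (a, b) * uvec β τ (a', b)) = ∑ y, ∑ z, β y * β z * (((cnt d (N - M) τ : ℝ)⁻¹) ^ 2 *
          (uvec (Pi.single y 1) τ (a, b) * uvec (Pi.single z 1) τ (a', b))) := by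
      intro τ
      rw [uvec_eq_sum, uvec_eq_sum β τ (a', b), Finset.sum_mul_sum, Finset.mul_sum]
      refine Finset.sum_congr rfl fun y _ => ?_
      rw [Finset.mul_sum]
      refine Finset.sum_congr rfl fun z _ => ?_
      ring
    rw [csum_congr fun τ _ => h2 τ, csum_sum]
    refine Finset.sum_congr rfl fun y _ => ?_
    rw [csum_sum]
    refine Finset.sum_congr rfl fun z _ => ?_
    rw [← mul_csum]
    congr 1
    -- The product of two family members is supported on the single `τ` found on the complement of
    -- `y`.
    have h3 : ∀ τ : Multiset (Fin d), ((cnt d (N - M) τ : ℝ)⁻¹) ^ 2 *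
          (uvec (Pi.single y 1) τ (a, b) * uvec (Pi.single z 1) τ (a', b)) =
        if τ = tyOn y.1ᶜ b then (fun τ => ((cnt d (N - M) τ : ℝ)⁻¹) ^ 2 *
          if tyOn y.1 b = ty a ∧ tyOn z.1 b = ty a' ∧ tyOn y.1ᶜ b = tyOn z.1ᶜ b then
            (cnt d M (ty a) : ℝ)⁻¹ * (cnt d M (ty a') : ℝ)⁻¹ else 0) τ else 0 := by
      intro τ
      rw [uvec_single, uvec_single]
      dsimp only
      by_cases h4 : τ = tyOn y.1ᶜ b
      · subst h4
        by_cases h5 : tyOn y.1 b = ty a <;> by_cases h6 : tyOn z.1 b = ty a' <;>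
          by_cases h7 : tyOn y.1ᶜ b = tyOn z.1ᶜ b <;>
          first | (simp [h5, h6, h7]; done) | simp [h5, h6, h7, Ne.symm h7]
      · simp [h4, Ne.symm h4]
    rw [csum_congr fun τ _ => h3 τ, csum_ite_eq (tyOn y.1ᶜ b) fun τ =>
      ((cnt d (N - M) τ : ℝ)⁻¹) ^ 2 *
          if tyOn y.1 b = ty a ∧ tyOn z.1 b = ty a' ∧ tyOn y.1ᶜ b = tyOn z.1ᶜ b then
            (cnt d M (ty a) : ℝ)⁻¹ * (cnt d M (ty a') : ℝ)⁻¹ else 0]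
    have h8 : (cnt d (N - M) (tyOn y.1ᶜ b) : ℝ) ≠ 0 := cnt_ne_zero (by
      rw [card_tyOn, Finset.card_compl, y.2, Fintype.card_fin])
    by_cases h5 : tyOn y.1 b = ty a <;> by_cases h6 : tyOn z.1 b = ty a' <;>
      by_cases h7 : tyOn y.1ᶜ b = tyOn z.1ᶜ b
    · simp only [h5, h6, h7, and_self, if_true]
      rw [h7] at h8
      field_simp
    all_goals simp [h5, h6, h7]
  rw [Finset.sum_congr rfl fun b _ => h1 b, Finset.sum_comm]
  have h9 : ∀ y : Sites M N, (∑ b : Conf d N, ∑ z, β y * β z * ((cnt d M (ty a) : ℝ)⁻¹ *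
        (cnt d M (ty a') : ℝ)⁻¹ * if tyOn y.1 b = ty a ∧ tyOn z.1 b = ty a' then
          (if tyOn y.1ᶜ b = tyOn z.1ᶜ b then (cnt d (N - M) (tyOn y.1ᶜ b) : ℝ)⁻¹ else 0)
            else 0)) = ∑ z, if ty a = ty a' then (cnt d M (ty a) : ℝ)⁻¹ * (symDim d (N - M) *
              (β y * β z * (symDim d (y.1 \ z.1).card : ℝ)⁻¹)) else 0 := by
    intro y
    rw [Finset.sum_comm]
    refine Finset.sum_congr rfl fun z _ => ?_
    rw [← Finset.mul_sum, ← Finset.mul_sum, sum_sites_pair_diag]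
    split_ifs with h
    · have : (cnt d M (ty a) : ℝ) ≠ 0 := cnt_ne_zero (card_ty a)
      rw [← h]
      field_simp
    · simp
  rw [Finset.sum_congr rfl fun y _ => h9 y, normSq]
  split_ifs
  · simp only [Finset.mul_sum]
  · simp

/-- Every pair `y`, `z` contributes a multiple of the symmetric projector, by `sum_sites_pair_diag`.
The trace condition on the Choi state is thus a matter of normalisation alone, whatever `β` is. -/
lemma traceOut_mixedCloneState (β : Sites M N → ℝ) : traceOut (mixedCloneState d M N β) =
    ((normSq d β : ℝ) : ℂ) • ((symDim d M : ℂ)⁻¹ • symProj d M) := by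
  have hM : (symDim d M : ℝ) ≠ 0 :=
    Nat.cast_ne_zero.mpr (symDim_pos d _ (Nat.pos_of_ne_zero (NeZero.ne d))).ne'
  have hN : (symDim d (N - M) : ℝ) ≠ 0 :=
    Nat.cast_ne_zero.mpr (symDim_pos d _ (Nat.pos_of_ne_zero (NeZero.ne d))).ne'
  ext a a'
  have h1 : traceOut (mixedCloneState d M N β) a a' = (((symDim d (N - M) : ℝ)⁻¹ *
      (symDim d M : ℝ)⁻¹ * ∑ b : Conf d N, csum d (N - M) fun τ => ((cnt d (N - M) τ : ℝ)⁻¹) ^ 2 *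
      (uvec β τ (a, b) * uvec β τ (a', b)) : ℝ) : ℂ) := by
    rw [traceOut, Matrix.of_apply, mixedCloneState_eq, Finset.mul_sum, Complex.ofReal_sum]
    refine Finset.sum_congr rfl fun b _ => ?_
    rw [Matrix.smul_apply, Matrix.mul_apply, smul_eq_mul, mul_csum, Finset.mul_sum, csum,
      Complex.ofReal_sum]
    refine Finset.sum_congr rfl fun c _ => ?_
    rw [Matrix.conjTranspose_apply, cloneVec_mul_symProj, cloneVec_mul_symProj, Complex.star_def,
      Complex.conj_ofReal]
    have h2 : (symDim d M : ℝ)⁻¹ = (Real.sqrt (symDim d M))⁻¹ * (Real.sqrt (symDim d M))⁻¹ := by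
      rw [← mul_inv, Real.mul_self_sqrt (Nat.cast_nonneg _)]
    rw [h2]
    push_cast
    ring
  rw [h1, sum_uvec_mul_uvec, Matrix.smul_apply, Matrix.smul_apply, symProj_apply]
  split_ifs
  · rw [show (symDim d (N - M) : ℝ)⁻¹ * (symDim d M : ℝ)⁻¹ * ((cnt d M (ty a) : ℝ)⁻¹ *
      (symDim d (N - M) * normSq d β)) = normSq d β * ((symDim d M : ℝ)⁻¹ *
        (cnt d M (ty a) : ℝ)⁻¹) by field_simp]
    push_cast
    rfl
  · simp

end Mixed

/-! ### Channels and Choi states -/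

section Kraus

variable {d M N : ℕ}

/-- The completely positive map with given Kraus operators. -/
def krausMap {κ : Type} [Fintype κ] (K : κ → Matrix (Conf d N) (Conf d M) ℂ) :
    Op d M →ₗ[ℂ] Op d N where
  toFun X := ∑ i, K i * X * (K i)ᴴ
  map_add' X Y := by simp only [Matrix.mul_add, Matrix.add_mul, Finset.sum_add_distrib]
  map_smul' z X := by
    simp only [Matrix.mul_smul, Matrix.smul_mul, Finset.smul_sum, RingHom.id_apply]

lemma krausMap_apply {κ : Type} [Fintype κ] (K : κ → Matrix (Conf d N) (Conf d M) ℂ) (X : Op d M) :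
    krausMap K X = ∑ i, K i * X * (K i)ᴴ := rfl

lemma isChannel_krausMap {κ : Type} [Fintype κ] {K : κ → Matrix (Conf d N) (Conf d M) ℂ}
    (h : ∑ i, (K i)ᴴ * K i = 1) : IsChannel (krausMap K) where
  completelyPositive k X hX := by
    -- These are the Kraus operators tensored with the identity of the ancilla.
    let B : κ → Matrix (Fin k × Conf d N) (Fin k × Conf d M) ℂ := fun i =>
      Matrix.of fun p q => if p.1 = q.1 then K i p.2 q.2 else 0
    have h1 : ampliate (krausMap K) k X = ∑ i, B i * X * (B i)ᴴ := by
      ext p q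
      simp only [ampliate, Matrix.of_apply, krausMap_apply, Matrix.sum_apply]
      refine Finset.sum_congr rfl fun i _ => ?_
      simp only [Matrix.mul_apply, Matrix.conjTranspose_apply, Matrix.of_apply, B,
        Fintype.sum_prod_type]
      rw [Finset.sum_eq_single q.1]
      · refine Finset.sum_congr rfl fun c _ => ?_
        rw [if_pos rfl]
        congr 1
        rw [Finset.sum_eq_single p.1]
        · simp
        · intro j _ hj
          simp [Ne.symm hj]
        · simp
      · intro j _ hj
        simp [Ne.symm hj]
      · simp
    rw [h1]
    exact Matrix.posSemidef_sum _ fun i _ => hX.mul_mul_conjTranspose_same (B i)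
  tracePreserving X := by
    rw [krausMap_apply, Matrix.trace_sum]
    calc ∑ i, (K i * X * (K i)ᴴ).trace = ∑ i, ((K i)ᴴ * K i * X).trace := by
          refine Finset.sum_congr rfl fun i _ => ?_
          rw [Matrix.trace_mul_comm, Matrix.mul_assoc]
      _ = X.trace := by rw [← Matrix.trace_sum, ← Finset.sum_mul, h, Matrix.one_mul]

end Kraus

/-! ### Choi states of channels, and channels with a prescribed Choi state -/

section Choi

variable {d M N : ℕ}

lemma symProj_star_apply (a c : Conf d M) : star (symProj d M a c) = symProj d M a c := by
  rw [symProj_apply]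
  split_ifs <;> simp

lemma bell_star (a c : Conf d M) : star (bell d M a c) = bell d M a c := by
  rw [bell, star_mul', symProj_star_apply, Complex.star_def, map_inv₀, Complex.conj_ofReal]

lemma sqrt_inv_mul_self : ((Real.sqrt (symDim d M) : ℝ) : ℂ)⁻¹ * ((Real.sqrt (symDim d M) : ℝ) : ℂ)⁻¹ =
    (symDim d M : ℂ)⁻¹ := by
  rw [← mul_inv, ← Complex.ofReal_mul, Real.mul_self_sqrt (Nat.cast_nonneg _)]
  simp

lemma sum_bell_mul_bell (a a' : Conf d M) :
    ∑ c, bell d M a c * star (bell d M a' c) = (symDim d M : ℂ)⁻¹ * symProj d M a a' := by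
  have h : symProj d M a a' = ∑ c, symProj d M a c * symProj d M a' c := by
    conv_lhs => rw [← symProj_mul_self]
    rw [Matrix.mul_apply]
    refine Finset.sum_congr rfl fun c _ => ?_
    congr 1
    exact (congrFun (congrFun symProj_transpose a') c)
  rw [h, Finset.mul_sum]
  refine Finset.sum_congr rfl fun c _ => ?_
  rw [bell_star, bell, bell, ← sqrt_inv_mul_self]
  ring

/-- The operator `|β_a⟩⟨β_a'|`, `β_a` being the rows of the Bell state. -/
def bellBlock (a a' : Conf d M) : Op d M := Matrix.vecMulVec (bell d M a) (star (bell d M a'))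

lemma choiState_apply (E : Op d M →ₗ[ℂ] Op d N) (p q : Conf d M × Conf d N) :
    choiState E p q = E (bellBlock p.1 q.1) p.2 q.2 := rfl

lemma traceOut_choiState {E : Op d M →ₗ[ℂ] Op d N} (hE : IsChannel E) :
    traceOut (choiState E) = (symDim d M : ℂ)⁻¹ • symProj d M := by
  ext a a'
  rw [traceOut, Matrix.of_apply]
  simp only [choiState_apply]
  refine (hE.tracePreserving (bellBlock a a')).trans ?_
  rw [Matrix.smul_apply, smul_eq_mul, ← sum_bell_mul_bell]
  rfl

lemma trace_eq_trace_traceOut (ρ : JointOp d M N) : ρ.trace = (traceOut ρ).trace := by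
  simp only [Matrix.trace, Matrix.diag_apply, traceOut, Matrix.of_apply, Fintype.sum_prod_type]

lemma trace_choiState [NeZero d] {E : Op d M →ₗ[ℂ] Op d N} (hE : IsChannel E) :
    (choiState E).trace = 1 := by
  rw [trace_eq_trace_traceOut, traceOut_choiState hE, Matrix.trace_smul, trace_symProj, smul_eq_mul,
    inv_mul_cancel₀]
  exact Nat.cast_ne_zero.mpr (symDim_pos d _ (Nat.pos_of_ne_zero (NeZero.ne d))).ne'

lemma choiState_posSemidef {E : Op d M →ₗ[ℂ] Op d N} (hE : IsChannel E) :
    (choiState E).PosSemidef := by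
  -- Complete positivity is applied with an ancilla as large as the whole space of `M` spins,
  -- relabelled by `Fin`, to the projector onto the Bell vector.
  let e := Fintype.equivFin (Conf d M)
  let v : Fin (Fintype.card (Conf d M)) × Conf d M → ℂ := fun p => bell d M (e.symm p.1) p.2
  have h := hE.completelyPositive _ _ (Matrix.posSemidef_vecMulVec_self_star v)
  have h1 : choiState E = (ampliate E _ (Matrix.vecMulVec v (star v))).submatrix
      (fun p => (e p.1, p.2)) (fun p => (e p.1, p.2)) := by
    ext p q
    simp only [choiState_apply, Matrix.submatrix_apply, ampliate, Matrix.of_apply]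
    have h2 : bellBlock p.1 q.1 = Matrix.of fun c c' =>
        Matrix.vecMulVec v (star v) (e p.1, c) (e q.1, c') := by
      ext c c'
      simp [bellBlock, Matrix.vecMulVec_apply, v]
    rw [h2]
  rw [h1]
  exact h.submatrix _

lemma kraus_mul_bellBlock (K : Matrix (Conf d N) (Conf d M) ℂ) (a a' : Conf d M) :
    K * bellBlock a a' * Kᴴ = Matrix.vecMulVec (K *ᵥ bell d M a) (star (K *ᵥ bell d M a')) := by
  rw [bellBlock, Matrix.mul_vecMulVec, Matrix.vecMulVec_mul, Matrix.star_mulVec]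

lemma symProj_mulVec_bell (a : Conf d M) : symProj d M *ᵥ bell d M a = bell d M a := by
  refine symProj_mulVec_of_ty fun s t h => ?_
  rw [bell, bell, symProj_ty_right h]

/-- The Choi state of an economical channel is pure. -/
lemma IsEconomical.choiState_eq {E : Op d M →ₗ[ℂ] Op d N} (hE : IsEconomical E) :
    ∃ v : Conf d M × Conf d N → ℂ, choiState E = Matrix.vecMulVec v (star v) := by
  obtain ⟨V, -, hV⟩ := hE
  refine ⟨fun p => (V *ᵥ bell d M p.1) p.2, ?_⟩
  ext p q
  rw [choiState_apply, hV, kraus_mul_bellBlock]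
  · rfl
  · have h := kraus_mul_bellBlock (symProj d M) p.1 q.1
    rwa [symProj_conjTranspose, symProj_mulVec_bell, symProj_mulVec_bell] at h

variable [NeZero d]

/-- The columns of `B`, read as operators from IN to OUT and scaled by the square root of the
dimension, are Kraus operators. The trace condition says that they are complete on the symmetric
subspace only. -/
lemma exists_channel_of_choi {κ : Type} [Fintype κ] (B : Matrix (Conf d M × Conf d N) κ ℂ)
    (hB : ∀ a a' b c, ty a = ty a' → B (a, b) c = B (a', b) c)
    (htr : traceOut (B * Bᴴ) = (symDim d M : ℂ)⁻¹ • symProj d M) :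
    ∃ E : Op d M →ₗ[ℂ] Op d N, IsChannel E ∧ choiState E = B * Bᴴ := by
  have hD : (symDim d M : ℝ) ≠ 0 :=
    Nat.cast_ne_zero.mpr (symDim_pos d _ (Nat.pos_of_ne_zero (NeZero.ne d))).ne'
  set s : ℝ := Real.sqrt (symDim d M) with hs
  have hs2 : (s : ℂ) * s = symDim d M := by
    rw [← Complex.ofReal_mul, hs, Real.mul_self_sqrt (Nat.cast_nonneg _)]
    simp
  have hs0 : (s : ℂ) ≠ 0 := by
    intro h0
    rw [h0, zero_mul] at hs2
    exact hD (by exact_mod_cast hs2.symm)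
  let K : κ ⊕ Conf d M → Matrix (Conf d N) (Conf d M) ℂ := Sum.elim
    (fun c => Matrix.of fun b a => (s : ℂ) * B (a, b) c)
    -- Further Kraus operators restore trace preservation: they send the complement of the symmetric
    -- subspace to the all-zero state. They annihilate the rows of the Bell vector, so they leave
    -- the Choi state unchanged.
    (fun j => Matrix.of fun b a => if b = 0 then (1 - symProj d M) j a else 0)
  have hP : (1 - symProj d M)ᴴ * (1 - symProj d M) = 1 - symProj d M := by
    rw [Matrix.conjTranspose_sub, Matrix.conjTranspose_one, symProj_conjTranspose, Matrix.sub_mul,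
      Matrix.mul_sub, Matrix.mul_sub, symProj_mul_self]
    simp
  refine ⟨krausMap K, isChannel_krausMap ?_, ?_⟩
  · rw [Fintype.sum_sum_type]
    have h1 : ∑ c : κ, (K (Sum.inl c))ᴴ * K (Sum.inl c) = symProj d M := by
      ext a a'
      have h2 := congrFun (congrFun htr a') a
      rw [traceOut, Matrix.of_apply, Matrix.smul_apply, smul_eq_mul] at h2
      have h3 : symProj d M a a' = (s : ℂ) * s * ∑ b, (B * Bᴴ) (a', b) (a, b) := by
        rw [h2, hs2, mul_inv_cancel_left₀ (by exact_mod_cast hD)]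
        exact congrFun (congrFun symProj_transpose a') a
      rw [h3, Matrix.sum_apply, Finset.mul_sum]
      simp only [Matrix.mul_apply, Matrix.conjTranspose_apply, K, Sum.elim_inl, Matrix.of_apply]
      rw [Finset.sum_comm]
      refine Finset.sum_congr rfl fun b _ => ?_
      rw [Finset.mul_sum]
      refine Finset.sum_congr rfl fun c _ => ?_
      rw [star_mul', Complex.star_def, Complex.conj_ofReal]
      ring
    have h4 : ∑ j : Conf d M, (K (Sum.inr j))ᴴ * K (Sum.inr j) = 1 - symProj d M := by
      rw [← hP]
      ext a a'
      rw [Matrix.sum_apply, Matrix.mul_apply]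
      refine Finset.sum_congr rfl fun j _ => ?_
      rw [Matrix.mul_apply, Finset.sum_eq_single 0]
      · simp [K]
      · intro b _ hb
        simp [K, hb]
      · simp
    rw [h1, h4, add_sub_cancel]
  · ext p q
    rw [choiState_apply, krausMap_apply, Fintype.sum_sum_type]
    simp only [kraus_mul_bellBlock]
    have h1 : ∀ (a : Conf d M) (c : κ), K (Sum.inl c) *ᵥ bell d M a = fun b => B (a, b) c := by
      intro a c
      funext b
      have h2 := congrFun (symProj_mulVec_of_ty (g := fun a => B (a, b) c)
        fun a a' h => hB a a' b c h) a
      rw [Matrix.mulVec, dotProduct] at h2 ⊢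
      rw [← h2]
      refine Finset.sum_congr rfl fun e _ => ?_
      simp only [K, Sum.elim_inl, Matrix.of_apply, bell, ← hs]
      field_simp
    have h5 : ∀ a j, K (Sum.inr j) *ᵥ bell d M a = 0 := by
      intro a j
      funext b
      have h2 : ((1 - symProj d M) *ᵥ bell d M a) j = 0 := by
        rw [Matrix.sub_mulVec, Matrix.one_mulVec, symProj_mulVec_bell, sub_self]
        rfl
      rw [Matrix.mulVec, dotProduct] at h2 ⊢
      simp only [K, Sum.elim_inr, Matrix.of_apply]
      by_cases hb : b = 0
      · simpa only [hb, if_true, Pi.zero_apply] using h2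
      · simp [hb]
    simp only [h1, h5]
    rw [Matrix.add_apply, Matrix.sum_apply, Matrix.mul_apply]
    simp [Matrix.vecMulVec_apply, Matrix.sum_apply]

lemma exists_channel_mixedCloneState {β : Sites M N → ℝ} (h : normSq d β = 1) :
    ∃ E : Op d M →ₗ[ℂ] Op d N, IsChannel E ∧ choiState E = mixedCloneState d M N β := by
  set s : ℝ := (Real.sqrt (symDim d (N - M)))⁻¹ with hs
  have h1 : mixedCloneState d M N β = ((s : ℂ) • (cloneVec d M N β * symProj d (N - M))) *
      ((s : ℂ) • (cloneVec d M N β * symProj d (N - M)))ᴴ := by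
    rw [mixedCloneState_eq, Matrix.conjTranspose_smul, Matrix.smul_mul, Matrix.mul_smul, smul_smul,
      Complex.star_def, Complex.conj_ofReal, hs, Complex.ofReal_inv, sqrt_inv_mul_self]
  rw [h1]
  refine exists_channel_of_choi _ ?_ ?_
  · intro a a' b c hty
    rw [Matrix.smul_apply, Matrix.smul_apply, cloneVec_mul_symProj, cloneVec_mul_symProj]
    simp only [uvec, hty]
  · rw [← h1, traceOut_mixedCloneState, h, Complex.ofReal_one, one_smul]

end Choi

/-! ### The fidelity as an expectation value of `R` -/

section Fidelity

variable {d M N : ℕ} [NeZero d]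

lemma copies_ty_left {n : ℕ} (ψ : Fin d → ℂ) {s t : Conf d n} (h : ty s = ty t) (r : Conf d n) :
    copies n ψ s r = copies n ψ t r := by
  simp only [copies, Matrix.of_apply, Finset.prod_mul_distrib]
  rw [prod_eq_map_tyOn Finset.univ s ψ, prod_eq_map_tyOn Finset.univ t ψ]
  exact congrArg (fun m => (Multiset.map ψ m).prod * _) h

lemma copies_ty_right {n : ℕ} (ψ : Fin d → ℂ) {s t : Conf d n} (h : ty s = ty t) (r : Conf d n) :
    copies n ψ r s = copies n ψ r t := by
  simp only [copies, Matrix.of_apply, Finset.prod_mul_distrib]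
  rw [prod_eq_map_tyOn Finset.univ s fun i => star (ψ i),
    prod_eq_map_tyOn Finset.univ t fun i => star (ψ i)]
  exact congrArg (fun m => _ * (Multiset.map (fun i => star (ψ i)) m).prod) h

/-- The integrand of `R`. -/
def stateKer (M : ℕ) (α : Finset (Fin N) → ℝ) (ψ : Fin d → ℂ) : JointOp d M N :=
  Matrix.of fun p q => (symDim d M : ℂ) * (copies M ψ q.1 p.1 * measOp α ψ p.2 q.2)

lemma continuous_copies {n : ℕ} (s t : Conf d n) :
    Continuous fun U : SU d => copies n (pureState U) s t := by
  simp only [copies, Matrix.of_apply]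
  exact continuous_finsetProd _ fun k _ =>
    (continuous_pureState _).mul (continuous_pureState _).star

lemma continuous_copiesOn {n : ℕ} (x : Finset (Fin n)) (s t : Conf d n) :
    Continuous fun U : SU d => copiesOn x (pureState U) s t := by
  simp only [copiesOn, Matrix.of_apply]
  refine continuous_finsetProd _ fun k _ => ?_
  split_ifs
  · exact (continuous_pureState _).mul (continuous_pureState _).star
  · exact continuous_const
  · exact continuous_const

lemma continuous_stateKer (α : Finset (Fin N) → ℝ) (p q : Conf d M × Conf d N) :
    Continuous fun U : SU d => stateKer M α (pureState U) p q := by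
  simp only [stateKer, Matrix.of_apply, measOp, Matrix.sum_apply, Matrix.smul_apply, smul_eq_mul]
  exact continuous_const.mul ((continuous_copies _ _).mul
    (continuous_finsetSum _ fun x _ => continuous_const.mul (continuous_copiesOn x _ _)))

lemma cloningOp_apply (α : Finset (Fin N) → ℝ) (p q : Conf d M × Conf d N) :
    cloningOp d M α p q = ∫ U : SU d, stateKer M α (pureState U) p q ∂(haarSU d) := by
  have h1 : ∀ U : SU d, stateKer M α (pureState U) p q = ∑ x, (α x : ℂ) * ((symDim d M : ℂ) *
      ((copies M (pureState U))ᵀ p.1 q.1 * copiesOn x (pureState U) p.2 q.2)) := by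
    intro U
    simp only [stateKer, Matrix.of_apply, measOp, Matrix.sum_apply, Matrix.smul_apply, smul_eq_mul,
      Finset.mul_sum, Matrix.transpose_apply]
    refine Finset.sum_congr rfl fun x _ => ?_
    ring
  simp only [h1]
  rw [integral_finsetSum]
  · simp only [cloningOp, cloningOpOn, Matrix.sum_apply, Matrix.smul_apply, Matrix.of_apply,
      smul_eq_mul, integral_const_mul]
  · intro x _
    exact integrable_of_continuous (continuous_const.mul (continuous_const.mul
      ((continuous_copies _ _).mul (continuous_copiesOn x _ _))))

/-- The state `ψ^{⊗ M}` is supported on the symmetric subspace, hence a combination of the blocks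
`bellBlock`. By linearity its image under `E` can be read off the Choi state. -/
lemma trace_choiState_mul_stateKer (α : Finset (Fin N) → ℝ) (E : Op d M →ₗ[ℂ] Op d N)
    (ψ : Fin d → ℂ) :
    (choiState E * stateKer M α ψ).trace = (measOp α ψ * E (copies M ψ)).trace := by
  have hD : (symDim d M : ℂ) ≠ 0 :=
    Nat.cast_ne_zero.mpr (symDim_pos d _ (Nat.pos_of_ne_zero (NeZero.ne d))).ne'
  have h1 : copies M ψ =
      ∑ a, ∑ a', ((symDim d M : ℂ) * copies M ψ a a') • bellBlock a a' := by
    have h2 : symProj d M * copies M ψ * symProj d M = copies M ψ := by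
      rw [symProj_mul_of_ty fun s t r h => copies_ty_left ψ h r,
        mul_symProj_of_ty fun s t r h => copies_ty_right ψ h r]
    conv_lhs => rw [← h2]
    ext c c'
    simp only [Matrix.sum_apply, Matrix.smul_apply, bellBlock, Matrix.vecMulVec_apply, smul_eq_mul,
      Pi.star_apply, bell_star]
    rw [Matrix.mul_apply, Finset.sum_comm]
    refine Finset.sum_congr rfl fun a' _ => ?_
    rw [Matrix.mul_apply, Finset.sum_mul]
    refine Finset.sum_congr rfl fun a _ => ?_
    have h3 : symProj d M c a = symProj d M a c := congrFun (congrFun symProj_transpose a) c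
    rw [bell, bell, h3]
    have h4 := sqrt_inv_mul_self (d := d) (M := M)
    linear_combination (-(symDim d M : ℂ) * copies M ψ a a' * symProj d M a c * symProj d M a' c') *
      h4 - (copies M ψ a a' * symProj d M a c * symProj d M a' c') * (mul_inv_cancel₀ hD)
  conv_rhs => rw [h1]
  simp only [map_sum, map_smul, Finset.mul_sum, Matrix.mul_smul, Matrix.trace_sum,
    Matrix.trace_smul, smul_eq_mul]
  simp only [Matrix.trace, Matrix.diag_apply, Matrix.mul_apply, Fintype.sum_prod_type]
  refine Finset.sum_congr rfl fun a _ => ?_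
  rw [Finset.sum_comm]
  refine Finset.sum_congr rfl fun a' _ => ?_
  rw [Finset.sum_comm, Finset.mul_sum]
  refine Finset.sum_congr rfl fun b' _ => ?_
  rw [Finset.mul_sum]
  refine Finset.sum_congr rfl fun b _ => ?_
  rw [choiState_apply]
  simp only [stateKer, Matrix.of_apply]
  ring

/-- The cloning fidelity is the expectation value of `R` in the Choi state. -/
lemma cloningFidelity_eq (α : Finset (Fin N) → ℝ) (E : Op d M →ₗ[ℂ] Op d N) :
    cloningFidelity α E = (choiState E * cloningOp d M α).trace.re := by
  have hcont : ∀ p q, Continuous fun U : SU d =>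
      choiState E p q * stateKer M α (pureState U) q p := fun p q =>
    continuous_const.mul (continuous_stateKer α q p)
  have h1 : (choiState E * cloningOp d M α).trace =
      ∫ U : SU d, (choiState E * stateKer M α (pureState U)).trace ∂(haarSU d) := by
    simp only [Matrix.trace, Matrix.diag_apply, Matrix.mul_apply, cloningOp_apply]
    rw [integral_finsetSum _ fun p _ => integrable_of_continuous
      (continuous_finsetSum _ fun q _ => hcont p q)]
    refine Finset.sum_congr rfl fun p _ => ?_
    rw [integral_finsetSum _ fun q _ => integrable_of_continuous (hcont p q)]
    refine Finset.sum_congr rfl fun q _ => ?_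
    rw [integral_const_mul]
  have h2 : Integrable (fun U : SU d => (choiState E * stateKer M α (pureState U)).trace)
      (haarSU d) := by
    refine integrable_of_continuous ?_
    simp only [Matrix.trace, Matrix.diag_apply, Matrix.mul_apply]
    exact continuous_finsetSum _ fun p _ => continuous_finsetSum _ fun q _ => hcont p q
  rw [h1, cloningFidelity]
  simp only [← trace_choiState_mul_stateKer]
  exact integral_re h2

lemma cloningFidelity_le {α : Finset (Fin N) → ℝ} {lam : ℝ}
    (h : IsMaxEigenvalue (cloningOp d M α) lam) {E : Op d M →ₗ[ℂ] Op d N} (hE : IsChannel E) :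
    cloningFidelity α E ≤ lam := by
  rw [cloningFidelity_eq]
  exact h.trace_le (cloneMat_isHermitian α) (choiState_posSemidef hE) (trace_choiState hE)

end Fidelity

/-! ### The sectors of `R` are connected -/

section Connected

variable {d M N : ℕ} [NeZero d]

/-- Two configurations are linked when `R` has a chain of positive matrix elements between them. -/
def Linked (α : Finset (Fin N) → ℝ) (p q : Conf d M × Conf d N) : Prop :=
  Relation.ReflTransGen (fun p q => 0 < cloneMat d M α p q) p q

lemma Linked.type_eq {α : Finset (Fin N) → ℝ} {p q : Conf d M × Conf d N} (h : Linked α p q)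
    {τ : Multiset (Fin d)} (hp : ty p.2 = ty p.1 + τ) : ty q.2 = ty q.1 + τ := by
  induction h with
  | refl => exact hp
  | tail _ h ih =>
    have h1 := cloneMat_ne_zero h.ne'
    rw [ih, add_left_comm, add_right_inj] at h1
    exact h1.symm

/-- At a zero of a nonnegative eigenvector the eigenvalue equation is a vanishing sum of nonnegative
terms, so the zero spreads along positive matrix elements. -/
lemma Linked.eq_zero {α : Finset (Fin N) → ℝ} (hα : ∀ x, 0 ≤ α x) {lam : ℝ}
    {g : Conf d M × Conf d N → ℝ} (hg : ∀ p, 0 ≤ g p) (hR : cloneMat d M α *ᵥ g = lam • g)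
    {p q : Conf d M × Conf d N} (h : Linked α p q) (hp : g p = 0) : g q = 0 := by
  induction h with
  | refl => exact hp
  | @tail r s _ h ih =>
    have h1 := congrFun hR r
    rw [Pi.smul_apply, ih, smul_zero, Matrix.mulVec, dotProduct,
      Finset.sum_eq_zero_iff_of_nonneg fun q _ => mul_nonneg (cloneMat_nonneg hα r q) (hg q)] at h1
    exact (mul_eq_zero.mp (h1 s (Finset.mem_univ s))).resolve_left h.ne'

/-- The elementary move: one output site trades its letter for `i`, and IN makes the same trade.
Unless the two letters coincide, IN must already hold the letter being given up. -/
lemma cloneMat_update_pos {α : Finset (Fin N) → ℝ} (hα : ∀ x, 0 ≤ α x) {k : Fin N}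
    (hk : ∃ x, k ∈ x ∧ 0 < α x) {a a' : Conf d M} {b : Conf d N} {i : Fin d}
    (h : ty a' + {b k} = ty a + {i}) :
    0 < cloneMat d M α (a, b) (a', Function.update b k i) := by
  obtain ⟨x, hkx, hx⟩ := hk
  refine cloneMat_pos hα hx ?_ ?_
  · intro l hl
    refine (Function.update_of_ne ?_ _ _).symm
    rintro rfl
    exact hl hkx
  · have h1 := tyOn_update hkx b i
    dsimp only
    rw [← add_left_inj ({b k} : Multiset (Fin d)), add_assoc (ty a), h1, add_right_comm, h,
      add_right_comm, add_assoc]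

/-- If every site is assessed then all configurations of a sector are linked. -/
lemma linked_of_type_eq {α : Finset (Fin N) → ℝ} (hα : ∀ x, 0 ≤ α x) (hM : 0 < M) (hMN : M ≤ N)
    (hn : ∀ k : Fin N, ∃ x, k ∈ x ∧ 0 < α x) {τ : Multiset (Fin d)} {p q : Conf d M × Conf d N}
    (hp : ty p.2 = ty p.1 + τ) (hq : ty q.2 = ty q.1 + τ) : Linked α p q := by
  obtain ⟨a, b⟩ := p
  obtain ⟨a₂, b₂⟩ := q
  dsimp only at hp hq
  -- The induction is on the number of output sites that still differ from the target.
  induction hc : (Finset.univ.filter fun k => b k ≠ b₂ k).card using Nat.strong_induction_on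
    generalizing a b with
  | _ n ih =>
  have hstep : ∀ (a' : Conf d M) (b' : Conf d N), Linked α (a, b) (a', b') →
      (∃ k, b k ≠ b₂ k ∧ b' k = b₂ k) → (∀ k, b k = b₂ k → b' k = b₂ k) →
      Linked α (a, b) (a₂, b₂) := by
    intro a' b' hl ⟨k, hk, hk'⟩ hsub
    refine hl.trans (ih _ ?_ a' b' (hl.type_eq hp) rfl)
    rw [← hc]
    refine Finset.card_lt_card ⟨fun l hl => ?_, fun hsub' => ?_⟩
    · simp only [Finset.mem_filter, Finset.mem_univ, true_and] at hl ⊢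
      exact fun h => hl (hsub l h)
    · have := hsub' (Finset.mem_filter.mpr ⟨Finset.mem_univ k, hk⟩)
      simp [hk'] at this
  by_cases h0 : ∀ k, b k = b₂ k
  · obtain rfl : b = b₂ := funext h0
    have hty : ty a = ty a₂ := by
      rw [hp, add_left_inj] at hq
      exact hq
    obtain ⟨x, -, hx⟩ := hn ⟨0, by omega⟩
    exact Relation.ReflTransGen.single (cloneMat_pos hα hx (fun _ _ => rfl) (by
      dsimp only
      rw [hty]))
  push Not at h0
  -- If IN holds the wrong letter of some differing site, one elementary move corrects that site.
  by_cases h1 : ∃ k, b k ≠ b₂ k ∧ b k ∈ ty a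
  · obtain ⟨k, hk, hka⟩ := h1
    obtain ⟨m, hm⟩ := Multiset.exists_cons_of_mem hka
    have hmc : m.card + 1 = M := by rw [← card_ty a, hm, Multiset.card_cons]
    obtain ⟨a', ha'⟩ := exists_ty_eq M (b₂ k ::ₘ m) (by rw [Multiset.card_cons, hmc])
    refine hstep a' (Function.update b k (b₂ k)) (Relation.ReflTransGen.single
      (cloneMat_update_pos hα (hn k) ?_)) ⟨k, hk, by simp⟩ ?_
    · rw [ha', hm]
      simp only [← Multiset.singleton_add]
      abel
    · intro l hl
      by_cases hlk : l = k
      · subst hlk; simp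
      · rw [Function.update_of_ne hlk, hl]
  push Not at h1
  set mis := Finset.univ.filter fun k => b k ≠ b₂ k with hmis
  have hoff : tyOn misᶜ b = tyOn misᶜ b₂ := tyOn_congr fun k hk => by
    simpa [hmis] using hk
  have h2 : ty a + tyOn mis b₂ = ty a₂ + tyOn mis b := by
    have e1 := tyOn_add_compl mis b
    have e2 := tyOn_add_compl mis b₂
    rw [hp] at e1
    rw [hq, ← hoff] at e2
    have e3 : ty a + tyOn mis b₂ + (τ + tyOn misᶜ b) = ty a₂ + tyOn mis b + (τ + tyOn misᶜ b) := by
      rw [add_add_add_comm, ← e1, add_right_comm, add_add_add_comm, e2, add_add_add_comm, ← e2,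
        add_comm (tyOn mis b)]
      rw [e2]
      abel
    exact add_right_cancel e3
  have h3 : ∀ i ∈ ty a, (tyOn mis b).count i = 0 := by
    intro i hi
    rw [Multiset.count_eq_zero, mem_tyOn]
    rintro ⟨k, hk, rfl⟩
    exact h1 k (by simpa [hmis] using hk) hi
  -- No letter of IN occurs on a differing site, so IN already has the target type, and the target
  -- rearranges the letters on the differing sites.
  have h4 : ty a = ty a₂ := by
    refine Multiset.eq_of_le_of_card_le (Multiset.le_iff_count.mpr fun i => ?_)
      (by rw [card_ty, card_ty])
    by_cases hi : i ∈ ty a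
    · have e1 := congrArg (Multiset.count i) h2
      rw [Multiset.count_add, Multiset.count_add, h3 i hi] at e1
      omega
    · rw [Multiset.count_eq_zero.mpr hi]
      exact Nat.zero_le _
  have h5 : tyOn mis b₂ = tyOn mis b := by
    rw [h4] at h2
    exact add_left_cancel h2
  obtain ⟨m, hm⟩ := h0
  obtain ⟨n', hn', hn''⟩ : ∃ n' ∈ mis, b n' = b₂ m := by
    rw [← mem_tyOn, ← h5, mem_tyOn]
    exact ⟨m, by simpa [hmis] using hm, rfl⟩
  have hn'm : n' ≠ m := by
    rintro rfl
    exact hm hn''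
  obtain ⟨i, hi⟩ : ∃ i, i ∈ ty a := by
    refine Multiset.card_pos_iff_exists_mem.mp ?_
    rw [card_ty]
    exact hM
  -- IN cannot directly exchange the letters of `m` and `n'`, as it holds neither. A correct site
  -- `s` carrying a letter `i` of IN serves as a buffer: four moves, at `s`, `n'`, `m` and `s`
  -- again, swap `m` with `n'` and restore both `s` and IN.
  obtain ⟨s, -, hs⟩ : ∃ s ∈ Finset.univ, b s = i := by
    have h6 : i ∈ ty b := by
      rw [hp]
      exact Multiset.mem_add.mpr (Or.inl hi)
    exact mem_tyOn.mp h6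
  have hsm : s ≠ m := by
    rintro rfl
    exact h1 s hm (hs ▸ hi)
  have hsn : s ≠ n' := by
    rintro rfl
    exact h1 s (by simpa [hmis] using hn') (hs ▸ hi)
  obtain ⟨m₀, hm₀⟩ := Multiset.exists_cons_of_mem hi
  have hmc : m₀.card + 1 = M := by rw [← card_ty a, hm₀, Multiset.card_cons]
  obtain ⟨a', ha'⟩ := exists_ty_eq M (b₂ m ::ₘ m₀) (by rw [Multiset.card_cons, hmc])
  obtain ⟨a'', ha''⟩ := exists_ty_eq M (b m ::ₘ m₀) (by rw [Multiset.card_cons, hmc])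
  have hswap : ∀ i j : Fin d, (i ::ₘ m₀) + {j} = (j ::ₘ m₀) + {i} := by
    intro i j
    simp only [← Multiset.singleton_add]
    abel
  set b1 := Function.update b s (b₂ m) with hb1
  set b2 := Function.update b1 n' (b m) with hb2
  set b3 := Function.update b2 m (b₂ m) with hb3
  set b4 := Function.update b3 s i with hb4
  have e1 : 0 < cloneMat d M α (a, b) (a', b1) := cloneMat_update_pos hα (hn s) (by
    rw [ha', hm₀, hs, hswap])
  have e2 : 0 < cloneMat d M α (a', b1) (a'', b2) := cloneMat_update_pos hα (hn n') (by
    rw [ha', ha'', hb1, Function.update_of_ne hsn.symm, hn'', hswap])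
  have e3 : 0 < cloneMat d M α (a'', b2) (a', b3) := cloneMat_update_pos hα (hn m) (by
    rw [ha', ha'', hb2, Function.update_of_ne hn'm.symm, hb1, Function.update_of_ne hsm.symm, hswap])
  have e4 : 0 < cloneMat d M α (a', b3) (a, b4) := cloneMat_update_pos hα (hn s) (by
    rw [ha', hm₀, hb3, Function.update_of_ne hsm, hb2, Function.update_of_ne hsn, hb1,
      Function.update_self, hswap])
  have hlink : Linked α (a, b) (a, b4) :=
    .tail (.tail (.tail (.single e1) e2) e3) e4
  refine hstep a b4 hlink ⟨m, hm, ?_⟩ ?_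
  · rw [hb4, Function.update_of_ne hsm.symm, hb3, Function.update_self]
  · intro l hl
    have hlm : l ≠ m := by rintro rfl; exact hm hl
    have hln : l ≠ n' := by
      rintro rfl
      exact (show b l ≠ b₂ l by simpa [hmis] using hn') hl
    by_cases hls : l = s
    · subst hls
      rw [hb4, Function.update_self, ← hl, hs]
    · rw [hb4, Function.update_of_ne hls, hb3, Function.update_of_ne hlm, hb2,
        Function.update_of_ne hln, hb1, Function.update_of_ne hls, hl]

end Connected

/-! ### The maximum eigenvectors of `R` -/

section TopSpace

variable {d M N : ℕ}

lemma exists_mem_free_tyOn {s : Finset (Fin N)} {m : Multiset (Fin d)} (hm : m.card = s.card)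
    (b₀ : Conf d N) : ∃ b ∈ free s b₀, tyOn s b = m := by
  by_contra! h
  have h1 : ∑ b ∈ free s b₀, (if tyOn s b = m then 1 else 0) = cnt d s.card m :=
    sum_free (H := fun t => if t = m then 1 else 0) fun _ _ => rfl
  rw [Finset.sum_eq_zero fun b hb => if_neg (h b hb)] at h1
  exact (cnt_pos hm).ne h1

/-- Both sides come from the same type with one letter removed, by `cnt_cons_mul_count`. This is the
invariance of the Bell vector at the level of coefficients. -/
lemma count_mul_inv_cnt {m m' : Multiset (Fin d)} {i j : Fin d} (hm : m.card = M)
    (h : m' + {i} = m + {j}) :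
    (m'.count j : ℝ) * (cnt d M m : ℝ)⁻¹ = m.count i * (cnt d M m' : ℝ)⁻¹ := by
  have hm' : m'.card = M := by
    have := congrArg Multiset.card h
    simp only [Multiset.card_add, Multiset.card_singleton] at this
    omega
  by_cases hij : i = j
  · subst hij
    rw [add_left_inj] at h
    rw [h]
  · have hi : i ∈ m := by
      have h1 : i ∈ m + {j} := h ▸ Multiset.mem_add.mpr (Or.inr (Multiset.mem_singleton_self i))
      rcases Multiset.mem_add.mp h1 with h1 | h1
      · exact h1
      · exact absurd (Multiset.mem_singleton.mp h1) hij
    obtain ⟨n, rfl⟩ := Multiset.exists_cons_of_mem hi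
    obtain rfl : m' = j ::ₘ n := by
      rw [← Multiset.singleton_add, add_comm m', add_assoc, add_right_inj] at h
      rw [h, add_comm, Multiset.singleton_add]
    obtain rfl : M = n.card + 1 := by rw [← hm, Multiset.card_cons]
    have e1 := cnt_cons_mul_count n i rfl
    have e2 := cnt_cons_mul_count n j rfl
    have h1 : (cnt d (n.card + 1) (i ::ₘ n) : ℝ) ≠ 0 := cnt_ne_zero hm
    have h2 : (cnt d (n.card + 1) (j ::ₘ n) : ℝ) ≠ 0 := cnt_ne_zero hm'
    have e3 : (cnt d (n.card + 1) (i ::ₘ n) : ℝ) * (i ::ₘ n).count i =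
        cnt d (n.card + 1) (j ::ₘ n) * (j ::ₘ n).count j := by exact_mod_cast e1.trans e2.symm
    field_simp
    linarith

/-- Output sites in `y` balance the sites of IN because the Bell vector is invariant. A site outside
`y` would put the letter `i` into `τ`, so it contributes nothing. -/
lemma sum_ite_uvec_single (y : Sites M N) {τ : Multiset (Fin d)} {i j : Fin d} (hi : i ∉ τ)
    (a : Conf d M) (b : Conf d N) :
    (∑ k, if b k = j then uvec (Pi.single y 1) τ (a, Function.update b k i) else 0) =
      ∑ k, if a k = i then uvec (Pi.single y 1) τ (Function.update a k j, b) else 0 := by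
  simp only [uvec_single]
  have h1 : ∀ k, (if b k = j then (if tyOn y.1 (Function.update b k i) = ty a ∧
      tyOn y.1ᶜ (Function.update b k i) = τ then (cnt d M (ty a) : ℝ)⁻¹ else 0) else 0) =
      if k ∈ y.1.filter (fun k => b k = j) then
        (if tyOn y.1 b + {i} = ty a + {j} ∧ tyOn y.1ᶜ b = τ then (cnt d M (ty a) : ℝ)⁻¹ else 0)
      else 0 := by
    intro k
    simp only [Finset.mem_filter]
    by_cases hb : b k = j
    · by_cases hk : k ∈ y.1
      · have e1 := tyOn_update hk b i
        have e2 : tyOn y.1ᶜ (Function.update b k i) = tyOn y.1ᶜ b := tyOn_congr fun l hl => by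
          rw [Function.update_of_ne]
          rintro rfl
          exact Finset.mem_compl.mp hl hk
        rw [if_pos hb, if_pos (c := k ∈ y.1 ∧ b k = j) ⟨hk, hb⟩, e2, ← e1, hb]
        simp only [add_left_inj]
      · have e1 : tyOn y.1ᶜ (Function.update b k i) ≠ τ := by
          rintro rfl
          exact hi (mem_tyOn.mpr ⟨k, Finset.mem_compl.mpr hk, Function.update_self ..⟩)
        simp [hk, e1]
    · simp [hb]
  have h2 : ∀ k, (if a k = i then (if tyOn y.1 b = ty (Function.update a k j) ∧
      tyOn y.1ᶜ b = τ then (cnt d M (ty (Function.update a k j)) : ℝ)⁻¹ else 0) else 0) =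
      if k ∈ Finset.univ.filter (fun k => a k = i) then
        (if tyOn y.1 b + {i} = ty a + {j} ∧ tyOn y.1ᶜ b = τ then
          (cnt d M (tyOn y.1 b) : ℝ)⁻¹ else 0) else 0 := by
    intro k
    simp only [Finset.mem_filter, Finset.mem_univ, true_and]
    by_cases ha : a k = i
    · have e1 := tyOn_update (Finset.mem_univ k) a j
      rw [if_pos ha, if_pos ha, ← e1, ha]
      simp only [add_left_inj]
      split_ifs with h3
      · rw [h3.1]
      · rfl
    · simp [ha]
  rw [Finset.sum_congr rfl fun k _ => h1 k, Finset.sum_congr rfl fun k _ => h2 k,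
    Finset.sum_ite_mem, Finset.sum_ite_mem, Finset.univ_inter, Finset.univ_inter,
    Finset.sum_const, Finset.sum_const, ← count_tyOn, ← count_tyOn, nsmul_eq_mul, nsmul_eq_mul]
  split_ifs with h3
  · exact count_mul_inv_cnt (card_ty a) h3.1
  · simp

/-- The Bell factors are invariant, so the matrix unit acts on `Φ` alone, and there it replaces a
letter that `Φ` does not contain. -/
lemma jointTot_single_mulVec_uvec (β : Sites M N → ℝ) {τ : Multiset (Fin d)} {i j : Fin d}
    (hi : i ∉ τ) :
    jointTot M N (Matrix.single j i 1) *ᵥ (fun p => (uvec β τ p : ℂ)) = 0 := by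
  funext p
  have h1 : (∑ k, if p.2 k = j then uvec β τ (p.1, Function.update p.2 k i) else 0) =
      ∑ k, if p.1 k = i then uvec β τ (Function.update p.1 k j, p.2) else 0 := by
    have h2 : ∀ (k : Fin N), (if p.2 k = j then uvec β τ (p.1, Function.update p.2 k i) else 0) =
        ∑ y, β y * if p.2 k = j then uvec (Pi.single y 1) τ (p.1, Function.update p.2 k i) else 0 := by
      intro k
      rw [uvec_eq_sum]
      split_ifs <;> simp
    have h3 : ∀ (k : Fin M), (if p.1 k = i then uvec β τ (Function.update p.1 k j, p.2) else 0) =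
        ∑ y, β y * if p.1 k = i then uvec (Pi.single y 1) τ (Function.update p.1 k j, p.2) else 0 := by
      intro k
      rw [uvec_eq_sum]
      split_ifs <;> simp
    rw [Finset.sum_congr rfl fun k _ => h2 k, Finset.sum_congr rfl fun k _ => h3 k,
      Finset.sum_comm, Finset.sum_comm (s := (Finset.univ : Finset (Fin M)))]
    refine Finset.sum_congr rfl fun y _ => ?_
    rw [← Finset.mul_sum, ← Finset.mul_sum, sum_ite_uvec_single y hi]
  have h4 := congrArg Complex.ofReal h1
  push_cast at h4
  rw [jointTot_single_mulVec, Pi.zero_apply, sub_eq_zero]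
  refine Eq.trans ?_ (h4.trans ?_)
  · exact Finset.sum_congr rfl fun k _ => by split_ifs <;> simp
  · exact Finset.sum_congr rfl fun k _ => by split_ifs <;> simp

variable [NeZero d]

variable {α : Finset (Fin N) → ℝ} {lam : ℝ} {β : Sites M N → ℝ}

lemma exists_uvec_pos (hβ : ∀ y, 0 ≤ β y) (hβ0 : β ≠ 0) {τ : Multiset (Fin d)}
    (hτ : τ.card = N - M) : ∃ p : Conf d M × Conf d N, ty p.2 = ty p.1 + τ ∧ 0 < uvec β τ p := by
  obtain ⟨y, hy⟩ := Function.ne_iff.mp hβ0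
  have hy' : 0 < β y := lt_of_le_of_ne (hβ y) (Ne.symm hy)
  obtain ⟨b, hb, hbτ⟩ := exists_mem_free_tyOn (s := y.1ᶜ) (m := τ)
    (by rw [hτ, Finset.card_compl, y.2, Fintype.card_fin]) (fun _ => (0 : Fin d))
  have h1 : tyOn y.1 b = ty (fun _ : Fin M => (0 : Fin d)) := by
    rw [tyOn_congr (c' := fun _ => (0 : Fin d)) fun k hk => mem_free.mp hb k (by simpa using hk)]
    simp [tyOn, y.2]
  refine ⟨(fun _ => 0, b), ?_, ?_⟩
  · rw [← h1, ← hbτ]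
    exact (tyOn_add_compl y.1 b).symm
  · rw [uvec_eq_sum]
    refine lt_of_lt_of_le ?_ (Finset.single_le_sum (fun z _ =>
      mul_nonneg (hβ z) (uvec_single_nonneg z τ _)) (Finset.mem_univ y))
    rw [uvec_single, if_pos ⟨h1, hbτ⟩]
    exact mul_pos hy' (inv_pos.mpr (by exact_mod_cast cnt_pos (card_ty _)))

/-- One zero in the sector would spread to the whole of it by irreducibility, yet `exists_uvec_pos`
provides a positive entry. -/
lemma uvec_pos_of_eigen (hα : ∀ x, 0 ≤ α x) (hM : 0 < M) (hMN : M ≤ N)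
    (hn : ∀ k : Fin N, ∃ x, k ∈ x ∧ 0 < α x) (hβ : ∀ y, 0 ≤ β y) (hβ0 : β ≠ 0)
    {τ : Multiset (Fin d)} (hev : cloneMat d M α *ᵥ uvec β τ = lam • uvec β τ)
    {p : Conf d M × Conf d N} (hp : ty p.2 = ty p.1 + τ) : 0 < uvec β τ p := by
  have hτ : τ.card = N - M := by
    have := congrArg Multiset.card hp
    rw [Multiset.card_add, card_ty, card_ty] at this
    omega
  obtain ⟨q, hq, hpos⟩ := exists_uvec_pos hβ hβ0 hτ
  refine lt_of_le_of_ne (uvec_nonneg hβ τ p) fun h0 => hpos.ne' ?_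
  exact (linked_of_type_eq hα hM hMN hn hp hq).eq_zero hα (uvec_nonneg hβ τ) hev h0.symm

/-- The optimal weights are positive. -/
lemma pos_of_eigen (hd : 2 ≤ d) (hα : ∀ x, 0 ≤ α x) (hM : 0 < M) (hMN : M ≤ N)
    (hn : ∀ k : Fin N, ∃ x, k ∈ x ∧ 0 < α x) (hβ : ∀ y, 0 ≤ β y) (hβ0 : β ≠ 0)
    (hev : ∀ τ : Multiset (Fin d), cloneMat d M α *ᵥ uvec β τ = lam • uvec β τ) (y : Sites M N) :
    0 < β y := by
  -- With letter `0` exactly on `y` and the input constantly `0`, only the set `y` carries the type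
  -- of the input, so the positive entry is a positive multiple of `β y`. This needs a second
  -- letter.
  let b : Conf d N := fun k => if k ∈ y.1 then 0 else ⟨1, hd⟩
  have h0 : ∀ k, b k = 0 ↔ k ∈ y.1 := by
    intro k
    by_cases hk : k ∈ y.1
    · simp [b, hk]
    · simp only [b, hk, if_false, iff_false]
      intro h
      simpa using congrArg Fin.val h
  have hcard : ∀ z : Sites M N, tyOn z.1 b = ty (fun _ : Fin M => (0 : Fin d)) ↔ z = y := by
    intro z
    constructor
    · intro h
      refine Subtype.ext (Finset.eq_of_subset_of_card_le (fun k hk => ?_) (by rw [z.2, y.2]))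
      have h1 : b k ∈ tyOn z.1 b := mem_tyOn.mpr ⟨k, hk, rfl⟩
      rw [h, mem_tyOn] at h1
      obtain ⟨_, -, h1⟩ := h1
      exact (h0 k).mp h1.symm
    · rintro rfl
      rw [tyOn_congr (c' := fun _ => (0 : Fin d)) fun k hk => (h0 k).mpr hk]
      simp [tyOn, z.2]
  have h1 := uvec_pos_of_eigen (τ := tyOn y.1ᶜ b) hα hM hMN hn hβ hβ0 (hev _)
    (p := (fun _ => 0, b)) (by
      dsimp only
      rw [← (hcard y).mpr rfl, tyOn_add_compl])
  rw [uvec] at h1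
  split_ifs at h1
  · rw [hvec, Finset.sum_eq_single y] at h1
    · by_contra hcon
      have h2 : β y = 0 := le_antisymm (not_lt.mp hcon) (hβ y)
      rw [h2, zero_mul, mul_zero] at h1
      exact lt_irrefl _ h1
    · intro z _ hz
      rw [if_neg, mul_zero]
      exact fun h => hz ((hcard z).mp h)
    · simp
  · exact absurd h1 (lt_irrefl _)

lemma uvec_mem_eigSet {τ : Multiset (Fin d)} (hev : cloneMat d M α *ᵥ uvec β τ = lam • uvec β τ) :
    (fun p => (uvec β τ p : ℂ)) ∈ eigSet d M α lam := by
  rw [eigSet, Set.mem_ofPred_eq, cloningOp_eq, map_ofReal_mulVec, hev]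
  funext p
  simp

/-- In each sector the maximum eigenvector is unique. -/
lemma eq_smul_uvec (h : IsMaxEigenvalue (cloningOp d M α) lam) (hα : ∀ x, 0 ≤ α x) (hM : 0 < M)
    (hMN : M ≤ N) (hn : ∀ k : Fin N, ∃ x, k ∈ x ∧ 0 < α x) (hβ : ∀ y, 0 ≤ β y) (hβ0 : β ≠ 0)
    {τ : Multiset (Fin d)} (hev : cloneMat d M α *ᵥ uvec β τ = lam • uvec β τ)
    {v : Conf d M × Conf d N → ℂ} (hv : v ∈ eigSet d M α lam)
    (hτ : ∀ p, v p ≠ 0 → ty p.2 = ty p.1 + τ) : ∃ c : ℂ, ∀ p, v p = c * uvec β τ p := by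
  by_cases hv0 : v = 0
  · exact ⟨0, fun p => by rw [hv0, zero_mul]; rfl⟩
  obtain ⟨p, hp⟩ := Function.ne_iff.mp hv0
  have hpos := uvec_pos_of_eigen hα hM hMN hn hβ hβ0 hev (hτ p hp)
  have hu : (uvec β τ p : ℂ) ≠ 0 := Complex.ofReal_ne_zero.mpr hpos.ne'
  -- Subtracting a multiple of the positive eigenvector creates a zero at `p`. The moduli of `w`
  -- again form an eigenvector, so this zero spreads over the sector.
  set w : Conf d M × Conf d N → ℂ := v - (v p / uvec β τ p) • fun q => (uvec β τ q : ℂ) with hw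
  have hwT : w ∈ eigSet d M α lam := by
    have h1 := uvec_mem_eigSet hev
    rw [eigSet, Set.mem_ofPred_eq] at hv h1 ⊢
    rw [hw, Matrix.mulVec_sub, Matrix.mulVec_smul, hv, h1, smul_sub, smul_comm]
  rw [mem_eigSet] at hwT
  have hlam := h.cloningOp_pos hα (by
    obtain ⟨x, -, hx⟩ := hn ⟨0, by omega⟩
    exact ⟨x, hx⟩)
  have habs : cloneMat d M α *ᵥ (fun q => ‖w q‖) = lam • fun q => ‖w q‖ := by
    rw [cloningOp_eq] at h
    refine h.mulVec_eq_of_le (cloneMat_transpose α) (fun q => norm_nonneg _) fun q => ?_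
    have h1 : lam * ‖w q‖ = ‖∑ r, (cloneMat d M α q r : ℂ) * w r‖ := by
      rw [hwT q, norm_mul, Complex.norm_real, Real.norm_of_nonneg hlam.le]
    rw [h1]
    refine (norm_sum_le _ _).trans (Finset.sum_le_sum fun r _ => ?_)
    rw [norm_mul, Complex.norm_real, Real.norm_of_nonneg (cloneMat_nonneg hα q r)]
  have hwp : w p = 0 := by
    rw [hw, Pi.sub_apply, Pi.smul_apply, smul_eq_mul, div_mul_cancel₀ _ hu, sub_self]
  refine ⟨v p / uvec β τ p, fun q => ?_⟩
  by_cases hq : ty q.2 = ty q.1 + τ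
  · have h1 := (linked_of_type_eq hα hM hMN hn (hτ p hp) hq).eq_zero hα (fun q => norm_nonneg _)
      habs (by rw [hwp, norm_zero])
    rw [norm_eq_zero, hw, Pi.sub_apply, sub_eq_zero] at h1
    exact h1
  · have h1 : v q = 0 := by
      by_contra h1
      exact hq (hτ q h1)
    have h2 : uvec β τ q = 0 := if_neg hq
    rw [h1, h2, Complex.ofReal_zero, mul_zero]

/-- There is no maximum eigenvector with negative weights. -/
lemma exists_type_of_ne_zero (h : IsMaxEigenvalue (cloningOp d M α) lam) (hα : ∀ x, 0 ≤ α x)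
    (hM : 0 < M) (hMN : M ≤ N) (hn : ∀ k : Fin N, ∃ x, k ∈ x ∧ 0 < α x) (hβ : ∀ y, 0 ≤ β y)
    (hβ0 : β ≠ 0) (hev : ∀ τ : Multiset (Fin d), cloneMat d M α *ᵥ uvec β τ = lam • uvec β τ)
    {v : Conf d M × Conf d N → ℂ} (hv : v ∈ eigSet d M α lam) {p : Conf d M × Conf d N}
    (hp : v p ≠ 0) : ∃ τ, ∀ q, wtPart p v q ≠ 0 → ty q.2 = ty q.1 + τ := by
  have hu0 : wtPart p v ≠ 0 := fun h0 => hp (by simpa [wtPart] using congrFun h0 p)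
  by_cases hneg : ∃ i, wt p i < 0
  · exfalso
    -- A negative weight would lead to a maximum eigenvector `v'` of nonnegative weight in which the
    -- letter `i` is absent, but which a raising operator does not kill. By uniqueness `v'` is a
    -- multiple of a family member, and this is killed.
    obtain ⟨i, j, v', hv', w', hw', hw0, hwi, -, hne⟩ := exists_raise hMN
      (fun v hv i j => jointTot_mem_eigSet v hv i j) (wtPart_mem_eigSet hv p) hu0
      (hasWeight_wtPart p v) hneg
    have hv'0 : v' ≠ 0 := by
      rintro rfl
      exact hne (Matrix.mulVec_zero _)
    obtain ⟨τ, hτ, hcount⟩ := hw'.exists_type hv'0 hw0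
    obtain ⟨c, hc⟩ := eq_smul_uvec h hα hM hMN hn hβ hβ0 (hev τ) hv' hτ
    have hi : i ∉ τ := by
      have h1 := hcount i
      rw [hwi] at h1
      exact Multiset.count_eq_zero.mp (by exact_mod_cast h1)
    refine hne ?_
    have h2 : v' = c • fun p => (uvec β τ p : ℂ) := funext hc
    rw [h2, Matrix.mulVec_smul, jointTot_single_mulVec_uvec β hi, smul_zero]
  · push Not at hneg
    obtain ⟨τ, hτ, -⟩ := (hasWeight_wtPart p v).exists_type hu0 hneg
    exact ⟨τ, hτ⟩

/-- Every maximum eigenvector is of the form `∑_y β_y |B_y⟩|Φ⟩_ȳ` for some symmetric `Φ`. -/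
lemma exists_phi (h : IsMaxEigenvalue (cloningOp d M α) lam) (hα : ∀ x, 0 ≤ α x)
    (hM : 0 < M) (hMN : M ≤ N) (hn : ∀ k : Fin N, ∃ x, k ∈ x ∧ 0 < α x) (hβ : ∀ y, 0 ≤ β y)
    (hβ0 : β ≠ 0) (hev : ∀ τ : Multiset (Fin d), cloneMat d M α *ᵥ uvec β τ = lam • uvec β τ)
    {v : Conf d M × Conf d N → ℂ} (hv : v ∈ eigSet d M α lam) :
    ∃ φ : Multiset (Fin d) → ℂ, ∀ p, v p = ∑ y : Sites M N, (β y : ℂ) *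
      if tyOn y.1 p.2 = ty p.1 then (cnt d M (ty p.1) : ℂ)⁻¹ * φ (tyOn y.1ᶜ p.2) else 0 := by
  have h1 : ∀ τ : Multiset (Fin d), ∃ c : ℂ, ∀ p, ty p.2 = ty p.1 + τ → v p = c * uvec β τ p := by
    intro τ
    by_cases hex : ∃ p, ty p.2 = ty p.1 + τ ∧ v p ≠ 0
    · obtain ⟨p, hp, hvp⟩ := hex
      obtain ⟨τ', hτ'⟩ := exists_type_of_ne_zero h hα hM hMN hn hβ hβ0 hev hv hvp
      have h2 := hτ' p (by simpa [wtPart] using hvp)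
      obtain rfl : τ' = τ := by
        rw [hp, add_right_inj] at h2
        exact h2.symm
      obtain ⟨c, hc⟩ := eq_smul_uvec h hα hM hMN hn hβ hβ0 (hev τ') (wtPart_mem_eigSet hv p) hτ'
      refine ⟨c, fun q hq => ?_⟩
      rw [← hc q, wtPart, if_pos]
      funext i
      simp [wt, hp, hq]
    · push Not at hex
      exact ⟨0, fun p hp => by rw [hex p hp, zero_mul]⟩
  -- The proportionality constants of the different sectors are the amplitudes of the single
  -- symmetric state `Φ`.
  choose φ hφ using h1
  refine ⟨φ, fun p => ?_⟩
  by_cases hp : ∃ τ, ty p.2 = ty p.1 + τ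
  · obtain ⟨τ, hτ⟩ := hp
    rw [hφ τ p hτ, uvec_eq_sum, Complex.ofReal_sum, Finset.mul_sum]
    refine Finset.sum_congr rfl fun y _ => ?_
    rw [uvec_single]
    by_cases hy : tyOn y.1 p.2 = ty p.1
    · have h3 : tyOn y.1ᶜ p.2 = τ := by
        have h4 := tyOn_add_compl y.1 p.2
        rw [hτ, hy, add_right_inj] at h4
        exact h4
      rw [if_pos ⟨hy, h3⟩, if_pos hy, h3]
      push_cast
      ring
    · simp [hy]
  · have h3 : v p = 0 := by
      by_contra h3
      obtain ⟨τ, hτ⟩ := exists_type_of_ne_zero h hα hM hMN hn hβ hβ0 hev hv h3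
      exact hp ⟨τ, hτ p (by simpa [wtPart] using h3)⟩
    rw [h3, eq_comm]
    refine Finset.sum_eq_zero fun y _ => ?_
    rw [if_neg, mul_zero]
    intro hy
    exact hp ⟨tyOn y.1ᶜ p.2, by rw [← hy, tyOn_add_compl]⟩

end TopSpace

/-! ### Reduced states of a symmetric vector -/

section Omega

variable {d : ℕ} {A : Type*} [AddCommMonoid A]

lemma csum_comm_three (l m n : ℕ)
    (F : Multiset (Fin d) → Multiset (Fin d) → Multiset (Fin d) → A) :
    (csum d l fun a => csum d m fun b => csum d n fun c => F a b c) =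
      csum d n fun c => csum d l fun a => csum d m fun b => F a b c := by
  rw [csum_congr fun a _ => csum_comm m n (F a), csum_comm]

lemma csum_fiber {K : Type*} [CommSemiring K] (n : ℕ) (F : Multiset (Fin d) → K) :
    csum d n F = ∑ m : Sym (Fin d) n, (cnt d n m : K) * F m := by
  rw [csum, ← Finset.sum_fiberwise Finset.univ (tySym : Conf d n → Sym (Fin d) n)]
  refine Finset.sum_congr rfl fun m _ => ?_
  have h1 : ∀ c ∈ Finset.univ.filter (fun c : Conf d n => tySym c = m), F (ty c) = F m := by
    intro c hc
    rw [Finset.mem_filter] at hc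
    rw [← hc.2]
    rfl
  rw [Finset.sum_congr rfl h1, Finset.sum_const, nsmul_eq_mul, cnt_eq_card]
  have h2 : (Finset.univ.filter fun c : Conf d n => tySym c = m) =
      Finset.univ.filter fun c : Conf d n => ty c = m.1 :=
    Finset.filter_congr fun c _ => Subtype.ext_iff
  rw [h2]
  rfl

lemma csum_pair_ite {n : ℕ} {t t' : Multiset (Fin d)} (ht : t.card = n) (ht' : t'.card = n)
    (Y : Multiset (Fin d) → Multiset (Fin d) → ℂ) (z : ℂ) :
    (csum d n fun μ => csum d n fun μ' => (cnt d n μ : ℂ)⁻¹ * (cnt d n μ' : ℂ)⁻¹ * Y μ μ' *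
      if t = μ ∧ t' = μ' then z else 0) = Y t t' * z := by
  have h1 : ∀ μ : Multiset (Fin d), (csum d n fun μ' => (cnt d n μ : ℂ)⁻¹ * (cnt d n μ' : ℂ)⁻¹ *
      Y μ μ' * if t = μ ∧ t' = μ' then z else 0) =
      if μ = t then (fun μ => (cnt d n μ : ℂ)⁻¹ * (Y μ t' * z)) μ else 0 := by
    intro μ
    have h2 : ∀ μ' : Multiset (Fin d), (cnt d n μ : ℂ)⁻¹ * (cnt d n μ' : ℂ)⁻¹ *
        Y μ μ' * (if t = μ ∧ t' = μ' then z else 0) = if μ' = t' then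
          (fun μ' => if μ = t then (cnt d n μ : ℂ)⁻¹ * (cnt d n μ' : ℂ)⁻¹ * (Y μ μ' * z) else 0) μ'
          else 0 := by
      intro μ'
      by_cases h3 : t = μ <;> by_cases h4 : t' = μ' <;>
        simp [h3, h4, eq_comm (a := μ), eq_comm (a := μ'), mul_assoc]
    rw [csum_congr fun μ' _ => h2 μ', csum_ite_eq t' fun μ' => if μ = t then
      (cnt d n μ : ℂ)⁻¹ * (cnt d n μ' : ℂ)⁻¹ * (Y μ μ' * z) else 0]
    have h5 : (cnt d n t' : ℂ) ≠ 0 := cnt_ne_zero ht'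
    split_ifs
    · field_simp
    · simp
  rw [csum_congr fun μ _ => h1 μ, csum_ite_eq t fun μ => (cnt d n μ : ℂ)⁻¹ * (Y μ t' * z),
    mul_inv_cancel_left₀ (cnt_ne_zero ht)]

/-- The Hilbert-Schmidt pairing of `Y` with the symmetrised product of `Z` and the identity: the
symmetrisation moves onto `Y`, which then gets partially traced over `e`. -/
lemma csum_pairing {n k : ℕ} (hk : k ≤ n) (Y Z : Multiset (Fin d) → Multiset (Fin d) → ℂ) :
    (csum d n fun μ => csum d n fun μ' => (cnt d n μ : ℂ)⁻¹ * (cnt d n μ' : ℂ)⁻¹ * Y μ μ' *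
      csum d (n - k) fun e => csum d k fun f => csum d k fun g =>
        if e + f = μ ∧ e + g = μ' then Z g f else 0) =
    csum d (n - k) fun e => csum d k fun f => csum d k fun g => Y (e + f) (e + g) * Z g f := by
  simp only [mul_csum]
  rw [csum_comm_three]
  refine csum_congr fun e he => ?_
  rw [csum_comm_three]
  refine csum_congr fun f hf => ?_
  rw [csum_comm_three]
  refine csum_congr fun g hg => ?_
  exact csum_pair_ite (by rw [Multiset.card_add, he, hf]; omega)
    (by rw [Multiset.card_add, he, hg]; omega) Y (Z g f)

lemma csum_diag {n : ℕ} (Y : Multiset (Fin d) → Multiset (Fin d) → ℂ) (C : ℂ) :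
    (csum d n fun μ => csum d n fun μ' => (cnt d n μ : ℂ)⁻¹ * (cnt d n μ' : ℂ)⁻¹ * Y μ μ' *
      if μ = μ' then cnt d n μ * C else 0) = C * csum d n fun μ => Y μ μ := by
  rw [mul_csum]
  refine csum_congr fun μ hμ => ?_
  have h1 : ∀ μ' : Multiset (Fin d), (cnt d n μ : ℂ)⁻¹ * (cnt d n μ' : ℂ)⁻¹ * Y μ μ' *
      (if μ = μ' then cnt d n μ * C else 0) = if μ' = μ then (fun μ' => (cnt d n μ : ℂ)⁻¹ *
        (cnt d n μ' : ℂ)⁻¹ * Y μ μ' * (cnt d n μ * C)) μ' else 0 := by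
    intro μ'
    by_cases h : μ = μ'
    · simp [h]
    · simp [h, Ne.symm h]
  rw [csum_congr fun μ' _ => h1 μ', csum_ite_eq μ fun μ' => (cnt d n μ : ℂ)⁻¹ *
        (cnt d n μ' : ℂ)⁻¹ * Y μ μ' * (cnt d n μ * C)]
  have h2 : (cnt d n μ : ℂ) ≠ 0 := cnt_ne_zero hμ
  field_simp

/-- A family of matrix elements between types is determined by its symmetrised products with the
identity on further spins. -/
lemma eq_zero_of_csum_sub [NeZero d] {K L : ℕ} {W : Multiset (Fin d) → Multiset (Fin d) → ℂ}
    (h : ∀ m m' : Multiset (Fin d), m.card = K + L → m'.card = K + L →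
      (csum d L fun ε => if ε ≤ m ∧ ε ≤ m' then W (m - ε) (m' - ε) else 0) = 0)
    {μ μ' : Multiset (Fin d)} (hμ : μ.card = K) (hμ' : μ'.card = K) : W μ μ' = 0 := by
  induction hn : K - μ.count 0 using Nat.strong_induction_on generalizing μ μ' with
  | _ n ih =>
  -- The test is made at `μ` enlarged by `L` zeros. The term that removes exactly these zeros gives
  -- `W μ μ'`; every other term leaves a first argument with more zeros, already known to vanish by
  -- induction.
  set z := Multiset.replicate L (0 : Fin d) with hz
  have hzc : z.card = L := Multiset.card_replicate L 0
  have h1 := h (μ + z) (μ' + z) (by rw [Multiset.card_add, hμ, hzc])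
    (by rw [Multiset.card_add, hμ', hzc])
  have h2 : ∀ ε : Multiset (Fin d), ε.card = L →
      (if ε ≤ μ + z ∧ ε ≤ μ' + z then W (μ + z - ε) (μ' + z - ε) else 0) =
      if ε = z then (fun _ => W μ μ') ε else 0 := by
    intro ε hε
    by_cases hεz : ε = z
    · subst hεz
      rw [if_pos rfl, if_pos ⟨Multiset.le_add_left _ _, Multiset.le_add_left _ _⟩,
        Multiset.add_sub_cancel_right, Multiset.add_sub_cancel_right]
    · rw [if_neg hεz]
      split_ifs with hle
      · have hlt : ε.count 0 < L := by
          refine lt_of_le_of_ne (hε ▸ Multiset.count_le_card 0 ε) fun hc => hεz ?_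
          rw [← hε, Multiset.count_eq_card] at hc
          exact Multiset.eq_replicate.mpr ⟨hε, fun b hb => (hc b hb).symm⟩
        have hcount : (μ + z - ε).count 0 = μ.count 0 + L - ε.count 0 := by
          rw [Multiset.count_sub, Multiset.count_add, hz, Multiset.count_replicate_self]
        have hc1 : (μ + z - ε).card = K := by
          rw [Multiset.card_sub hle.1, Multiset.card_add, hμ, hzc, hε, Nat.add_sub_cancel]
        have hc2 : (μ' + z - ε).card = K := by
          rw [Multiset.card_sub hle.2, Multiset.card_add, hμ', hzc, hε, Nat.add_sub_cancel]
        refine ih _ ?_ hc1 hc2 rfl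
        have := Multiset.count_le_card 0 (μ + z - ε)
        rw [hc1] at this
        omega
      · rfl
  rw [csum_congr h2, csum_ite_eq z fun _ => W μ μ'] at h1
  exact (mul_eq_zero.mp h1).resolve_left (cnt_ne_zero hzc)

variable [NeZero d]

/-- The difference between the state of `k` of the `n` spins in the symmetric state with
amplitudes `φ` and the maximally mixed symmetric state. -/
def omega (n : ℕ) (φ : Multiset (Fin d) → ℂ) (k : ℕ) (g f : Multiset (Fin d)) : ℂ :=
  (csum d (n - k) fun r => φ (g + r) * star (φ (f + r))) -
    if f = g then (csum d n fun s => φ s * star (φ s)) * (mu f : ℂ) else 0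

lemma csum_mu_add_complex (m : Multiset (Fin d)) (n : ℕ) :
    (csum d n fun r => (mu (m + r) : ℂ)) = mu m := by
  rw [← csum_mu_add m n, csum, csum, Complex.ofReal_sum]

/-- Both parts of the deviation are compatible with partial traces, so the deviation on fewer spins
is the partial trace of the one on more. -/
lemma csum_omega {n K k : ℕ} (hk : k ≤ K) (hK : K ≤ n) (φ : Multiset (Fin d) → ℂ)
    (g f : Multiset (Fin d)) :
    (csum d (K - k) fun e => omega n φ K (e + g) (e + f)) = omega n φ k g f := by
  have h1 : n - k = (K - k) + (n - K) := by omega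
  rw [omega, h1, csum_add]
  simp only [omega, add_right_inj]
  rw [csum, Finset.sum_sub_distrib]
  congr 1
  · rw [csum]
    refine Finset.sum_congr rfl fun e _ => csum_congr fun r _ => ?_
    rw [add_comm (ty e) g, add_comm (ty e) f, add_assoc, add_assoc]
  · split_ifs
    · rw [← csum_mu_add_complex f (K - k), mul_csum]
      exact Finset.sum_congr rfl fun e _ => by rw [add_comm (ty e) f]
    · simp

/-- Tracing out all the spins leaves the norm minus itself. -/
lemma csum_omega_diag {n K : ℕ} (hK : K ≤ n) (φ : Multiset (Fin d) → ℂ) :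
    (csum d K fun μ => omega n φ K μ μ) = 0 := by
  have h1 := csum_omega (Nat.zero_le K) hK φ 0 0
  simp only [add_zero, Nat.sub_zero] at h1
  rw [h1, omega]
  simp [mu_zero]

lemma csum_mu_ite {M k : ℕ} (hk : k ≤ M) (m m' : Multiset (Fin d)) (z : ℂ) :
    (csum d (M - k) fun e => csum d k fun f => csum d k fun g =>
      if e + f = m ∧ e + g = m' then (if f = g then z * (mu f : ℂ) else 0) else 0) =
    if m = m' then cnt d M m * (z * (symDim d k : ℂ)⁻¹) else 0 := by
  have h1 : ∀ e f : Multiset (Fin d), f.card = k → (csum d k fun g =>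
      if e + f = m ∧ e + g = m' then (if f = g then z * (mu f : ℂ) else 0) else 0) =
      if e + f = m then (if m = m' then z * (symDim d k : ℂ)⁻¹ else 0) else 0 := by
    intro e f hf
    have h2 : ∀ g : Multiset (Fin d),
        (if e + f = m ∧ e + g = m' then (if f = g then z * (mu f : ℂ) else 0) else 0) =
        if g = f then (fun _ => if e + f = m then (if m = m' then z * (mu f : ℂ) else 0) else 0) g
          else 0 := by
      intro g
      by_cases hgf : g = f
      · subst hgf
        by_cases h3 : e + g = m
        · simp [h3]
        · simp [h3]
      · simp [hgf, Ne.symm hgf]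
    rw [csum_congr fun g _ => h2 g, csum_ite_eq f fun _ =>
      if e + f = m then (if m = m' then z * (mu f : ℂ) else 0) else 0]
    have h4 : (cnt d k f : ℂ) ≠ 0 := cnt_ne_zero hf
    rw [mu_eq hf]
    push_cast
    split_ifs
    · field_simp
    · simp
    · simp
  rw [csum_congr fun e _ => csum_congr fun f hf => h1 e f hf, csum_csum_add_eq hk]
  split_ifs <;> simp

end Omega

/-! ### The reduced states of an economical optimal cloner -/

section Economical

variable {d M N : ℕ} [NeZero d]

lemma card_sdiff_le (y z : Sites M N) :
    (y.1 \ z.1).card ≤ M ∧ (y.1 \ z.1).card ≤ N - M := by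
  have hy := y.2
  have hz := z.2
  have c1 := Finset.card_sdiff_add_card_inter y.1 z.1
  have c3 := Finset.card_union_add_card_inter y.1 z.1
  have c4 := Finset.card_le_univ (y.1 ∪ z.1)
  rw [Fintype.card_fin] at c4
  omega

lemma csum_star {n : ℕ} (F : Multiset (Fin d) → ℂ) :
    star (csum d n F) = csum d n fun m => star (F m) := by
  simp [csum]

/-- The condition that the reduced state on IN be maximally mixed, in terms of the reduced states
of `φ`. -/
lemma exists_sum_omega {β : Sites M N → ℝ} {φ : Multiset (Fin d) → ℂ}
    {v : Conf d M × Conf d N → ℂ} (hv : ∀ p, v p = ∑ y : Sites M N, (β y : ℂ) *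
      if tyOn y.1 p.2 = ty p.1 then (cnt d M (ty p.1) : ℂ)⁻¹ * φ (tyOn y.1ᶜ p.2) else 0)
    (htr : ∀ a a', ∑ b, v (a, b) * star (v (a', b)) = (symDim d M : ℂ)⁻¹ * symProj d M a a') :
    ∃ C : ℂ, ∀ m m' : Multiset (Fin d), m.card = M → m'.card = M →
      (∑ y : Sites M N, ∑ z : Sites M N, (β y * β z : ℂ) *
        csum d (M - (y.1 \ z.1).card) fun e => csum d (y.1 \ z.1).card fun f =>
          csum d (y.1 \ z.1).card fun g => if e + f = m ∧ e + g = m' then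
            omega (N - M) φ (y.1 \ z.1).card g f else 0) = if m = m' then cnt d M m * C else 0 := by
  -- The squared norm of `Φ`. Replacing the reduced states of `Φ` by their deviations subtracts
  -- maximally mixed parts, which contribute multiples of the identity and only shift the constant.
  set κ : ℂ := csum d (N - M) fun s => φ s * star (φ s) with hκ
  refine ⟨(symDim d M : ℂ)⁻¹ -
    ∑ y : Sites M N, ∑ z : Sites M N, (β y * β z : ℂ) * (κ * (symDim d (y.1 \ z.1).card : ℂ)⁻¹),
    fun m m' hm hm' => ?_⟩
  obtain ⟨a, rfl⟩ := exists_ty_eq M m hm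
  obtain ⟨a', rfl⟩ := exists_ty_eq M m' hm'
  have hca : (cnt d M (ty a) : ℂ) ≠ 0 := cnt_ne_zero hm
  have hca' : (cnt d M (ty a') : ℂ) ≠ 0 := cnt_ne_zero hm'
  have h1 : ∑ y : Sites M N, ∑ z : Sites M N, (β y * β z : ℂ) *
      (csum d (M - (y.1 \ z.1).card) fun e => csum d (y.1 \ z.1).card fun f =>
        csum d (y.1 \ z.1).card fun g => if e + f = ty a ∧ e + g = ty a' then
          csum d (N - M - (y.1 \ z.1).card) fun r => φ (g + r) * star (φ (f + r)) else 0) =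
      if ty a = ty a' then cnt d M (ty a) * (symDim d M : ℂ)⁻¹ else 0 := by
    have h2 : ∀ b : Conf d N, v (a, b) * star (v (a', b)) = ∑ y : Sites M N, ∑ z : Sites M N,
        (cnt d M (ty a) : ℂ)⁻¹ * (cnt d M (ty a') : ℂ)⁻¹ * ((β y * β z : ℂ) *
          if tyOn y.1 b = ty a ∧ tyOn z.1 b = ty a' then
            φ (tyOn y.1ᶜ b) * star (φ (tyOn z.1ᶜ b)) else 0) := by
      intro b
      rw [hv, hv, star_sum, Finset.sum_mul_sum]
      refine Finset.sum_congr rfl fun y _ => Finset.sum_congr rfl fun z _ => ?_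
      by_cases h3 : tyOn y.1 b = ty a <;> by_cases h4 : tyOn z.1 b = ty a' <;>
        simp [h3, h4]
      ring
    have h5 := htr a a'
    rw [Finset.sum_congr rfl fun b _ => h2 b, Finset.sum_comm] at h5
    have h6 : ∀ y : Sites M N, (∑ b : Conf d N, ∑ z : Sites M N, (cnt d M (ty a) : ℂ)⁻¹ *
        (cnt d M (ty a') : ℂ)⁻¹ * ((β y * β z : ℂ) *
          if tyOn y.1 b = ty a ∧ tyOn z.1 b = ty a' then
            φ (tyOn y.1ᶜ b) * star (φ (tyOn z.1ᶜ b)) else 0)) =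
        (cnt d M (ty a) : ℂ)⁻¹ * (cnt d M (ty a') : ℂ)⁻¹ * ∑ z : Sites M N, (β y * β z : ℂ) *
          (csum d (M - (y.1 \ z.1).card) fun e => csum d (y.1 \ z.1).card fun f =>
            csum d (y.1 \ z.1).card fun g => if e + f = ty a ∧ e + g = ty a' then
              csum d (N - M - (y.1 \ z.1).card) fun r => φ (g + r) * star (φ (f + r)) else 0) := by
      intro y
      rw [Finset.sum_comm, Finset.mul_sum]
      refine Finset.sum_congr rfl fun z _ => ?_
      rw [← Finset.mul_sum, ← Finset.mul_sum,
        sum_sites_pair y z (ty a) (ty a') fun p q => φ p * star (φ q)]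
    rw [Finset.sum_congr rfl fun y _ => h6 y, ← Finset.mul_sum, symProj_apply] at h5
    have h7 := congrArg (fun t => (cnt d M (ty a) : ℂ) * cnt d M (ty a') * t) h5
    rw [← mul_assoc, show (cnt d M (ty a) : ℂ) * cnt d M (ty a') * ((cnt d M (ty a) : ℂ)⁻¹ *
      (cnt d M (ty a') : ℂ)⁻¹) = 1 by field_simp, one_mul] at h7
    rw [h7]
    split_ifs with h8
    · rw [← h8]
      field_simp
    · simp
  have h9 : ∑ y : Sites M N, ∑ z : Sites M N, (β y * β z : ℂ) *
      (csum d (M - (y.1 \ z.1).card) fun e => csum d (y.1 \ z.1).card fun f =>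
        csum d (y.1 \ z.1).card fun g => if e + f = ty a ∧ e + g = ty a' then
          (if f = g then κ * (mu f : ℂ) else 0) else 0) =
      if ty a = ty a' then cnt d M (ty a) * ∑ y : Sites M N, ∑ z : Sites M N,
        (β y * β z : ℂ) * (κ * (symDim d (y.1 \ z.1).card : ℂ)⁻¹) else 0 := by
    have h10 : ∀ y z : Sites M N, (β y * β z : ℂ) *
      (csum d (M - (y.1 \ z.1).card) fun e => csum d (y.1 \ z.1).card fun f =>
        csum d (y.1 \ z.1).card fun g => if e + f = ty a ∧ e + g = ty a' then
          (if f = g then κ * (mu f : ℂ) else 0) else 0) = if ty a = ty a' then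
          cnt d M (ty a) * ((β y * β z : ℂ) * (κ * (symDim d (y.1 \ z.1).card : ℂ)⁻¹)) else 0 := by
      intro y z
      rw [csum_mu_ite (card_sdiff_le y z).1]
      split_ifs
      · ring
      · simp
    rw [Finset.sum_congr rfl fun y _ => Finset.sum_congr rfl fun z _ => h10 y z]
    split_ifs
    · simp only [Finset.mul_sum]
    · simp
  have h11 : (if ty a = ty a' then (cnt d M (ty a) : ℂ) * ((symDim d M : ℂ)⁻¹ -
      ∑ y : Sites M N, ∑ z : Sites M N, (β y * β z : ℂ) *
        (κ * (symDim d (y.1 \ z.1).card : ℂ)⁻¹)) else 0) =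
      (if ty a = ty a' then cnt d M (ty a) * (symDim d M : ℂ)⁻¹ else 0) -
      if ty a = ty a' then cnt d M (ty a) * ∑ y : Sites M N, ∑ z : Sites M N,
        (β y * β z : ℂ) * (κ * (symDim d (y.1 \ z.1).card : ℂ)⁻¹) else 0 := by
    split_ifs
    · rw [mul_sub]
    · rw [sub_zero]
  rw [h11, ← h1, ← h9, ← Finset.sum_sub_distrib]
  refine Finset.sum_congr rfl fun y _ => ?_
  rw [← Finset.sum_sub_distrib]
  refine Finset.sum_congr rfl fun z _ => ?_
  rw [← mul_sub]
  congr 1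
  simp only [csum]
  rw [← Finset.sum_sub_distrib]
  refine Finset.sum_congr rfl fun e _ => ?_
  rw [← Finset.sum_sub_distrib]
  refine Finset.sum_congr rfl fun f _ => ?_
  rw [← Finset.sum_sub_distrib]
  refine Finset.sum_congr rfl fun g _ => ?_
  by_cases h12 : ty e + ty f = ty a ∧ ty e + ty g = ty a'
  · rw [if_pos h12, if_pos h12, if_pos h12]
    rfl
  · rw [if_neg h12, if_neg h12, if_neg h12, sub_zero]

/-- The number of further spins in the previous condition can be lowered. -/
lemma sum_omega_of_le {β : Sites M N → ℝ} {φ : Multiset (Fin d) → ℂ} {C : ℂ} {K : ℕ} (hK : K ≤ M)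
    (hK' : ∀ y z : Sites M N, (y.1 \ z.1).card ≤ K)
    (h : ∀ m m' : Multiset (Fin d), m.card = M → m'.card = M →
      (∑ y : Sites M N, ∑ z : Sites M N, (β y * β z : ℂ) *
        csum d (M - (y.1 \ z.1).card) fun e => csum d (y.1 \ z.1).card fun f =>
          csum d (y.1 \ z.1).card fun g => if e + f = m ∧ e + g = m' then
            omega (N - M) φ (y.1 \ z.1).card g f else 0) = if m = m' then cnt d M m * C else 0)
    {μ μ' : Multiset (Fin d)} (hμ : μ.card = K) (hμ' : μ'.card = K) :
    (∑ y : Sites M N, ∑ z : Sites M N, (β y * β z : ℂ) *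
        csum d (K - (y.1 \ z.1).card) fun e => csum d (y.1 \ z.1).card fun f =>
          csum d (y.1 \ z.1).card fun g => if e + f = μ ∧ e + g = μ' then
            omega (N - M) φ (y.1 \ z.1).card g f else 0) = if μ = μ' then cnt d K μ * C else 0 := by
  rw [← sub_eq_zero]
  -- The condition on `M` spins is the symmetrised product, with the identity on `M - K` spins, of
  -- the same condition on `K` spins, because every deviation involves at most `K` of them.
  refine eq_zero_of_csum_sub (L := M - K) (W := fun μ μ' =>
    (∑ y : Sites M N, ∑ z : Sites M N, (β y * β z : ℂ) *
        csum d (K - (y.1 \ z.1).card) fun e => csum d (y.1 \ z.1).card fun f =>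
          csum d (y.1 \ z.1).card fun g => if e + f = μ ∧ e + g = μ' then
            omega (N - M) φ (y.1 \ z.1).card g f else 0) - if μ = μ' then cnt d K μ * C else 0)
    (fun m m' hm hm' => ?_) hμ hμ'
  rw [Nat.add_sub_cancel' hK] at hm hm'
  have h1 := h m m' hm hm'
  have hsub : ∀ {ε s m : Multiset (Fin d)}, ε + s = m ↔ ε ≤ m ∧ s = m - ε := by
    intro ε s m
    constructor
    · rintro rfl
      exact ⟨Multiset.le_add_right _ _, (add_tsub_cancel_left _ _).symm⟩
    · rintro ⟨h1, rfl⟩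
      exact add_tsub_cancel_of_le h1
  have h2 : (csum d (M - K) fun ε => if ε ≤ m ∧ ε ≤ m' then
      (if m - ε = m' - ε then cnt d K (m - ε) * C else 0) else 0) =
      if m = m' then cnt d M m * C else 0 := by
    rw [← csum_csum_add_eq hK m C]
    by_cases hmm : m = m'
    · subst hmm
      rw [if_pos rfl]
      refine csum_congr fun ε _ => ?_
      by_cases h3 : ε ≤ m
      · rw [if_pos ⟨h3, h3⟩, if_pos rfl, ← csum_ite_eq (m - ε) fun _ => C]
        refine csum_congr fun s _ => ?_
        simp only [hsub, h3, true_and]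
      · rw [if_neg fun h => h3 h.1]
        simp [hsub, h3, csum]
    · rw [if_neg hmm]
      refine Finset.sum_eq_zero fun ε _ => ?_
      dsimp only
      split_ifs with h3 h4
      · refine absurd ?_ hmm
        rw [← add_tsub_cancel_of_le h3.1, h4, add_tsub_cancel_of_le h3.2]
      · rfl
      · rfl
  have h3 : ∀ y z : Sites M N, (csum d (M - K) fun ε => if ε ≤ m ∧ ε ≤ m' then
      csum d (K - (y.1 \ z.1).card) fun e => csum d (y.1 \ z.1).card fun f =>
        csum d (y.1 \ z.1).card fun g => if e + f = m - ε ∧ e + g = m' - ε then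
          omega (N - M) φ (y.1 \ z.1).card g f else 0 else 0) =
      csum d (M - (y.1 \ z.1).card) fun e => csum d (y.1 \ z.1).card fun f =>
        csum d (y.1 \ z.1).card fun g => if e + f = m ∧ e + g = m' then
          omega (N - M) φ (y.1 \ z.1).card g f else 0 := by
    intro y z
    have h4 := hK' y z
    rw [show M - (y.1 \ z.1).card = (M - K) + (K - (y.1 \ z.1).card) by omega, csum_add]
    refine csum_congr fun ε _ => ?_
    by_cases h5 : ε ≤ m <;> by_cases h6 : ε ≤ m' <;> simp [h5, h6, add_assoc, hsub, csum]
  rw [← h2] at h1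
  rw [← sub_eq_zero] at h1
  refine Eq.trans ?_ h1
  rw [csum, csum]
  have h7 : ∀ ε : Multiset (Fin d), (if ε ≤ m ∧ ε ≤ m' then
      (∑ y : Sites M N, ∑ z : Sites M N, (β y * β z : ℂ) *
        csum d (K - (y.1 \ z.1).card) fun e => csum d (y.1 \ z.1).card fun f =>
          csum d (y.1 \ z.1).card fun g => if e + f = m - ε ∧ e + g = m' - ε then
            omega (N - M) φ (y.1 \ z.1).card g f else 0) -
        (if m - ε = m' - ε then cnt d K (m - ε) * C else 0) else 0) =
      (∑ y : Sites M N, ∑ z : Sites M N, (β y * β z : ℂ) * if ε ≤ m ∧ ε ≤ m' then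
        csum d (K - (y.1 \ z.1).card) fun e => csum d (y.1 \ z.1).card fun f =>
          csum d (y.1 \ z.1).card fun g => if e + f = m - ε ∧ e + g = m' - ε then
            omega (N - M) φ (y.1 \ z.1).card g f else 0 else 0) -
        if ε ≤ m ∧ ε ≤ m' then (if m - ε = m' - ε then cnt d K (m - ε) * C else 0) else 0 := by
    intro ε
    split_ifs
    · rfl
    · rfl
    · simp
  rw [Finset.sum_congr rfl fun c _ => h7 (ty c), Finset.sum_sub_distrib]
  congr 1
  rw [Finset.sum_comm]
  refine Finset.sum_congr rfl fun y _ => ?_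
  rw [Finset.sum_comm]
  refine Finset.sum_congr rfl fun z _ => ?_
  rw [← Finset.mul_sum, ← h3 y z]
  rfl

/-- The reduced states of `φ` are maximally mixed. -/
lemma omega_eq_zero {β : Sites M N → ℝ} (hβ : ∀ y, 0 < β y) {φ : Multiset (Fin d) → ℂ} {C : ℂ}
    {K : ℕ} (hKN : K ≤ N - M) (hK' : ∀ y z : Sites M N, (y.1 \ z.1).card ≤ K)
    (h : ∀ μ μ' : Multiset (Fin d), μ.card = K → μ'.card = K →
      (∑ y : Sites M N, ∑ z : Sites M N, (β y * β z : ℂ) *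
        csum d (K - (y.1 \ z.1).card) fun e => csum d (y.1 \ z.1).card fun f =>
          csum d (y.1 \ z.1).card fun g => if e + f = μ ∧ e + g = μ' then
            omega (N - M) φ (y.1 \ z.1).card g f else 0) = if μ = μ' then cnt d K μ * C else 0)
    (hex : ∃ y z : Sites M N, (y.1 \ z.1).card = K) {f g : Multiset (Fin d)} (hf : f.card = K)
    (hg : g.card = K) : omega (N - M) φ K g f = 0 := by
  -- The pairing with the deviation on `K` spins: the right-hand side is a multiple of the identity,
  -- and the deviation is traceless.
  have h1 : (csum d K fun μ => csum d K fun μ' => (cnt d K μ : ℂ)⁻¹ * (cnt d K μ' : ℂ)⁻¹ *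
      star (omega (N - M) φ K μ' μ) * ∑ y : Sites M N, ∑ z : Sites M N, (β y * β z : ℂ) *
        csum d (K - (y.1 \ z.1).card) fun e => csum d (y.1 \ z.1).card fun f =>
          csum d (y.1 \ z.1).card fun g => if e + f = μ ∧ e + g = μ' then
            omega (N - M) φ (y.1 \ z.1).card g f else 0) = 0 := by
    rw [csum_congr fun μ hμ => csum_congr fun μ' hμ' => by rw [h μ μ' hμ hμ'],
      csum_diag (fun μ μ' => star (omega (N - M) φ K μ' μ)), ← csum_star, csum_omega_diag hKN,
      star_zero, mul_zero]
  -- On the left-hand side the partial trace of the deviation on `K` spins is the deviation on `|y \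
  -- z|` spins, so each pair contributes a squared norm with positive coefficient.
  have h2 : ∑ y : Sites M N, ∑ z : Sites M N, (β y * β z : ℂ) *
      (csum d (y.1 \ z.1).card fun f => csum d (y.1 \ z.1).card fun g =>
        omega (N - M) φ (y.1 \ z.1).card g f * star (omega (N - M) φ (y.1 \ z.1).card g f)) = 0 := by
    rw [← h1]
    simp only [Finset.mul_sum, csum_sum]
    refine Finset.sum_congr rfl fun y _ => Finset.sum_congr rfl fun z _ => ?_
    simp only [mul_left_comm _ ((β y : ℂ) * (β z : ℂ)) (csum d _ _)]
    rw [csum_congr fun μ _ => (mul_csum K ((β y : ℂ) * (β z : ℂ)) _).symm, ← mul_csum]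
    congr 1
    symm
    rw [csum_pairing (hK' y z) (fun μ μ' => star (omega (N - M) φ K μ' μ))
      (omega (N - M) φ (y.1 \ z.1).card), csum_comm]
    refine csum_congr fun f _ => (csum_comm _ _ _).trans ?_
    refine csum_congr fun g _ => (csum_mul _ _ _).symm.trans ?_
    rw [← csum_star, csum_omega (hK' y z) hKN, mul_comm]
  have hnn : ∀ k g f, 0 ≤ omega (N - M) φ k g f * star (omega (N - M) φ k g f) :=
    fun k g f => mul_star_self_nonneg _
  have hββ : ∀ y z : Sites M N, 0 < (β y * β z : ℂ) := fun y z => by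
    exact_mod_cast mul_pos (hβ y) (hβ z)
  have hterm : ∀ y z : Sites M N, 0 ≤ (β y * β z : ℂ) *
      (csum d (y.1 \ z.1).card fun f => csum d (y.1 \ z.1).card fun g =>
        omega (N - M) φ (y.1 \ z.1).card g f * star (omega (N - M) φ (y.1 \ z.1).card g f)) :=
    fun y z => mul_nonneg (hββ y z).le
      (Finset.sum_nonneg fun f _ => Finset.sum_nonneg fun g _ => hnn _ _ _)
  obtain ⟨y, z, hyz⟩ := hex
  rw [Finset.sum_eq_zero_iff_of_nonneg fun y _ => Finset.sum_nonneg fun z _ => hterm y z] at h2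
  have h3 := h2 y (Finset.mem_univ y)
  rw [Finset.sum_eq_zero_iff_of_nonneg fun z _ => hterm y z] at h3
  have h4 := (mul_eq_zero.mp (h3 z (Finset.mem_univ z))).resolve_left (hββ y z).ne'
  rw [hyz] at h4
  simp only [csum] at h4
  rw [Finset.sum_eq_zero_iff_of_nonneg fun f _ =>
    Finset.sum_nonneg fun g _ => hnn _ _ _] at h4
  obtain ⟨cf, rfl⟩ := exists_ty_eq K f hf
  obtain ⟨cg, rfl⟩ := exists_ty_eq K g hg
  have h5 := h4 cf (Finset.mem_univ cf)
  rw [Finset.sum_eq_zero_iff_of_nonneg fun g _ => hnn _ _ _] at h5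
  have h6 := h5 cg (Finset.mem_univ cg)
  rcases mul_eq_zero.mp h6 with h7 | h7
  · exact h7
  · exact star_eq_zero.mp h7

/-- A symmetric state with maximally mixed reduced states on `K` spins needs `K` further spins. -/
lemma card_sym_le_of_omega_eq_zero {n K : ℕ} {φ : Multiset (Fin d) → ℂ}
    (hφ : ∃ s : Multiset (Fin d), s.card = n ∧ φ s ≠ 0)
    (h : ∀ f g : Multiset (Fin d), f.card = K → g.card = K → omega n φ K g f = 0) :
    Fintype.card (Sym (Fin d) K) ≤ Fintype.card (Sym (Fin d) (n - K)) := by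
  set κ : ℂ := csum d n fun s => φ s * star (φ s) with hκ
  have hκ0 : κ ≠ 0 := by
    obtain ⟨s, hs, hs0⟩ := hφ
    obtain ⟨c, rfl⟩ := exists_ty_eq n s hs
    intro h0
    rw [hκ, csum, Finset.sum_eq_zero_iff_of_nonneg fun c _ => mul_star_self_nonneg _] at h0
    rcases mul_eq_zero.mp (h0 c (Finset.mem_univ c)) with h1 | h1
    · exact hs0 h1
    · exact hs0 (star_eq_zero.mp h1)
  -- The amplitudes of `φ` across the cut of `K` against `n - K` spins, and their adjoint weighted
  -- by the multiplicities of types. The product is the reduced state, here an invertible diagonal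
  -- matrix, so its rank cannot exceed the dimension of the other side.
  let A : Matrix (Sym (Fin d) K) (Sym (Fin d) (n - K)) ℂ := Matrix.of fun g r => φ (g.1 + r.1)
  let B : Matrix (Sym (Fin d) (n - K)) (Sym (Fin d) K) ℂ := Matrix.of fun r f =>
    (cnt d (n - K) r.1 : ℂ) * star (φ (f.1 + r.1))
  have hAB : A * B = Matrix.diagonal fun f => κ * (mu f.1 : ℂ) := by
    ext g f
    have h1 := h f.1 g.1 f.2 g.2
    rw [omega, sub_eq_zero, csum_fiber] at h1
    rw [Matrix.mul_apply, Matrix.diagonal_apply]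
    have h2 : (∑ r, A g r * B r f) = ∑ r : Sym (Fin d) (n - K), (cnt d (n - K) (r : Multiset (Fin d)) : ℂ) *
        (φ (g.1 + r) * star (φ (f.1 + r))) := by
      refine Finset.sum_congr rfl fun r _ => ?_
      simp only [A, B, Matrix.of_apply]
      exact mul_left_comm _ _ _
    rw [h2, h1]
    by_cases hgf : g = f
    · subst hgf
      rw [if_pos rfl, if_pos rfl]
    · rw [if_neg hgf, if_neg]
      exact fun h => hgf (Subtype.ext h.symm)
  have hdet : (A * B).rank = Fintype.card (Sym (Fin d) K) := by
    rw [hAB, Matrix.rank_diagonal]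
    exact Fintype.card_congr (Equiv.subtypeUnivEquiv fun f =>
      mul_ne_zero hκ0 (Complex.ofReal_ne_zero.mpr (mu_pos f.1).ne'))
  rw [← hdet]
  exact (Matrix.rank_mul_le_left A B).trans (Matrix.rank_le_card_width A)

end Economical

/-! ### Economical optimal cloners -/

section Main

variable {d M N : ℕ}

lemma card_sym_strictMono (hd : 2 ≤ d) : StrictMono fun n => Fintype.card (Sym (Fin d) n) := by
  obtain ⟨e, rfl⟩ : ∃ e, d = e + 2 := ⟨d - 2, by omega⟩
  refine strictMono_nat_of_lt_succ fun n => ?_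
  simp only [Sym.card_sym_eq_multichoose, Fintype.card_fin]
  rw [Nat.multichoose_succ_succ]
  have h : 0 < (e + 1).multichoose (n + 1) := by
    rw [Nat.multichoose_eq]
    exact Nat.choose_pos (by omega)
  exact Nat.lt_add_of_pos_left h

/-- The largest value of `|y \ z|` is attained by exchanging `K` sites of `y` for `K` sites of its
complement. -/
lemma exists_card_sdiff_eq {K : ℕ} (hKM : K ≤ M) (hKN : K ≤ N - M) (hMN : M ≤ N) :
    ∃ y z : Sites M N, (y.1 \ z.1).card = K := by
  obtain ⟨y, -, hy⟩ := Finset.exists_subset_card_eq (s := (Finset.univ : Finset (Fin N))) (n := M)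
    (by simpa using hMN)
  obtain ⟨s, hs, hsc⟩ := Finset.exists_subset_card_eq (s := y) (n := M - K) (by omega)
  obtain ⟨t, ht, htc⟩ := Finset.exists_subset_card_eq (s := yᶜ) (n := K)
    (by rw [Finset.card_compl, hy, Fintype.card_fin]; exact hKN)
  have hdisj : Disjoint s t := Finset.disjoint_of_subset_left hs
    (Finset.disjoint_of_subset_right ht disjoint_compl_right)
  refine ⟨⟨y, hy⟩, ⟨s ∪ t, by rw [Finset.card_union_of_disjoint hdisj, hsc, htc]; omega⟩, ?_⟩
  have h1 : y \ (s ∪ t) = y \ s := by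
    ext k
    simp only [Finset.mem_sdiff, Finset.mem_union, not_or]
    exact ⟨fun h => ⟨h.1, h.2.1⟩, fun h => ⟨h.1, h.2, fun hk => Finset.mem_compl.mp (ht hk) h.1⟩⟩
  rw [h1, Finset.card_sdiff_of_subset hs, hy, hsc]
  omega

variable [NeZero d] {α : Finset (Fin N) → ℝ} {lam : ℝ}

lemma three_mul_le (hd : 2 ≤ d) (hM : 0 < M) (hMN : M < N) (hα : ∀ x, 0 ≤ α x)
    (hn : ∀ k : Fin N, ∃ x, k ∈ x ∧ 0 < α x) (h : IsMaxEigenvalue (cloningOp d M α) lam)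
    {E : Op d M →ₗ[ℂ] Op d N} (hE : IsChannel E) (hE' : IsEconomical E)
    (hF : cloningFidelity α E = lam) : 3 * M ≤ N := by
  obtain ⟨x, -, hx⟩ := hn ⟨0, by omega⟩
  obtain ⟨β, hβ, hβ0, hev⟩ := exists_optimal hMN.le hα ⟨x, hx⟩ h
  have hβpos := pos_of_eigen hd hα hM hMN.le hn hβ hβ0 hev
  obtain ⟨v, hv⟩ := hE'.choiState_eq
  have htrace : (Matrix.vecMulVec v (star v)).trace = 1 := by rw [← hv, trace_choiState hE]
  have hvT : v ∈ eigSet d M α lam := h.eigenvector_of_trace_eq (cloneMat_isHermitian α) htrace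
    (by rw [← hv, ← cloningFidelity_eq, hF])
  obtain ⟨φ, hφ⟩ := exists_phi h hα hM hMN.le hn hβ hβ0 hev hvT
  obtain ⟨C, hC⟩ := exists_sum_omega hφ fun a a' => by
    have h1 := congrFun (congrFun (traceOut_choiState hE) a) a'
    rw [hv] at h1
    exact h1
  have hKM : min M (N - M) ≤ M := min_le_left _ _
  have hKN : min M (N - M) ≤ N - M := min_le_right _ _
  have hK' : ∀ y z : Sites M N, (y.1 \ z.1).card ≤ min M (N - M) := fun y z =>
    le_min (card_sdiff_le y z).1 (card_sdiff_le y z).2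
  have hφ0 : ∃ s : Multiset (Fin d), s.card = N - M ∧ φ s ≠ 0 := by
    by_contra! hcon
    have hv0 : v = 0 := by
      funext p
      rw [hφ p]
      refine Finset.sum_eq_zero fun y _ => ?_
      rw [hcon _ (by rw [card_tyOn, Finset.card_compl, y.2, Fintype.card_fin])]
      simp
    rw [hv0] at htrace
    simp [Matrix.trace, Matrix.vecMulVec_apply] at htrace
  have h2 := card_sym_le_of_omega_eq_zero hφ0 fun f g hf hg =>
    omega_eq_zero hβpos hKN hK' (fun μ μ' hμ hμ' => sum_omega_of_le hKM hK' hC hμ hμ')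
      (exists_card_sdiff_eq hKM hKN hMN.le) hf hg
  have h3 := (card_sym_strictMono hd).le_iff_le.mp h2
  -- Here `min M (N - M) ≤ N - M - min M (N - M)`. If the minimum were `N - M`, this would
  -- contradict `M < N`; so it is `M`.
  omega

/-- The bound given by the maximum eigenvalue is attained. -/
lemma exists_optimal_channel (hMN : M ≤ N) (hα : ∀ x, 0 ≤ α x) (hα1 : ∃ x, 0 < α x)
    (h : IsMaxEigenvalue (cloningOp d M α) lam) :
    ∃ β : Sites M N → ℝ, (∀ x, 0 ≤ β x) ∧
      cloningOp d M α * mixedCloneState d M N β = (lam : ℂ) • mixedCloneState d M N β ∧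
      traceOut (mixedCloneState d M N β) = (symDim d M : ℂ)⁻¹ • symProj d M ∧
      ∃ E : Op d M →ₗ[ℂ] Op d N, IsChannel E ∧
        choiState E = mixedCloneState d M N β ∧ cloningFidelity α E = lam := by
  obtain ⟨β, hβ, hβ0, hev⟩ := exists_optimal hMN hα hα1 h
  have hpos := normSq_pos (d := d) hβ hβ0
  -- The norm is quadratic in `β`, so this rescaling makes the reduced state on IN exactly the
  -- maximally mixed one.
  set c : ℝ := (Real.sqrt (normSq d β))⁻¹ with hc
  have hnorm : normSq d (c • β) = 1 := by
    have h1 : normSq d (c • β) = c ^ 2 * normSq d β := by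
      simp only [normSq, Pi.smul_apply, smul_eq_mul, Finset.mul_sum]
      exact Finset.sum_congr rfl fun y _ => Finset.sum_congr rfl fun z _ => by ring
    rw [h1, hc, inv_pow, Real.sq_sqrt hpos.le, inv_mul_cancel₀ hpos.ne']
  have hR : cloningOp d M α * mixedCloneState d M N (c • β) =
      (lam : ℂ) • mixedCloneState d M N (c • β) := by
    refine cloningOp_mul_mixedCloneState fun τ => ?_
    rw [uvec_smul, Matrix.mulVec_smul, hev, smul_comm]
  have htr : traceOut (mixedCloneState d M N (c • β)) = (symDim d M : ℂ)⁻¹ • symProj d M := by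
    rw [traceOut_mixedCloneState, hnorm, Complex.ofReal_one, one_smul]
  obtain ⟨E, hE, hchoi⟩ := exists_channel_mixedCloneState hnorm
  refine ⟨c • β, fun y => mul_nonneg (by positivity) (hβ y), hR, htr, E, hE, hchoi, ?_⟩
  rw [cloningFidelity_eq, Matrix.trace_mul_comm, hchoi, hR, ← hchoi, Matrix.trace_smul,
    trace_choiState hE]
  simp

end Main

end QClone

end

theorem mainTheorem4 (d M N : ℕ) [NeZero d] (hM : 0 < M) (hMN : M < N)
    (α : Finset (Fin N) → ℝ) (hα0 : ∀ x, 0 ≤ α x) (hα1 : ∑ x, α x = 1) :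
    ∃ lam : ℝ, IsMaxEigenvalue (cloningOp d M α) lam ∧
      -- `lam` bounds the fidelity of every channel
      (∀ E : Op d M →ₗ[ℂ] Op d N, IsChannel E → cloningFidelity α E ≤ lam) ∧
      -- and it is attained, through the mixed symmetric state on the remaining spins
      (∃ β : Sites M N → ℝ, (∀ x, 0 ≤ β x) ∧
        cloningOp d M α * mixedCloneState d M N β = (lam : ℂ) • mixedCloneState d M N β ∧
        traceOut (mixedCloneState d M N β) = (symDim d M : ℂ)⁻¹ • symProj d M ∧
        ∃ E : Op d M →ₗ[ℂ] Op d N, IsChannel E ∧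
          choiState E = mixedCloneState d M N β ∧ cloningFidelity α E = lam) ∧
      -- necessary condition for an economical optimal cloner
      (2 ≤ d → (∀ n : Fin N, ∃ x : Finset (Fin N), n ∈ x ∧ 0 < α x) →
        ∀ E : Op d M →ₗ[ℂ] Op d N, IsChannel E → IsEconomical E →
          cloningFidelity α E = lam → 3 * M ≤ N) := by
  have hα1' : ∃ x, 0 < α x := by
    by_contra! hcon
    have h0 : ∑ x, α x ≤ 0 := Finset.sum_nonpos fun x _ => hcon x
    rw [hα1] at h0
    exact absurd h0 (by norm_num)
  obtain ⟨lam, h⟩ := exists_isMaxEigenvalue (cloneMat_isHermitian (d := d) (M := M) α)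
  exact ⟨lam, h, fun E hE => cloningFidelity_le h hE,
    exists_optimal_channel hMN.le hα0 hα1' h,
    fun hd hn E hE hE' hF => three_mul_le hd hM hMN hα0 hn h hE hE' hF⟩
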